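/- Let $R\subset\mathbb R^N\setminus\{0\}$ be a reduced root system: a finite set, invariant under the reflections $\sigma_\alpha x=x-2\frac{\alpha\cdot x}{\|\alpha\|^2}\alpha$ ($\alpha\in R$), such that $\alpha=c\,\xi$ with $\alpha,\xi\in R$ forces $c=\pm1$. Fix a vector $m$ orthogonal to no root, let $R_+=\{\alpha\in R: m\cdot\alpha>0\}$, let $W$ be the finite group generated by the $\sigma_\alpha$, and let $C_W=\{x:\alpha\cdot x\ge 0\ \forall\alpha\in R_+\}$. For $\beta>1$ consider the Dunkl process on $\mathbb R^N$ with all multiplicities equal to $\beta/2$ (the process with generator $\tfrac12\Delta_k=\tfrac12\sum_i T_i^2$, $T_i$ the Dunkl operators). Its transition density is $$p_\beta(t,y|x_0)=\frac{e^{-(\|x_0\|^2+\|y\|^2)/2t}}{c_\beta t^{N/2}}E_\beta\Big(\frac{x_0}{\sqrt t},\frac y{\sqrt t}\Big)w_\beta\Big(\frac{y}{\sqrt t}\Big),\qquad w_\beta(x)=\prod_{\alpha\in R_+}|\alpha\cdot x|^\beta,\qquad c_\beta=\int_{\mathbb R^N}e^{-\|x\|^2/2}w_\beta(x)\,dx,$$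 where $E_\beta$ is the Dunkl kernel ($E_\beta(0,y)=E_\beta(x,0)=1$, $T_iE_\beta(\cdot,y)=y_iE_\beta(\cdot,y)$). The associated jump process on $W$ jumps from $\tau$ to $\tau\sigma_\alpha$ at rate $$\lambda_\beta(t,\alpha|x_0)=\frac{\beta\|\alpha\|^2}{4}\int_{C_W}\frac{1}{(\alpha\cdot x)^2}\sum_{\rho\in W}p_\beta(t,x|\rho x_0)\,dx .$$ For the process started at $x_0=0$ the master equation is $\partial_tP(t)=t^{-1}M(\beta)P(t)$ with the symmetric $W\times W$ matrix $$M_{\tau\nu}(\beta)=\sum_{\alpha\in R_+}\lambda_\beta(1,\alpha|0)\,(\delta_{\tau\sigma_\alpha,\nu}-\delta_{\tau,\nu}).$$ Let $r_0(\beta)\ge r_1(\beta)\ge\dots\ge r_{|W|-1}(\beta)$ be its eigenvalues, repeated according to multiplicity; $r_0(\beta)=0$ is the equilibrium eigenvalue and the $r_i(\beta)$ with $i\ge1$ are the dynamical (relaxation) exponents. **Theorem.** The limit $M^{(0)}=\lim_{\beta\to\infty}M(\beta)$ exists and is symmetric. Let $r_0^{(0)}\ge r_1^{(0)}\ge\dots$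 be its eigenvalues, repeated according to multiplicity. There are constants $r_i^{(1)}<0$ ($1\le i\le |W|-1$) and constants $A,K$, depending only on $R$ (with its choice of $R_+$), such that for every $M>0$ there is a constant $C(M)$ with $1<C(M)\le A(1+M)$ for which $$\Big|\,r_i(\beta)+|r_i^{(0)}|+\frac{|r_i^{(1)}|}{\beta}\,\Big|\le K\big(\beta^{-2}+e^{-M}\big)\qquad\text{for all }\beta>C(M)\text{ and all }1\le i\le |W|-1 .$$ -/

import Mathlib

open Filter Topology MeasureTheory
open scoped Matrix

noncomputable section

/-- The orthogonal reflection `x ↦ x - 2 (α·x / ‖α‖²) α` along `α`. -/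
def dunklRefl {N : ℕ} (α : EuclideanSpace ℝ (Fin N)) :
    EuclideanSpace ℝ (Fin N) ≃ₗᵢ[ℝ] EuclideanSpace ℝ (Fin N) :=
  (Submodule.span ℝ {α})ᗮ.reflection

theorem dunklRefl_apply {N : ℕ} (α x : EuclideanSpace ℝ (Fin N)) :
    dunklRefl α x = x - (2 * (inner ℝ α x / ‖α‖ ^ 2)) • α := by
  rw [dunklRefl, Submodule.reflection_orthogonal_apply, Submodule.reflection_singleton_apply]
  simp only [two_smul, two_mul, add_smul, RCLike.ofReal_real_eq_id, id_eq]
  abel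

theorem dunklRefl_mul_self {N : ℕ} (α : EuclideanSpace ℝ (Fin N)) :
    dunklRefl α * dunklRefl α = 1 :=
  Submodule.reflection_mul_reflection _

/-- A reduced (not necessarily crystallographic, irreducible or spanning) root system in `ℝ^N`
together with a vector `m`, orthogonal to no root, that selects the positive subsystem. -/
structure DunklRootSystem (N : ℕ) where
  /-- the roots -/
  roots : Finset (EuclideanSpace ℝ (Fin N))
  zero_notMem : (0 : EuclideanSpace ℝ (Fin N)) ∉ roots
  refl_mem : ∀ α ∈ roots, ∀ ξ ∈ roots, dunklRefl α ξ ∈ roots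
  reduced : ∀ α ∈ roots, ∀ ξ ∈ roots, ∀ c : ℝ, α = c • ξ → c = 1 ∨ c = -1
  /-- the vector selecting the positive roots -/
  m : EuclideanSpace ℝ (Fin N)
  regular : ∀ α ∈ roots, (inner ℝ m α : ℝ) ≠ 0

namespace DunklRootSystem

variable {N : ℕ}

/-- The reflection (Weyl) group `W`. -/
def weylGroup (R : DunklRootSystem N) :
    Subgroup (EuclideanSpace ℝ (Fin N) ≃ₗᵢ[ℝ] EuclideanSpace ℝ (Fin N)) :=
  Subgroup.closure (dunklRefl '' (R.roots : Set (EuclideanSpace ℝ (Fin N))))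

theorem weylGroup_image_roots (R : DunklRootSystem N)
    {w : EuclideanSpace ℝ (Fin N) ≃ₗᵢ[ℝ] EuclideanSpace ℝ (Fin N)} (hw : w ∈ R.weylGroup) :
    w '' (R.roots : Set (EuclideanSpace ℝ (Fin N))) = R.roots := by
  induction hw using Subgroup.closure_induction with
  | mem x hx =>
    obtain ⟨α, hα, rfl⟩ := hx
    apply Set.Subset.antisymm
    · rintro _ ⟨ξ, hξ, rfl⟩
      exact R.refl_mem α hα ξ hξ
    · intro ξ hξ
      refine ⟨dunklRefl α ξ, R.refl_mem α hα ξ hξ, ?_⟩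
      exact Submodule.reflection_reflection _ ξ
  | one => simp
  | mul x y _ _ hx hy =>
    have : (⇑(x * y) : EuclideanSpace ℝ (Fin N) → EuclideanSpace ℝ (Fin N)) = x ∘ y := rfl
    rw [this, Set.image_comp, hy, hx]
  | inv x _ hx =>
    conv_lhs => rw [← hx]
    rw [← Set.image_comp]
    have : (⇑(x⁻¹) ∘ ⇑x : EuclideanSpace ℝ (Fin N) → EuclideanSpace ℝ (Fin N)) = id := by
      funext v
      exact x.symm_apply_apply v
    rw [this, Set.image_id]

theorem weylGroup_fix_orthogonal (R : DunklRootSystem N)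
    {w : EuclideanSpace ℝ (Fin N) ≃ₗᵢ[ℝ] EuclideanSpace ℝ (Fin N)} (hw : w ∈ R.weylGroup)
    {v : EuclideanSpace ℝ (Fin N)} (hv : ∀ α ∈ R.roots, (inner ℝ α v : ℝ) = 0) : w v = v := by
  induction hw using Subgroup.closure_induction with
  | mem x hx =>
    obtain ⟨α, hα, rfl⟩ := hx
    rw [dunklRefl_apply, hv α hα]
    simp
  | one => rfl
  | mul x y _ _ hx hy =>
    change x (y v) = v
    rw [hy, hx]
  | inv x _ hx =>
    change x.symm v = v
    rw [LinearIsometryEquiv.symm_apply_eq, hx]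

instance finite_weylGroup (R : DunklRootSystem N) : Finite R.weylGroup := by
  let f : R.weylGroup → (R.roots → R.roots) := fun w α =>
    ⟨w.1 α.1, by
      have h := R.weylGroup_image_roots w.2
      have h2 : w.1 α.1 ∈ w.1 '' (R.roots : Set (EuclideanSpace ℝ (Fin N))) :=
        ⟨α.1, α.2, rfl⟩
      rw [h] at h2
      exact h2⟩
  refine Finite.of_injective f ?_
  intro w w' h
  apply Subtype.ext
  apply LinearIsometryEquiv.ext
  intro x
  have hR : ∀ α ∈ R.roots, w.1 α = w'.1 α := by
    intro α hα
    exact congrArg Subtype.val (congrFun h ⟨α, hα⟩)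
  let K := Submodule.span ℝ (R.roots : Set (EuclideanSpace ℝ (Fin N)))
  have hK : ∀ y ∈ K, w.1 y = w'.1 y := by
    intro y hy
    induction hy using Submodule.span_induction with
    | mem a ha => exact hR a ha
    | zero => simp
    | add a b _ _ ha hb => rw [map_add, map_add, ha, hb]
    | smul c a _ ha => rw [map_smul, map_smul, ha]
  obtain ⟨y, hy, v, hv, rfl⟩ := K.exists_add_mem_mem_orthogonal x
  have hv' : ∀ α ∈ R.roots, (inner ℝ α v : ℝ) = 0 := fun α hα =>
    (Submodule.mem_orthogonal K v).1 hv α (Submodule.subset_span hα)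
  rw [map_add, map_add, hK y hy, R.weylGroup_fix_orthogonal w.2 hv',
    R.weylGroup_fix_orthogonal w'.2 hv']

instance fintype_weylGroup (R : DunklRootSystem N) : Fintype R.weylGroup :=
  Fintype.ofFinite _

instance decidableEq_weylGroup (R : DunklRootSystem N) : DecidableEq R.weylGroup :=
  Classical.decEq _

open Classical in
/-- The positive subsystem `R₊`. -/
def posRoots (R : DunklRootSystem N) : Finset (EuclideanSpace ℝ (Fin N)) :=
  R.roots.filter fun α => 0 < (inner ℝ R.m α : ℝ)

/-- The closed Weyl chamber `C_W`. -/
def chamber (R : DunklRootSystem N) : Set (EuclideanSpace ℝ (Fin N)) :=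
  {x | ∀ α ∈ R.posRoots, 0 ≤ (inner ℝ α x : ℝ)}

/-- The Dunkl operator `T_i` when all multiplicities equal `β/2`; the formula is meant at points
`x` off the reflecting hyperplanes. -/
def dunklOp (R : DunklRootSystem N) (β : ℝ) (i : Fin N) (f : EuclideanSpace ℝ (Fin N) → ℝ)
    (x : EuclideanSpace ℝ (Fin N)) : ℝ :=
  fderiv ℝ f x (EuclideanSpace.single i 1) +
    β / 2 * ∑ α ∈ R.posRoots, (f x - f (dunklRefl α x)) / (inner ℝ α x : ℝ) * α i

/-- The defining relations of the Dunkl kernel: `E(0, y) = E(x, 0) = 1`, and `E(·, y)` is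
real-analytic with `T_i E(·, y) = y_i E(·, y)` (off the reflecting hyperplanes, hence everywhere
by continuity). -/
structure IsDunklKernel (R : DunklRootSystem N) (β : ℝ)
    (E : EuclideanSpace ℝ (Fin N) → EuclideanSpace ℝ (Fin N) → ℝ) : Prop where
  zero_left : ∀ y, E 0 y = 1
  zero_right : ∀ x, E x 0 = 1
  analytic : ∀ y, AnalyticOnNhd ℝ (fun x => E x y) Set.univ
  eigen : ∀ x y, (∀ α ∈ R.roots, (inner ℝ α x : ℝ) ≠ 0) →
    ∀ i, R.dunklOp β i (fun x => E x y) x = y i * E x y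

open Classical in
/-- The Dunkl kernel. It exists and is unique for every `β > 0`; the second branch only makes the
definition total. -/
def dunklKernel (R : DunklRootSystem N) (β : ℝ) :
    EuclideanSpace ℝ (Fin N) → EuclideanSpace ℝ (Fin N) → ℝ :=
  if h : ∃ E, R.IsDunklKernel β E then h.choose else fun _ _ => 1

/-- The weight `w_β(x) = ∏_{α ∈ R₊} |α·x|^β`. -/
def weight (R : DunklRootSystem N) (β : ℝ) (x : EuclideanSpace ℝ (Fin N)) : ℝ :=
  ∏ α ∈ R.posRoots, |(inner ℝ α x : ℝ)| ^ β

/-- The Selberg-type normalization `c_β`. -/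
def selbergConst (R : DunklRootSystem N) (β : ℝ) : ℝ :=
  ∫ x : EuclideanSpace ℝ (Fin N), Real.exp (-‖x‖ ^ 2 / 2) * R.weight β x

/-- The transition density `p(t, y | x₀)` of the Dunkl process. -/
def density (R : DunklRootSystem N) (β t : ℝ) (y x₀ : EuclideanSpace ℝ (Fin N)) : ℝ :=
  Real.exp (-(‖x₀‖ ^ 2 + ‖y‖ ^ 2) / (2 * t)) / (R.selbergConst β * t ^ ((N : ℝ) / 2)) *
    R.dunklKernel β ((Real.sqrt t)⁻¹ • x₀) ((Real.sqrt t)⁻¹ • y) *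
    R.weight β ((Real.sqrt t)⁻¹ • y)

/-- The transition density `p̂(t, y | x₀) = ∑_{ρ ∈ W} p(t, y | ρ x₀)` of the radial Dunkl
process, a probability density on the chamber. -/
def radialDensity (R : DunklRootSystem N) (β t : ℝ) (y x₀ : EuclideanSpace ℝ (Fin N)) : ℝ :=
  ∑ ρ : R.weylGroup, R.density β t y (ρ.1 x₀)

/-- The rate `λ_β(t, α | x₀)` of the jumps `τ → τ σ_α` of the Dunkl jump process. -/
def jumpRate (R : DunklRootSystem N) (β t : ℝ) (α x₀ : EuclideanSpace ℝ (Fin N)) : ℝ :=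
  β * ‖α‖ ^ 2 / 4 *
    ∫ x in R.chamber, 1 / (inner ℝ α x : ℝ) ^ 2 * R.radialDensity β t x x₀

/-- The total jump rate `Λ_β(t | x₀)`. -/
def totalRate (R : DunklRootSystem N) (β t : ℝ) (x₀ : EuclideanSpace ℝ (Fin N)) : ℝ :=
  ∑ α ∈ R.posRoots, R.jumpRate β t α x₀

open Classical in
/-- The matrix `M_{τν} = ∑_{α ∈ R₊} λ_β(1, α | 0) δ_{τσ_α, ν} - Λ_β(1 | 0) δ_{τ, ν}`. For the
process started at `0` the master equation is `∂_t P(t) = t⁻¹ M P(t)`. -/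
def transitionMatrix (R : DunklRootSystem N) (β : ℝ) :
    Matrix R.weylGroup R.weylGroup ℝ :=
  Matrix.of fun τ ν =>
    ∑ α ∈ R.posRoots, R.jumpRate β 1 α 0 * (if τ.1 * dunklRefl α = ν.1 then 1 else 0)
      - R.totalRate β 1 0 * (if τ = ν then 1 else 0)

open Classical in
theorem transitionMatrix_isHermitian (R : DunklRootSystem N) (β : ℝ) :
    (R.transitionMatrix β).IsHermitian := by
  ext τ ν
  have h : ∀ α, (ν.1 * dunklRefl α = τ.1) ↔ (τ.1 * dunklRefl α = ν.1) := by
    intro α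
    constructor
    · intro h
      rw [← h, mul_assoc, dunklRefl_mul_self, mul_one]
    · intro h
      rw [← h, mul_assoc, dunklRefl_mul_self, mul_one]
  simp only [Matrix.conjTranspose_apply, transitionMatrix, Matrix.of_apply, star_trivial]
  congr 1
  · refine Finset.sum_congr rfl fun α _ => ?_
    congr 1
    exact if_congr (h α) rfl rfl
  · congr 1
    exact if_congr eq_comm rfl rfl

/-- The dynamical (relaxation) exponents `r_0(β) ≥ r_1(β) ≥ ⋯ ≥ r_{|W|-1}(β)` of the Dunkl jump
process started at `0`: the eigenvalues of `M`, repeated according to multiplicity. -/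
def relaxationExponent (R : DunklRootSystem N) (β : ℝ) : Fin (Fintype.card R.weylGroup) → ℝ :=
  (R.transitionMatrix_isHermitian β).eigenvalues₀

end DunklRootSystem

end

/-!
At `x₀ = 0` the Dunkl kernel equals `1`, so the jump rates are explicit moments. After scaling
`x = √β u`, and because the reflection group permutes the chambers simply transitively,
`λ_α(β) = ¼ ‖α‖² E[(α · u)⁻²]`, the mean being taken for the probability measure proportional to
`exp (-β F)` on the chamber, `F(u) = ‖u‖²/2 - ∑_α log (α · u)` (`jumpRate_eq`).

*Expansion of the rates.* As `β → ∞` the measure concentrates at the critical point `s` of `F`,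
that is `s = ∑_α α / (α · s)`. Integration by parts turns moment bounds into one another and
yields `λ_α(β) = λ⁰_α + λ¹_α / β + O(β⁻²)` (`exists_expansion_sq`), with the means of `(α · u)⁻²`
and similar singular functions controlled by further integrations by parts with a shifted
exponent.

*Perturbation theory.* The matrix is thus `M₀ + β⁻¹ M₁ + O(β⁻²)`. A rotation `1 + β⁻¹ X` that
removes the part of `M₁` mapping between different eigenspaces of `M₀`, followed by the
Courant–Fischer principle, shows that the ordered eigenvalues are
`μ_i + β⁻¹ ⟨φ_i, M₁ φ_i⟩ + O(β⁻²)` for an adapted orthonormal eigenbasis of `M₀`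
(`LinearMap.IsSymmetric.exists_eigenvalues_expansion`). The error term `e^{-M}` of the statement
is not needed, and `C(M)` can be taken constant.

*Sign of the correction.* Some of the `λ¹_α` are negative, so `⟨φ, M₁ φ⟩ < 0` for nonconstant
eigenvectors needs an argument. Functions on the group are restrictions of polynomials to the free
orbit of `s`, and `-2 M₀` is the restriction of a differential-difference operator `A` that maps a
polynomial of degree `m` to `m` times itself, up to lower order. Hence the eigenvalues of `-2 M₀`
are natural numbers, an eigenfunction `φ` of eigenvalue `m` is the restriction of a polynomial `p`
of degree at most `m` with `A p = m p`, and `φ` is orthogonal to the restrictions of all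
polynomials of smaller degree (`exists_polynomial_lift`). The equation `A p = m p` holds on the
whole chamber, and integrating it against the Gibbs measure gives an exact formula for
`⟨φ, M(β) φ⟩` (`inner_reflSum_meanSq`) whose leading correction is the sum over an eigenbasis
`v_k` of the Hessian of `F` at `s`, with eigenvalues `h_k`, of `h_k⁻¹ ⟨B_k φ, a_k⟩`. Here `a_k` is
the derivative of `p` along `v_k`, and `B_k` is minus the derivative of the frozen generator along
`v_k`. Differentiating `A p = m p` at `s` gives `(-2 M₀ + h_k - m) a_k = B_k φ`, and since `B_k`
raises degrees by less than `h_k`, the components of `B_k φ` with negative `-2 M₀ + h_k - m`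
vanish; so every term is nonnegative (`inner_reflSum_orbitGrad_nonneg`). They cannot all vanish,
because the same operator for the direction `s` maps `φ` to `2 m φ`.
-/

/-! ### The reflection group acts simply transitively on the chambers -/

theorem dunklRefl_self {N : ℕ} (α : EuclideanSpace ℝ (Fin N)) : dunklRefl α α = -α := by
  rcases eq_or_ne α 0 with rfl | h
  · simp
  · have : ‖α‖ ^ 2 ≠ 0 := by positivity
    rw [dunklRefl_apply, real_inner_self_eq_norm_sq, div_self this, mul_one, two_smul]
    abel

theorem dunklRefl_neg {N : ℕ} (α : EuclideanSpace ℝ (Fin N)) : dunklRefl (-α) = dunklRefl α := by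
  ext1 x
  simp [dunklRefl_apply, inner_neg_left, neg_div]

theorem inner_dunklRefl {N : ℕ} (α x y : EuclideanSpace ℝ (Fin N)) :
    (inner ℝ x (dunklRefl α y) : ℝ) =
      inner ℝ x y - 2 * (inner ℝ α y / ‖α‖ ^ 2) * inner ℝ x α := by
  rw [dunklRefl_apply, inner_sub_right, real_inner_smul_right]

theorem dunklRefl_map {N : ℕ} (w : EuclideanSpace ℝ (Fin N) ≃ₗᵢ[ℝ] EuclideanSpace ℝ (Fin N))
    (α : EuclideanSpace ℝ (Fin N)) : dunklRefl (w α) = w * dunklRefl α * w⁻¹ := by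
  ext1 x
  change _ = w (dunklRefl α (w.symm x))
  rw [dunklRefl_apply, dunklRefl_apply, map_sub, map_smul, w.apply_symm_apply, w.norm_map,
    ← w.inner_map_map α, w.apply_symm_apply]

namespace DunklRootSystem

variable {N : ℕ} (R : DunklRootSystem N)

theorem mem_posRoots {α : EuclideanSpace ℝ (Fin N)} :
    α ∈ R.posRoots ↔ α ∈ R.roots ∧ 0 < (inner ℝ R.m α : ℝ) := by
  simp [posRoots]

theorem ne_zero_of_mem_posRoots {α : EuclideanSpace ℝ (Fin N)} (h : α ∈ R.posRoots) : α ≠ 0 := by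
  rintro rfl
  exact R.zero_notMem (R.mem_posRoots.1 h).1

theorem norm_pos_of_mem_posRoots {α : EuclideanSpace ℝ (Fin N)} (h : α ∈ R.posRoots) :
    0 < ‖α‖ :=
  norm_pos_iff.2 (R.ne_zero_of_mem_posRoots h)

theorem neg_mem_roots {α : EuclideanSpace ℝ (Fin N)} (h : α ∈ R.roots) : -α ∈ R.roots := by
  rw [← dunklRefl_self]
  exact R.refl_mem α h α h

theorem mem_posRoots_or_neg {α : EuclideanSpace ℝ (Fin N)} (h : α ∈ R.roots) :
    α ∈ R.posRoots ∨ -α ∈ R.posRoots := by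
  rcases lt_or_gt_of_ne (R.regular α h) with h1 | h1
  · right
    rw [mem_posRoots, inner_neg_right]
    exact ⟨R.neg_mem_roots h, by linarith⟩
  · left
    exact R.mem_posRoots.2 ⟨h, h1⟩

theorem neg_notMem_posRoots {α : EuclideanSpace ℝ (Fin N)} (h : α ∈ R.posRoots) :
    -α ∉ R.posRoots := by
  intro h'
  have h1 := (R.mem_posRoots.1 h).2
  have h2 := (R.mem_posRoots.1 h').2
  rw [inner_neg_right] at h2
  linarith

theorem weylGroup_map_mem {w : EuclideanSpace ℝ (Fin N) ≃ₗᵢ[ℝ] EuclideanSpace ℝ (Fin N)}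
    (hw : w ∈ R.weylGroup) {α : EuclideanSpace ℝ (Fin N)} (h : α ∈ R.roots) : w α ∈ R.roots := by
  have h2 : w α ∈ w '' (R.roots : Set (EuclideanSpace ℝ (Fin N))) := ⟨α, h, rfl⟩
  rw [R.weylGroup_image_roots hw] at h2
  exact h2

theorem dunklRefl_mem_weylGroup {α : EuclideanSpace ℝ (Fin N)} (h : α ∈ R.roots) :
    dunklRefl α ∈ R.weylGroup :=
  Subgroup.subset_closure ⟨α, h, rfl⟩

/-- The open Weyl chamber. -/
def openChamber : Set (EuclideanSpace ℝ (Fin N)) :=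
  {x | ∀ α ∈ R.posRoots, 0 < (inner ℝ α x : ℝ)}

theorem m_mem_openChamber : R.m ∈ R.openChamber := fun α h => by
  rw [real_inner_comm]
  exact (R.mem_posRoots.1 h).2

/-- A positive root `α` is simple when `σ_α` permutes the positive roots other than `α`. -/
def IsSimpleRoot (α : EuclideanSpace ℝ (Fin N)) : Prop :=
  α ∈ R.posRoots ∧ ∀ γ ∈ R.posRoots, γ ≠ α → dunklRefl α γ ∈ R.posRoots

/-- Nonnegative combinations of a finite set of vectors. -/
def InCone (Δ : Finset (EuclideanSpace ℝ (Fin N))) (x : EuclideanSpace ℝ (Fin N)) : Prop :=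
  ∃ c : EuclideanSpace ℝ (Fin N) → ℝ, (∀ α, 0 ≤ c α) ∧ x = ∑ α ∈ Δ, c α • α

theorem inCone_of_mem {Δ : Finset (EuclideanSpace ℝ (Fin N))} {x : EuclideanSpace ℝ (Fin N)}
    (h : x ∈ Δ) : InCone Δ x := by
  classical
  refine ⟨fun α => if α = x then 1 else 0, fun α => by dsimp only; split_ifs <;> norm_num, ?_⟩
  simp [ite_smul, h]

theorem InCone.trans {Δ Δ' : Finset (EuclideanSpace ℝ (Fin N))} {x : EuclideanSpace ℝ (Fin N)}
    (h : InCone Δ x) (h' : ∀ α ∈ Δ, InCone Δ' α) : InCone Δ' x := by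
  classical
  obtain ⟨c, hc, rfl⟩ := h
  choose! d hd hd' using h'
  refine ⟨fun β => ∑ α ∈ Δ, if α ∈ Δ then c α * d α β else 0, fun β => ?_, ?_⟩
  · refine Finset.sum_nonneg fun α hα => ?_
    rw [if_pos hα]
    exact mul_nonneg (hc α) (hd α hα β)
  · simp_rw [Finset.sum_smul]
    rw [Finset.sum_comm]
    refine Finset.sum_congr rfl fun α hα => ?_
    simp_rw [if_pos hα, mul_smul]
    rw [← Finset.smul_sum, ← hd' α hα]

/-- A minimal set of positive roots whose cone contains all positive roots consists of simple
roots; pairing `δ` with itself, some simple root makes an acute angle with `δ`. -/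
theorem exists_isSimpleRoot_inner_pos {δ : EuclideanSpace ℝ (Fin N)} (hδ : δ ∈ R.posRoots) :
    ∃ α, R.IsSimpleRoot α ∧ 0 < (inner ℝ α δ : ℝ) := by
  classical
  let S : Finset (Finset (EuclideanSpace ℝ (Fin N))) :=
    R.posRoots.powerset.filter fun Δ => ∀ γ ∈ R.posRoots, InCone Δ γ
  have hS : S.Nonempty :=
    ⟨R.posRoots, by
      simp only [S, Finset.mem_filter, Finset.mem_powerset_self, true_and]
      exact fun γ hγ => inCone_of_mem hγ⟩
  obtain ⟨Δ, hΔS, hmin⟩ := S.exists_min_image Finset.card hS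
  simp only [S, Finset.mem_filter, Finset.mem_powerset] at hΔS hmin
  obtain ⟨hΔ, hcone⟩ := hΔS
  have hsimple : ∀ α ∈ Δ, R.IsSimpleRoot α := by
    intro α hα
    refine ⟨hΔ hα, fun γ hγ hne => ?_⟩
    have hαp := hΔ hα
    have hγr := (R.mem_posRoots.1 hγ).1
    have hαr := (R.mem_posRoots.1 hαp).1
    rcases R.mem_posRoots_or_neg (R.refl_mem α hαr γ hγr) with h | h
    · exact h
    exfalso
    obtain ⟨c, hc, hcγ⟩ := hcone γ hγ
    obtain ⟨d, hd, hdε⟩ := hcone _ h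
    set k : ℝ := 2 * (inner ℝ α γ / ‖α‖ ^ 2) with hk
    have h1 : k • α = γ + -(dunklRefl α γ) := by rw [dunklRefl_apply]; abel
    have h2 : (k - c α - d α) • α = ∑ β ∈ Δ.erase α, (c β + d β) • β := by
      rw [sub_smul, sub_smul, h1, hdε]
      conv_lhs => rw [hcγ]
      rw [← Finset.add_sum_erase _ _ hα, ← Finset.add_sum_erase _ (fun β => d β • β) hα]
      simp only [add_smul, Finset.sum_add_distrib]
      abel
    rcases lt_or_ge 0 (k - c α - d α) with hpos | hneg
    · -- `α` is redundant, against minimality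
      have hα' : InCone (Δ.erase α) α := by
        refine ⟨fun β => (k - c α - d α)⁻¹ * (c β + d β), fun β => ?_, ?_⟩
        · have := hc β; have := hd β; positivity
        · simp_rw [mul_smul]
          rw [← Finset.smul_sum, ← h2, smul_smul, inv_mul_cancel₀ hpos.ne', one_smul]
      have h3 := hmin (Δ.erase α) ⟨(Finset.erase_subset _ _).trans hΔ, fun η hη =>
        (hcone η hη).trans fun β hβ => by
          by_cases hb : β = α
          · rw [hb]; exact hα'
          · exact inCone_of_mem (Finset.mem_erase.2 ⟨hb, hβ⟩)⟩
      have := Finset.card_erase_lt_of_mem hα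
      omega
    · -- pairing with `m` forces `γ` to be proportional to `α`
      have h3 : ∑ β ∈ Δ.erase α, (c β + d β) * (inner ℝ R.m β : ℝ)
          = (k - c α - d α) * inner ℝ R.m α := by
        rw [← real_inner_smul_right, h2, inner_sum]
        simp_rw [real_inner_smul_right]
      have hnn : ∀ β ∈ Δ.erase α, 0 ≤ (c β + d β) * (inner ℝ R.m β : ℝ) := fun β hβ => by
        have := hc β; have := hd β
        have := (R.mem_posRoots.1 (hΔ (Finset.mem_of_mem_erase hβ))).2
        positivity
      have hαm := (R.mem_posRoots.1 hαp).2
      have h4 : ∑ β ∈ Δ.erase α, (c β + d β) * (inner ℝ R.m β : ℝ) = 0 := by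
        refine le_antisymm ?_ (Finset.sum_nonneg hnn)
        rw [h3]
        exact mul_nonpos_of_nonpos_of_nonneg hneg hαm.le
      have h5 : γ = c α • α := by
        rw [hcγ, ← Finset.add_sum_erase _ _ hα, Finset.sum_eq_zero, add_zero]
        intro β hβ
        have h6 := (Finset.sum_eq_zero_iff_of_nonneg hnn).1 h4 β hβ
        have h7 := (R.mem_posRoots.1 (hΔ (Finset.mem_of_mem_erase hβ))).2
        have h8 : c β = 0 := by
          have h8 := (mul_eq_zero.1 h6).resolve_right h7.ne'
          have := hc β; have := hd β
          linarith
        rw [h8, zero_smul]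
      rcases R.reduced γ hγr α hαr _ h5 with h6 | h6
      · rw [h6, one_smul] at h5; exact hne h5
      · have := hc α; linarith
  by_contra! hcon
  obtain ⟨c, hc, hcδ⟩ := hcone δ hδ
  have h1 : (inner ℝ δ δ : ℝ) ≤ 0 := by
    nth_rewrite 1 [hcδ]
    rw [sum_inner]
    refine Finset.sum_nonpos fun α hα => ?_
    rw [real_inner_smul_left]
    exact mul_nonpos_of_nonneg_of_nonpos (hc α) (hcon α (hsimple α hα))
  rw [real_inner_self_eq_norm_sq] at h1
  have := R.norm_pos_of_mem_posRoots hδ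
  nlinarith

/-- The product of the reflections along a list of vectors. -/
noncomputable def wordProd (l : List (EuclideanSpace ℝ (Fin N))) :
    EuclideanSpace ℝ (Fin N) ≃ₗᵢ[ℝ] EuclideanSpace ℝ (Fin N) :=
  (l.map dunklRefl).prod

theorem wordProd_append (l l' : List (EuclideanSpace ℝ (Fin N))) :
    wordProd (l ++ l') = wordProd l * wordProd l' := by
  simp [wordProd]

theorem wordProd_cons (a : EuclideanSpace ℝ (Fin N)) (l : List (EuclideanSpace ℝ (Fin N))) :
    wordProd (a :: l) = dunklRefl a * wordProd l := by
  simp [wordProd]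

theorem wordProd_nil : wordProd ([] : List (EuclideanSpace ℝ (Fin N))) = 1 := rfl

theorem wordProd_reverse (l : List (EuclideanSpace ℝ (Fin N))) :
    wordProd l.reverse = (wordProd l)⁻¹ := by
  induction l with
  | nil => simp [wordProd]
  | cons a l ih =>
    rw [List.reverse_cons, wordProd_append, ih, wordProd_cons, wordProd_cons, wordProd_nil,
      mul_inv_rev, mul_one]
    rw [inv_eq_of_mul_eq_one_left (dunklRefl_mul_self a)]

theorem wordProd_mem {l : List (EuclideanSpace ℝ (Fin N))} (hl : ∀ α ∈ l, R.IsSimpleRoot α) :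
    wordProd l ∈ R.weylGroup := by
  refine Subgroup.list_prod_mem _ fun x hx => ?_
  obtain ⟨α, hα, rfl⟩ := List.mem_map.1 hx
  exact R.dunklRefl_mem_weylGroup (R.mem_posRoots.1 (hl α hα).1).1

theorem exists_word_map_simple {γ : EuclideanSpace ℝ (Fin N)} (hγ : γ ∈ R.posRoots) :
    ∃ l : List (EuclideanSpace ℝ (Fin N)), (∀ α ∈ l, R.IsSimpleRoot α) ∧
      ∃ α, R.IsSimpleRoot α ∧ wordProd l α = γ := by
  classical
  let S := R.posRoots.filter fun δ => ∃ l : List (EuclideanSpace ℝ (Fin N)),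
    (∀ α ∈ l, R.IsSimpleRoot α) ∧ wordProd l δ = γ
  have hS : S.Nonempty := ⟨γ, by
    simp only [S, Finset.mem_filter]
    exact ⟨hγ, [], by simp, rfl⟩⟩
  obtain ⟨δ, hδS, hmin⟩ := S.exists_min_image (fun δ => (inner ℝ R.m δ : ℝ)) hS
  simp only [S, Finset.mem_filter] at hδS hmin
  obtain ⟨hδ, l, hl, hlδ⟩ := hδS
  refine ⟨l, hl, δ, ?_, hlδ⟩
  by_contra hns
  obtain ⟨α, hα, hαδ⟩ := R.exists_isSimpleRoot_inner_pos hδ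
  have hne : δ ≠ α := fun h => hns (h ▸ hα)
  have h1 := hmin (dunklRefl α δ) ⟨hα.2 δ hδ hne, l ++ [α], by
    simpa [or_imp, forall_and] using ⟨hl, hα⟩, by
    rw [wordProd_append, wordProd_cons, wordProd_nil, mul_one]
    change wordProd l (dunklRefl α (dunklRefl α δ)) = γ
    have : dunklRefl α (dunklRefl α δ) = δ := by
      change (dunklRefl α * dunklRefl α) δ = δ
      rw [dunklRefl_mul_self]; rfl
    rw [this, hlδ]⟩
  rw [inner_dunklRefl] at h1
  have h2 := (R.mem_posRoots.1 hα.1).2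
  have h3 := R.norm_pos_of_mem_posRoots hα.1
  have : 0 < 2 * (inner ℝ α δ / ‖α‖ ^ 2) * (inner ℝ R.m α : ℝ) := by positivity
  linarith

theorem exists_word_of_mem {w : EuclideanSpace ℝ (Fin N) ≃ₗᵢ[ℝ] EuclideanSpace ℝ (Fin N)}
    (hw : w ∈ R.weylGroup) :
    ∃ l : List (EuclideanSpace ℝ (Fin N)), (∀ α ∈ l, R.IsSimpleRoot α) ∧ wordProd l = w := by
  induction hw using Subgroup.closure_induction with
  | mem x hx =>
    obtain ⟨γ, hγ, rfl⟩ := hx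
    have key : ∀ γ ∈ R.posRoots, ∃ l : List (EuclideanSpace ℝ (Fin N)),
        (∀ α ∈ l, R.IsSimpleRoot α) ∧ wordProd l = dunklRefl γ := by
      intro γ hγ
      obtain ⟨l, hl, α, hα, rfl⟩ := R.exists_word_map_simple hγ
      refine ⟨l ++ [α] ++ l.reverse, ?_, ?_⟩
      · intro β hβ
        simp only [List.append_assoc, List.mem_append, List.mem_cons, List.not_mem_nil, or_false,
          List.mem_reverse] at hβ
        rcases hβ with h | h | h
        · exact hl β h
        · exact h ▸ hα
        · exact hl β h
      · rw [wordProd_append, wordProd_append, wordProd_reverse, dunklRefl_map, wordProd_cons,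
          wordProd_nil, mul_one]
    rcases R.mem_posRoots_or_neg hγ with h | h
    · exact key γ h
    · rw [← dunklRefl_neg]
      exact key _ h
  | one => exact ⟨[], by simp, rfl⟩
  | mul x y _ _ hx hy =>
    obtain ⟨l, hl, rfl⟩ := hx
    obtain ⟨l', hl', rfl⟩ := hy
    refine ⟨l ++ l', ?_, wordProd_append _ _⟩
    intro α hα
    rcases List.mem_append.1 hα with h | h
    exacts [hl α h, hl' α h]
  | inv x _ hx =>
    obtain ⟨l, hl, rfl⟩ := hx
    exact ⟨l.reverse, fun α hα => hl α (List.mem_reverse.1 hα), wordProd_reverse l⟩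

/-- When a word of simple reflections takes a negative root to a positive one, the sign changes
at some letter `a`, and just before it the root is `-a`. -/
theorem exists_sign_change (l : List (EuclideanSpace ℝ (Fin N)))
    (hl : ∀ α ∈ l, R.IsSimpleRoot α) {x : EuclideanSpace ℝ (Fin N)} (hx : -x ∈ R.posRoots)
    (hlx : wordProd l x ∈ R.posRoots) :
    ∃ l₁ a l₂, l = l₁ ++ a :: l₂ ∧ wordProd l₂ x = -a := by
  induction l with
  | nil => exact absurd hx (R.neg_notMem_posRoots hlx)
  | cons b l ih =>
    have hl' : ∀ α ∈ l, R.IsSimpleRoot α := fun α hα => hl α (List.mem_cons_of_mem _ hα)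
    have hxr : wordProd l x ∈ R.roots := by
      refine R.weylGroup_map_mem (R.wordProd_mem hl') ?_
      simpa using R.neg_mem_roots (R.mem_posRoots.1 hx).1
    rcases R.mem_posRoots_or_neg hxr with h | h
    · obtain ⟨l₁, a, l₂, rfl, h2⟩ := ih hl' h
      exact ⟨b :: l₁, a, l₂, rfl, h2⟩
    · refine ⟨[], b, l, rfl, ?_⟩
      by_contra hne
      have h1 := (hl b List.mem_cons_self).2 _ h fun h' => hne (by rw [← h', neg_neg])
      rw [wordProd_cons] at hlx
      rw [map_neg] at h1
      exact R.neg_notMem_posRoots hlx h1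

/-- The deletion argument: a word of simple reflections that preserves the positive roots can be
shortened by two letters, hence is trivial. -/
theorem wordProd_eq_one (n : ℕ) : ∀ l : List (EuclideanSpace ℝ (Fin N)), l.length ≤ n →
    (∀ α ∈ l, R.IsSimpleRoot α) → (∀ γ ∈ R.posRoots, wordProd l γ ∈ R.posRoots) →
    wordProd l = 1 := by
  induction n with
  | zero =>
    intro l hn _ _
    rw [List.length_eq_zero_iff.1 (Nat.le_zero.1 hn), wordProd_nil]
  | succ n ih =>
    intro l hn hl hpos
    rcases List.eq_nil_or_concat l with rfl | ⟨l₀, α, rfl⟩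
    · exact wordProd_nil
    have hα : R.IsSimpleRoot α := hl α (by simp)
    have hl₀ : ∀ β ∈ l₀, R.IsSimpleRoot β := fun β hβ => hl β (by simp [hβ])
    have h1 : wordProd l₀ (-α) ∈ R.posRoots := by
      have := hpos α hα.1
      rw [List.concat_eq_append, wordProd_append, wordProd_cons, wordProd_nil, mul_one] at this
      rw [← dunklRefl_self]
      exact this
    obtain ⟨l₁, a, l₂, rfl, h2⟩ := R.exists_sign_change l₀ hl₀ (by rw [neg_neg]; exact hα.1) h1
    rw [map_neg, neg_inj] at h2
    have h3 : wordProd ((l₁ ++ a :: l₂).concat α) = wordProd (l₁ ++ l₂) := by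
      rw [List.concat_eq_append, wordProd_append, wordProd_append, wordProd_append, wordProd_cons,
        wordProd_cons, wordProd_nil, mul_one, ← h2, dunklRefl_map]
      simp only [mul_assoc, inv_mul_cancel_left, dunklRefl_mul_self, mul_one]
    rw [h3] at hpos ⊢
    refine ih _ ?_ ?_ hpos
    · simp at hn ⊢; omega
    · intro β hβ
      refine hl₀ β ?_
      simp only [List.mem_append, List.mem_cons] at hβ ⊢
      tauto

theorem eq_one_of_map_openChamber
    {g : EuclideanSpace ℝ (Fin N) ≃ₗᵢ[ℝ] EuclideanSpace ℝ (Fin N)} (hg : g ∈ R.weylGroup)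
    {y : EuclideanSpace ℝ (Fin N)} (hy : y ∈ R.openChamber) (hgy : g y ∈ R.openChamber) :
    g = 1 := by
  obtain ⟨l, hl, rfl⟩ := R.exists_word_of_mem hg
  refine R.wordProd_eq_one _ l le_rfl hl fun γ hγ => ?_
  rcases R.mem_posRoots_or_neg (R.weylGroup_map_mem hg (R.mem_posRoots.1 hγ).1) with h | h
  · exact h
  · have h1 := hgy _ h
    rw [inner_neg_left, LinearIsometryEquiv.inner_map_map] at h1
    have := hy γ hγ
    linarith

/-- Transitivity: the `w ∈ W` maximizing `m · w x` moves `x` into the closed chamber. -/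
theorem exists_map_mem_chamber (x : EuclideanSpace ℝ (Fin N)) :
    ∃ w : R.weylGroup, w.1 x ∈ R.chamber := by
  obtain ⟨w, -, hw⟩ := Finset.univ.exists_max_image
    (fun w : R.weylGroup => (inner ℝ R.m (w.1 x) : ℝ)) Finset.univ_nonempty
  refine ⟨w, fun α hα => ?_⟩
  have h1 := hw (⟨dunklRefl α, R.dunklRefl_mem_weylGroup (R.mem_posRoots.1 hα).1⟩ * w)
    (Finset.mem_univ _)
  change inner ℝ R.m (dunklRefl α (w.1 x)) ≤ inner ℝ R.m (w.1 x) at h1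
  rw [inner_dunklRefl] at h1
  by_contra! hneg
  have h2 := (R.mem_posRoots.1 hα).2
  have h3 := R.norm_pos_of_mem_posRoots hα
  have h4 : inner ℝ α (w.1 x) / ‖α‖ ^ 2 < 0 := div_neg_of_neg_of_pos hneg (by positivity)
  nlinarith

end DunklRootSystem

/-! ### The critical point of the Gibbs energy -/

namespace DunklRootSystem

variable {N : ℕ} (R : DunklRootSystem N)

theorem isOpen_openChamber : IsOpen R.openChamber := by
  have : R.openChamber = ⋂ α ∈ R.posRoots, {x | 0 < (inner ℝ α x : ℝ)} := by
    ext x; simp [openChamber]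
  rw [this]
  refine isOpen_biInter_finset fun α _ => ?_
  exact isOpen_lt continuous_const (by fun_prop)

/-- `s` is a critical point, inside the open chamber, of the energy
`F(u) = ‖u‖² / 2 - ∑_{α ∈ R₊} log (α · u)`. -/
def IsCritical (s : EuclideanSpace ℝ (Fin N)) : Prop :=
  s ∈ R.openChamber ∧ s = ∑ α ∈ R.posRoots, (inner ℝ α s : ℝ)⁻¹ • α

/-- `exp (-F)` vanishes at infinity; it therefore attains its maximum on the chamber, at a
critical point of `F`. -/
theorem tendsto_prod_mul_exp_cocompact :
    Tendsto (fun u : EuclideanSpace ℝ (Fin N) =>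
      (∏ α ∈ R.posRoots, max (inner ℝ α u : ℝ) 0) * Real.exp (-‖u‖ ^ 2 / 2))
      (cocompact _) (𝓝 0) := by
  have h1 : Tendsto (fun u : EuclideanSpace ℝ (Fin N) =>
      ((∏ α ∈ R.posRoots, ‖α‖) * Real.exp (1 / 2)) *
        (‖u‖ ^ R.posRoots.card * Real.exp (-‖u‖))) (cocompact _) (𝓝 0) := by
    have := ((Real.tendsto_pow_mul_exp_neg_atTop_nhds_zero R.posRoots.card).comp
      (tendsto_norm_cocompact_atTop (E := EuclideanSpace ℝ (Fin N)))).const_mul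
      ((∏ α ∈ R.posRoots, ‖α‖) * Real.exp (1 / 2))
    rw [mul_zero] at this
    exact this
  refine squeeze_zero (fun u => ?_) (fun u => ?_) h1
  · exact mul_nonneg (Finset.prod_nonneg fun α _ => le_max_right _ _) (Real.exp_pos _).le
  · have h2 : (∏ α ∈ R.posRoots, max (inner ℝ α u : ℝ) 0) ≤
        (∏ α ∈ R.posRoots, ‖α‖) * ‖u‖ ^ R.posRoots.card := by
      rw [← Finset.prod_const, ← Finset.prod_mul_distrib]
      refine Finset.prod_le_prod (fun α _ => le_max_right _ _) fun α _ => ?_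
      exact max_le (real_inner_le_norm α u) (by positivity)
    have h3 : Real.exp (-‖u‖ ^ 2 / 2) ≤ Real.exp (1 / 2) * Real.exp (-‖u‖) := by
      rw [← Real.exp_add]
      exact Real.exp_le_exp.2 (by nlinarith [sq_nonneg (‖u‖ - 1)])
    calc _ ≤ ((∏ α ∈ R.posRoots, ‖α‖) * ‖u‖ ^ R.posRoots.card) *
          (Real.exp (1 / 2) * Real.exp (-‖u‖)) :=
          mul_le_mul h2 h3 (Real.exp_pos _).le (by positivity)
      _ = _ := by ring

theorem exists_isCritical : ∃ s, R.IsCritical s := by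
  set g : EuclideanSpace ℝ (Fin N) → ℝ := fun u =>
    (∏ α ∈ R.posRoots, max (inner ℝ α u : ℝ) 0) * Real.exp (-‖u‖ ^ 2 / 2) with hg
  have hgc : Continuous g := by
    refine Continuous.mul (continuous_finsetProd _ fun α _ => ?_) (by fun_prop)
    fun_prop
  have hgm : 0 < g R.m := by
    refine mul_pos (Finset.prod_pos fun α hα => ?_) (Real.exp_pos _)
    exact lt_max_of_lt_left (R.m_mem_openChamber α hα)
  obtain ⟨s, hs⟩ := hgc.exists_forall_ge' R.m
    ((R.tendsto_prod_mul_exp_cocompact.eventually (gt_mem_nhds hgm)).mono fun _ h => h.le)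
  have hgs : 0 < g s := hgm.trans_le (hs _)
  have hsC : s ∈ R.openChamber := by
    intro α hα
    by_contra! h
    have : g s = 0 := by
      simp only [hg]
      rw [Finset.prod_eq_zero hα (max_eq_right h), zero_mul]
    exact hgs.ne' this
  refine ⟨s, hsC, ?_⟩
  set L : EuclideanSpace ℝ (Fin N) → ℝ := fun u =>
    ∑ α ∈ R.posRoots, Real.log (inner ℝ α u : ℝ) - ‖u‖ ^ 2 / 2 with hL
  have hgL : ∀ u ∈ R.openChamber, Real.log (g u) = L u := by
    intro u hu
    simp only [hg, hL]
    have hmax : ∀ α ∈ R.posRoots, max (inner ℝ α u : ℝ) 0 = inner ℝ α u :=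
      fun α hα => max_eq_left (hu α hα).le
    rw [Finset.prod_congr rfl hmax, Real.log_mul, Real.log_prod, Real.log_exp]
    · ring
    · exact fun α hα => (hu α hα).ne'
    · exact Finset.prod_ne_zero_iff.2 fun α hα => (hu α hα).ne'
    · exact (Real.exp_pos _).ne'
  have hloc : IsLocalMax L s := by
    filter_upwards [R.isOpen_openChamber.mem_nhds hsC] with u hu
    rw [← hgL u hu, ← hgL s hsC]
    refine Real.log_le_log ?_ (hs u)
    exact mul_pos (Finset.prod_pos fun α hα => lt_max_of_lt_left (hu α hα)) (Real.exp_pos _)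
  have hd : HasFDerivAt L (∑ α ∈ R.posRoots, (inner ℝ α s : ℝ)⁻¹ • innerSL ℝ α -
      innerSL ℝ s) s := by
    refine HasFDerivAt.sub (HasFDerivAt.fun_sum fun α hα => ?_) ?_
    · exact ((innerSL ℝ α).hasFDerivAt).log (hsC α hα).ne'
    · have h := (hasStrictFDerivAt_norm_sq s).hasFDerivAt.const_mul (1 / 2 : ℝ)
      convert! h using 1
      · funext u; ring
      · ext; simp
  have h0 := hloc.hasFDerivAt_eq_zero hd
  refine ext_inner_right ℝ fun v => ?_
  have h1 := congrArg (fun f => f v) h0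
  simp only [sub_apply, sum_apply, smul_apply, innerSL_apply_apply, zero_apply,
    smul_eq_mul] at h1
  rw [sum_inner]
  simp_rw [real_inner_smul_left]
  linarith

end DunklRootSystem

/-! ### Gibbs weights and integration by parts -/

theorem hasDerivAt_max_zero_rpow {e : ℝ} (he : 1 < e) (t : ℝ) :
    HasDerivAt (fun t : ℝ => max t 0 ^ e) (e * max t 0 ^ (e - 1)) t := by
  rcases lt_trichotomy t 0 with h | rfl | h
  · rw [max_eq_right h.le, Real.zero_rpow (by linarith), mul_zero]
    refine (hasDerivAt_const t (0 : ℝ)).congr_of_eventuallyEq ?_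
    filter_upwards [gt_mem_nhds h] with u hu
    rw [max_eq_right hu.le, Real.zero_rpow (by linarith)]
  · rw [max_self, Real.zero_rpow (by linarith), mul_zero]
    rw [hasDerivAt_iff_tendsto_slope]
    have h1 : Tendsto (fun u : ℝ => max u 0 ^ (e - 1)) (𝓝[≠] 0) (𝓝 0) := by
      have hc : Continuous fun u : ℝ => max u 0 ^ (e - 1) :=
        (continuous_id.max continuous_const).rpow_const fun _ => Or.inr (by linarith)
      have := (hc.tendsto 0).mono_left (nhdsWithin_le_nhds (s := {0}ᶜ))
      rwa [max_self, Real.zero_rpow (by linarith)] at this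
    refine h1.congr' ?_
    filter_upwards [self_mem_nhdsWithin] with u hu
    have hu0 : u ≠ 0 := hu
    rw [slope_def_field, max_self, Real.zero_rpow (by linarith : e ≠ 0), sub_zero, sub_zero]
    rcases lt_or_gt_of_ne hu0 with h | h
    · rw [max_eq_right h.le, Real.zero_rpow (by linarith), Real.zero_rpow (by linarith), zero_div]
    · rw [max_eq_left h.le, Real.rpow_sub_one h.ne']
  · rw [max_eq_left h.le]
    refine (Real.hasDerivAt_rpow_const (Or.inl h.ne')).congr_of_eventuallyEq ?_
    filter_upwards [lt_mem_nhds h] with u hu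
    rw [max_eq_left hu.le]

theorem exists_one_add_pow_mul_exp_le {b : ℝ} (hb : 0 < b) (K : ℕ) :
    ∃ C : ℝ, ∀ r : ℝ, 0 ≤ r → (1 + r) ^ K * Real.exp (-b * r ^ 2) ≤ C := by
  refine ⟨K.factorial * Real.exp (1 + 1 / (4 * b)), fun r hr => ?_⟩
  have h1 := Real.pow_div_factorial_le_exp (1 + r) (by linarith) K
  rw [div_le_iff₀' (by positivity)] at h1
  calc (1 + r) ^ K * Real.exp (-b * r ^ 2)
      ≤ (K.factorial * Real.exp (1 + r)) * Real.exp (-b * r ^ 2) := by gcongr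
    _ = K.factorial * Real.exp ((1 + r) + -b * r ^ 2) := by
      rw [Real.exp_add (1 + r) (-b * r ^ 2)]; ring
    _ ≤ _ := by
      refine mul_le_mul_of_nonneg_left (Real.exp_le_exp.2 ?_) (by positivity)
      have : 1 + 1 / (4 * b) - ((1 + r) + -b * r ^ 2) = b * (r - 1 / (2 * b)) ^ 2 := by
        field_simp; ring
      nlinarith [mul_nonneg hb.le (sq_nonneg (r - 1 / (2 * b)))]

theorem Function.HasTemperateGrowth.exists_bound {N : ℕ} {f : EuclideanSpace ℝ (Fin N) → ℝ}
    (hf : f.HasTemperateGrowth) : ∃ (k : ℕ) (C : ℝ), 0 ≤ C ∧ ∀ x, |f x| ≤ C * (1 + ‖x‖) ^ k := by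
  obtain ⟨k, C, hC, h⟩ := hf.norm_iteratedFDeriv_le_uniform 0
  exact ⟨k, C, hC, fun x => by simpa using h 0 le_rfl x⟩

namespace DunklRootSystem

variable {N : ℕ} (R : DunklRootSystem N)

/-- The weight `∏_{α ∈ R₊} (α · u)_+ ^ {e_α} exp (-β ‖u‖² / 2)`, supported on the chamber. -/
noncomputable def gibbs (β : ℝ) (e : EuclideanSpace ℝ (Fin N) → ℝ)
    (u : EuclideanSpace ℝ (Fin N)) : ℝ :=
  (∏ α ∈ R.posRoots, max (inner ℝ α u : ℝ) 0 ^ e α) * Real.exp (-(β / 2) * ‖u‖ ^ 2)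

variable {R} {β : ℝ} {e : EuclideanSpace ℝ (Fin N) → ℝ}

theorem gibbs_nonneg (u : EuclideanSpace ℝ (Fin N)) : 0 ≤ R.gibbs β e u :=
  mul_nonneg (Finset.prod_nonneg fun _ _ => Real.rpow_nonneg (le_max_right _ _) _)
    (Real.exp_pos _).le

theorem gibbs_pos {u : EuclideanSpace ℝ (Fin N)} (hu : u ∈ R.openChamber) :
    0 < R.gibbs β e u :=
  mul_pos (Finset.prod_pos fun α hα => Real.rpow_pos_of_pos (lt_max_of_lt_left (hu α hα)) _)
    (Real.exp_pos _)

theorem gibbs_eq_zero (he : ∀ α ∈ R.posRoots, 0 < e α) {u : EuclideanSpace ℝ (Fin N)}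
    (hu : u ∉ R.openChamber) : R.gibbs β e u = 0 := by
  simp only [openChamber, Set.mem_ofPred_eq, not_forall, not_lt] at hu
  obtain ⟨α, hα, h⟩ := hu
  rw [gibbs, Finset.prod_eq_zero hα, zero_mul]
  rw [max_eq_right h, Real.zero_rpow (he α hα).ne']

theorem continuous_gibbs (he : ∀ α ∈ R.posRoots, 0 ≤ e α) : Continuous (R.gibbs β e) := by
  unfold gibbs
  refine Continuous.mul (continuous_finsetProd _ fun α hα => ?_) (by fun_prop)
  exact Continuous.rpow_const (by fun_prop) fun _ => Or.inr (he α hα)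

theorem gibbs_le (hβ : 0 < β) (he : ∀ α ∈ R.posRoots, 0 ≤ e α) (k : ℕ) :
    ∃ C : ℝ, ∀ u, (1 + ‖u‖) ^ k * R.gibbs β e u ≤ C := by
  set K : ℕ := ∑ α ∈ R.posRoots, ⌈e α⌉₊ with hK
  obtain ⟨C, hC⟩ := exists_one_add_pow_mul_exp_le (half_pos hβ) (k + K)
  set D : ℝ := ∏ α ∈ R.posRoots, (1 + ‖α‖) ^ ⌈e α⌉₊ with hD
  refine ⟨D * C, fun u => ?_⟩
  have h1 : (∏ α ∈ R.posRoots, max (inner ℝ α u : ℝ) 0 ^ e α) ≤ D * (1 + ‖u‖) ^ K := by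
    rw [hK, ← Finset.prod_pow_eq_pow_sum, hD, ← Finset.prod_mul_distrib]
    refine Finset.prod_le_prod (fun α _ => Real.rpow_nonneg (le_max_right _ _) _) fun α hα => ?_
    rw [← mul_pow]
    have h2 : max (inner ℝ α u : ℝ) 0 ≤ (1 + ‖α‖) * (1 + ‖u‖) := by
      refine max_le ((real_inner_le_norm α u).trans ?_) (by positivity)
      nlinarith [norm_nonneg α, norm_nonneg u]
    have h3 : 1 ≤ (1 + ‖α‖) * (1 + ‖u‖) := by
      nlinarith [norm_nonneg α, norm_nonneg u, mul_nonneg (norm_nonneg α) (norm_nonneg u)]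
    calc max (inner ℝ α u : ℝ) 0 ^ e α ≤ ((1 + ‖α‖) * (1 + ‖u‖)) ^ e α :=
          Real.rpow_le_rpow (le_max_right _ _) h2 (he α hα)
      _ ≤ ((1 + ‖α‖) * (1 + ‖u‖)) ^ ((⌈e α⌉₊ : ℕ) : ℝ) :=
          Real.rpow_le_rpow_of_exponent_le h3 (Nat.le_ceil _)
      _ = _ := Real.rpow_natCast _ _
  have hD0 : 0 ≤ D := Finset.prod_nonneg fun α _ => by positivity
  calc (1 + ‖u‖) ^ k * R.gibbs β e u
      ≤ (1 + ‖u‖) ^ k * ((D * (1 + ‖u‖) ^ K) * Real.exp (-(β / 2) * ‖u‖ ^ 2)) := by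
        unfold gibbs; gcongr
    _ = D * ((1 + ‖u‖) ^ (k + K) * Real.exp (-(β / 2) * ‖u‖ ^ 2)) := by ring
    _ ≤ D * C := mul_le_mul_of_nonneg_left (hC _ (norm_nonneg _)) hD0

theorem integrable_mul_gibbs (hβ : 0 < β) (he : ∀ α ∈ R.posRoots, 0 ≤ e α)
    {f : EuclideanSpace ℝ (Fin N) → ℝ} (hf : f.HasTemperateGrowth) :
    Integrable (fun u => f u * R.gibbs β e u) := by
  obtain ⟨k, C, hC, hfC⟩ := hf.exists_bound
  obtain ⟨D, hD⟩ := R.gibbs_le hβ he (k + (N + 1))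
  have hint : Integrable (fun u : EuclideanSpace ℝ (Fin N) =>
      (C * D) * (1 + ‖u‖) ^ (-((N : ℝ) + 1))) :=
    (integrable_one_add_norm (by simp)).const_mul _
  refine hint.mono' ?_ (Eventually.of_forall fun u => ?_)
  · exact (hf.1.continuous.mul (continuous_gibbs he)).aestronglyMeasurable
  · rw [Real.norm_eq_abs, abs_mul, abs_of_nonneg (gibbs_nonneg u)]
    have h1 : (0 : ℝ) < 1 + ‖u‖ := by positivity
    have h2 : (1 + ‖u‖) ^ (-((N : ℝ) + 1)) = ((1 + ‖u‖) ^ (N + 1))⁻¹ := by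
      rw [Real.rpow_neg h1.le, ← Real.rpow_natCast]; push_cast; rfl
    rw [h2, ← div_eq_mul_inv, le_div_iff₀ (by positivity)]
    calc |f u| * R.gibbs β e u * (1 + ‖u‖) ^ (N + 1)
        ≤ (C * (1 + ‖u‖) ^ k) * R.gibbs β e u * (1 + ‖u‖) ^ (N + 1) := by
          gcongr
          · exact gibbs_nonneg u
          · exact hfC u
      _ = C * ((1 + ‖u‖) ^ (k + (N + 1)) * R.gibbs β e u) := by ring
      _ ≤ C * D := mul_le_mul_of_nonneg_left (hD u) hC

open Classical in
theorem gibbs_update (he : ∀ α ∈ R.posRoots, 1 < e α) {α : EuclideanSpace ℝ (Fin N)}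
    (hα : α ∈ R.posRoots) (u : EuclideanSpace ℝ (Fin N)) :
    R.gibbs β (Function.update e α (e α - 1)) u = R.gibbs β e u / (inner ℝ α u : ℝ) := by
  by_cases hu : u ∈ R.openChamber
  · have h := hu α hα
    rw [gibbs, gibbs, ← Finset.mul_prod_erase _ _ hα,
      ← Finset.mul_prod_erase _ (fun α => max (inner ℝ α u : ℝ) 0 ^ e α) hα,
      Function.update_self, max_eq_left h.le, Real.rpow_sub_one h.ne']
    have : ∏ x ∈ R.posRoots.erase α,
          max (inner ℝ x u : ℝ) 0 ^ (Function.update e α (e α - 1) x) =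
        ∏ x ∈ R.posRoots.erase α, max (inner ℝ x u : ℝ) 0 ^ e x :=
      Finset.prod_congr rfl fun x hx => by
        rw [Function.update_of_ne (Finset.ne_of_mem_erase hx)]
    rw [this]
    ring
  · rw [gibbs_eq_zero _ hu, gibbs_eq_zero (fun α hα => one_pos.trans (he α hα)) hu, zero_div]
    intro γ hγ
    rcases eq_or_ne γ α with rfl | h
    · rw [Function.update_self]; linarith [he γ hγ]
    · rw [Function.update_of_ne h]; linarith [he γ hγ]

theorem hasLineDerivAt_gibbs (he : ∀ α ∈ R.posRoots, 1 < e α) (u v : EuclideanSpace ℝ (Fin N)) :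
    HasLineDerivAt ℝ (R.gibbs β e)
      ((∑ α ∈ R.posRoots, e α * inner ℝ α v / (inner ℝ α u : ℝ) - β * inner ℝ u v) *
        R.gibbs β e u) u v := by
  classical
  have h1 : ∀ α ∈ R.posRoots, HasDerivAt (fun t : ℝ => max (inner ℝ α (u + t • v) : ℝ) 0 ^ e α)
      ((e α * max (inner ℝ α u : ℝ) 0 ^ (e α - 1)) * inner ℝ α v) 0 := by
    intro α hα
    have h2 : HasDerivAt (fun t : ℝ => (inner ℝ α (u + t • v) : ℝ)) (inner ℝ α v) 0 := by
      simp_rw [inner_add_right, real_inner_smul_right]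
      simpa using ((hasDerivAt_id (0 : ℝ)).mul_const (inner ℝ α v : ℝ)).const_add (inner ℝ α u)
    have h3 := (hasDerivAt_max_zero_rpow (he α hα) (inner ℝ α (u + (0 : ℝ) • v) : ℝ)).comp
      (0 : ℝ) h2
    simpa [Function.comp_def] using h3
  have h2 : HasDerivAt (fun t : ℝ => Real.exp (-(β / 2) * ‖u + t • v‖ ^ 2))
      (Real.exp (-(β / 2) * ‖u‖ ^ 2) * (-β * inner ℝ u v)) 0 := by
    have h3 : HasDerivAt (fun t : ℝ => ‖u + t • v‖ ^ 2) (2 * inner ℝ u v) 0 := by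
      have h4 : HasDerivAt (fun t : ℝ => u + t • v) v 0 := by
        simpa using ((hasDerivAt_id (0 : ℝ)).smul_const v).const_add u
      simpa using h4.norm_sq
    have h5 := (h3.const_mul (-(β / 2))).exp
    simp only [zero_smul, add_zero] at h5
    convert! h5 using 1
    ring
  have h3 := (HasDerivAt.fun_finsetProd h1).mul h2
  unfold HasLineDerivAt
  convert! h3 using 1
  simp only [zero_smul, add_zero, smul_eq_mul]
  rw [sub_mul, Finset.sum_mul, Finset.sum_mul]
  have h4 : ∀ α ∈ R.posRoots, e α * inner ℝ α v / (inner ℝ α u : ℝ) * R.gibbs β e u =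
      (∏ j ∈ R.posRoots.erase α, max (inner ℝ j u : ℝ) 0 ^ e j) *
        (e α * max (inner ℝ α u : ℝ) 0 ^ (e α - 1) * inner ℝ α v) *
        Real.exp (-(β / 2) * ‖u‖ ^ 2) := by
    intro α hα
    have h5 := R.gibbs_update (β := β) he hα u
    have h6 : e α * inner ℝ α v / (inner ℝ α u : ℝ) * R.gibbs β e u =
      e α * inner ℝ α v * (R.gibbs β e u / (inner ℝ α u : ℝ)) := by ring
    rw [h6, ← h5, gibbs, ← Finset.mul_prod_erase _ _ hα, Function.update_self]
    have : ∏ x ∈ R.posRoots.erase α,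
          max (inner ℝ x u : ℝ) 0 ^ (Function.update e α (e α - 1) x) =
        ∏ x ∈ R.posRoots.erase α, max (inner ℝ x u : ℝ) 0 ^ e x :=
      Finset.prod_congr rfl fun x hx => by
        rw [Function.update_of_ne (Finset.ne_of_mem_erase hx)]
    rw [this]
    ring
  rw [Finset.sum_congr rfl h4, gibbs]
  ring

theorem integrable_mul_gibbs_div (hβ : 0 < β) (he : ∀ α ∈ R.posRoots, 1 < e α)
    {f : EuclideanSpace ℝ (Fin N) → ℝ} (hf : f.HasTemperateGrowth)
    {α : EuclideanSpace ℝ (Fin N)} (hα : α ∈ R.posRoots) :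
    Integrable (fun u => f u * (R.gibbs β e u / (inner ℝ α u : ℝ))) := by
  classical
  simp_rw [← R.gibbs_update he hα]
  refine integrable_mul_gibbs hβ (fun γ hγ => ?_) hf
  rcases eq_or_ne γ α with rfl | h
  · rw [Function.update_self]; linarith [he γ hγ]
  · rw [Function.update_of_ne h]; linarith [he γ hγ]

/-- Integration by parts against a Gibbs weight. There is no boundary term, because the weight
is continuously differentiable across the walls when all exponents exceed `1`. -/
theorem integral_deriv_mul_gibbs (hβ : 0 < β) (he : ∀ α ∈ R.posRoots, 1 < e α)
    {f f' : EuclideanSpace ℝ (Fin N) → ℝ} (hf : f.HasTemperateGrowth) (hf' : f'.HasTemperateGrowth)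
    (v : EuclideanSpace ℝ (Fin N)) (hd : ∀ u, HasLineDerivAt ℝ f (f' u) u v) :
    ∫ u, f' u * R.gibbs β e u = ∫ u, f u *
      (β * inner ℝ u v - ∑ α ∈ R.posRoots, e α * inner ℝ α v / (inner ℝ α u : ℝ)) *
        R.gibbs β e u := by
  have he0 : ∀ α ∈ R.posRoots, 0 ≤ e α := fun α hα => by linarith [he α hα]
  have h1 := integral_bilinear_hasLineDerivAt_right_eq_neg_left_of_integrable
    (μ := (volume : Measure (EuclideanSpace ℝ (Fin N)))) (f := f) (f' := f') (g := R.gibbs β e)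
    (g' := fun u => (∑ α ∈ R.posRoots, e α * inner ℝ α v / (inner ℝ α u : ℝ) - β * inner ℝ u v) *
        R.gibbs β e u) (v := v) (B := ContinuousLinearMap.mul ℝ ℝ) ?_ ?_ ?_
    (fun u _ => hd u) (fun u _ => hasLineDerivAt_gibbs he u v)
  · simp only [ContinuousLinearMap.mul_apply'] at h1
    rw [← neg_eq_iff_eq_neg] at h1
    rw [← h1, ← integral_neg]
    refine integral_congr_ae (Eventually.of_forall fun u => ?_)
    simp only
    ring
  · exact integrable_mul_gibbs hβ he0 hf'
  · have h2 : Integrable (fun u => ∑ α ∈ R.posRoots, (e α * inner ℝ α v) *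
        (f u * (R.gibbs β e u / (inner ℝ α u : ℝ))) -
        (f u * (β * inner ℝ u v)) * R.gibbs β e u) := by
      refine Integrable.sub (integrable_finsetSum _ fun α hα => ?_) ?_
      · exact (integrable_mul_gibbs_div hβ he hf hα).const_mul _
      · exact integrable_mul_gibbs hβ he0 (by fun_prop)
    refine h2.congr (Eventually.of_forall fun u => ?_)
    simp only [ContinuousLinearMap.mul_apply']
    rw [sub_mul, mul_sub, Finset.sum_mul, Finset.mul_sum]
    congr 1
    · exact Finset.sum_congr rfl fun α _ => by ring
    · ring
  · exact integrable_mul_gibbs hβ he0 hf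

end DunklRootSystem

/-! ### The scaled Gibbs measure and its moments -/

/-- The root `α` divided by `α · s`. -/
noncomputable def scaledRoot {N : ℕ} (s α : EuclideanSpace ℝ (Fin N)) : EuclideanSpace ℝ (Fin N) :=
  (inner ℝ α s : ℝ)⁻¹ • α

/-- The relative deviation `α · (u - s) / α · u`. It satisfies
`1 - relDev s α u = (α · s) / (α · u)`. -/
noncomputable def relDev {N : ℕ} (s α u : EuclideanSpace ℝ (Fin N)) : ℝ :=
  inner ℝ α (u - s) / inner ℝ α u

namespace DunklRootSystem

variable {N : ℕ} (R : DunklRootSystem N)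

/-- The probability measure proportional to `exp (-β F)` on the chamber, where
`F(u) = ‖u‖² / 2 - ∑_{α ∈ R₊} log (α · u)`. -/
noncomputable def gibbsMeasure (β : ℝ) : Measure (EuclideanSpace ℝ (Fin N)) :=
  volume.withDensity fun u => ENNReal.ofReal
    (R.gibbs β (fun _ => β) u / ∫ x, R.gibbs β (fun _ => β) x)

variable {R} {β : ℝ}

theorem integrable_gibbs (hβ : 0 < β) : Integrable (R.gibbs β fun _ => β) := by
  have := integrable_mul_gibbs (R := R) (e := fun _ => β) hβ (fun _ _ => hβ.le)
    (f := fun _ => 1) (by fun_prop)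
  simpa using this

theorem integral_gibbs_pos (hβ : 0 < β) : 0 < ∫ x, R.gibbs β (fun _ => β) x := by
  rw [integral_pos_iff_support_of_nonneg (fun u => gibbs_nonneg u) (integrable_gibbs hβ)]
  refine (R.isOpen_openChamber.measure_pos volume ⟨R.m, R.m_mem_openChamber⟩).trans_le
    (measure_mono fun u hu => ?_)
  exact (gibbs_pos hu).ne'

theorem measurable_density (hβ : 0 < β) : Measurable fun u => ENNReal.ofReal
    (R.gibbs β (fun _ => β) u / ∫ x, R.gibbs β (fun _ => β) x) :=
  (((continuous_gibbs fun _ _ => hβ.le).measurable).div_const _).ennreal_ofReal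

theorem integral_gibbsMeasure (hβ : 0 < β) (f : EuclideanSpace ℝ (Fin N) → ℝ) :
    ∫ u, f u ∂(R.gibbsMeasure β) =
      (∫ u, f u * R.gibbs β (fun _ => β) u) / ∫ x, R.gibbs β (fun _ => β) x := by
  rw [gibbsMeasure, integral_withDensity_eq_integral_toReal_smul (measurable_density hβ)
    (Eventually.of_forall fun _ => ENNReal.ofReal_lt_top), ← integral_div]
  refine integral_congr_ae (Eventually.of_forall fun u => ?_)
  simp only [smul_eq_mul]
  rw [ENNReal.toReal_ofReal (div_nonneg (gibbs_nonneg u) (integral_gibbs_pos hβ).le)]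
  ring

theorem integrable_gibbsMeasure_iff (hβ : 0 < β) {f : EuclideanSpace ℝ (Fin N) → ℝ} :
    Integrable f (R.gibbsMeasure β) ↔ Integrable fun u => f u * R.gibbs β (fun _ => β) u := by
  have hZ := integral_gibbs_pos (R := R) hβ
  rw [gibbsMeasure, integrable_withDensity_iff_integrable_smul' (measurable_density hβ)
    (Eventually.of_forall fun _ => ENNReal.ofReal_lt_top)]
  have h : (fun u => (ENNReal.ofReal (R.gibbs β (fun _ => β) u /
      ∫ x, R.gibbs β (fun _ => β) x)).toReal • f u) =
      fun u => (f u * R.gibbs β (fun _ => β) u) * (∫ x, R.gibbs β (fun _ => β) x)⁻¹ := by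
    funext u
    rw [ENNReal.toReal_ofReal (div_nonneg (gibbs_nonneg u) hZ.le), smul_eq_mul]
    ring
  rw [h]
  exact integrable_mul_const_iff (isUnit_iff_ne_zero.2 (inv_ne_zero hZ.ne')) _

theorem isProbabilityMeasure_gibbsMeasure (hβ : 0 < β) :
    IsProbabilityMeasure (R.gibbsMeasure β) := by
  have hZ := integral_gibbs_pos (R := R) hβ
  constructor
  rw [gibbsMeasure, withDensity_apply _ MeasurableSet.univ, Measure.restrict_univ,
    ← ofReal_integral_eq_lintegral_ofReal ((integrable_gibbs hβ).div_const _)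
      (Eventually.of_forall fun u => div_nonneg (gibbs_nonneg u) hZ.le),
    integral_div, div_self hZ.ne', ENNReal.ofReal_one]

theorem ae_mem_openChamber (hβ : 0 < β) : ∀ᵐ u ∂(R.gibbsMeasure β), u ∈ R.openChamber := by
  rw [gibbsMeasure, ae_withDensity_iff (measurable_density hβ)]
  refine Eventually.of_forall fun u hu => ?_
  by_contra h
  rw [gibbs_eq_zero (fun _ _ => hβ) h, zero_div, ENNReal.ofReal_zero] at hu
  exact hu rfl

theorem integrable_of_temperate (hβ : 0 < β) {f : EuclideanSpace ℝ (Fin N) → ℝ}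
    (hf : f.HasTemperateGrowth) : Integrable f (R.gibbsMeasure β) :=
  (integrable_gibbsMeasure_iff hβ).2 (integrable_mul_gibbs hβ (fun _ _ => hβ.le) hf)

theorem integrable_div (hβ : 1 < β) {f : EuclideanSpace ℝ (Fin N) → ℝ}
    (hf : f.HasTemperateGrowth) {α : EuclideanSpace ℝ (Fin N)} (hα : α ∈ R.posRoots) :
    Integrable (fun u => f u / inner ℝ α u) (R.gibbsMeasure β) := by
  rw [integrable_gibbsMeasure_iff (by linarith)]
  refine (integrable_mul_gibbs_div (R := R) (by linarith) (fun _ _ => hβ) hf hα).congr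
    (Eventually.of_forall fun u => ?_)
  simp only
  ring

theorem update_gt {γ : EuclideanSpace ℝ (Fin N)} [DecidableEq (EuclideanSpace ℝ (Fin N))]
    (hβ : 2 < β) (α : EuclideanSpace ℝ (Fin N)) :
    1 < Function.update (fun _ : EuclideanSpace ℝ (Fin N) => β) γ (β - 1) α := by
  rcases eq_or_ne α γ with rfl | h
  · rw [Function.update_self]; linarith
  · rw [Function.update_of_ne h]; linarith

theorem integrable_div_div (hβ : 2 < β) {f : EuclideanSpace ℝ (Fin N) → ℝ}
    (hf : f.HasTemperateGrowth) {α γ : EuclideanSpace ℝ (Fin N)} (hα : α ∈ R.posRoots)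
    (hγ : γ ∈ R.posRoots) :
    Integrable (fun u => f u / inner ℝ α u / inner ℝ γ u) (R.gibbsMeasure β) := by
  classical
  rw [integrable_gibbsMeasure_iff (by linarith)]
  have h := integrable_mul_gibbs_div (R := R) (β := β) (by linarith)
    (fun α _ => update_gt (γ := γ) hβ α) hf hα
  refine h.congr (Eventually.of_forall fun u => ?_)
  simp only
  rw [gibbs_update (e := fun _ => β) (fun _ _ => by linarith) hγ]
  ring

variable {s : EuclideanSpace ℝ (Fin N)}

theorem IsCritical.inner_pos (hs : R.IsCritical s) {α : EuclideanSpace ℝ (Fin N)}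
    (hα : α ∈ R.posRoots) : 0 < (inner ℝ α s : ℝ) := hs.1 α hα

/-- The basic relation `r = y - y r` between `r = α · z / α · u` and `y = α · z / α · s`. -/
theorem relDev_eq (hs : R.IsCritical s) {α u : EuclideanSpace ℝ (Fin N)} (hα : α ∈ R.posRoots)
    (hu : u ∈ R.openChamber) :
    relDev s α u = inner ℝ (scaledRoot s α) (u - s) -
      inner ℝ (scaledRoot s α) (u - s) * relDev s α u := by
  have h1 := (hs.inner_pos hα).ne'
  have h2 := (hu α hα).ne'
  simp only [relDev, scaledRoot, real_inner_smul_left]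
  rw [inner_sub_right]
  field_simp
  ring

theorem one_sub_relDev (hs : R.IsCritical s) {α u : EuclideanSpace ℝ (Fin N)}
    (hα : α ∈ R.posRoots) (hu : u ∈ R.openChamber) :
    (inner ℝ α u : ℝ)⁻¹ = (inner ℝ α s)⁻¹ * (1 - relDev s α u) := by
  have h1 := (hs.inner_pos hα).ne'
  have h2 := (hu α hα).ne'
  simp only [relDev]
  rw [inner_sub_right]
  field_simp
  ring

/-- The gradient of the energy along `v`, centred at the critical point. -/
theorem force_eq (hs : R.IsCritical s) {u : EuclideanSpace ℝ (Fin N)}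
    (hu : u ∈ R.openChamber) (v : EuclideanSpace ℝ (Fin N)) :
    inner ℝ u v - ∑ α ∈ R.posRoots, inner ℝ α v / (inner ℝ α u : ℝ) =
      inner ℝ (u - s) v + ∑ α ∈ R.posRoots, relDev s α u * inner ℝ (scaledRoot s α) v := by
  have h1 : (inner ℝ s v : ℝ) = ∑ α ∈ R.posRoots, (inner ℝ α s : ℝ)⁻¹ * inner ℝ α v := by
    conv_lhs => rw [hs.2, sum_inner]
    exact Finset.sum_congr rfl fun α _ => real_inner_smul_left _ _ _
  rw [inner_sub_left, h1, sub_add_eq_add_sub, add_sub_assoc, ← Finset.sum_sub_distrib,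
    sub_eq_add_neg, ← Finset.sum_neg_distrib]
  congr 1
  refine Finset.sum_congr rfl fun α hα => ?_
  rw [div_eq_mul_inv, one_sub_relDev hs hα hu, scaledRoot, real_inner_smul_left]
  ring

theorem integrable_mul_relDev (hβ : 1 < β) {f : EuclideanSpace ℝ (Fin N) → ℝ}
    (hf : f.HasTemperateGrowth) {α : EuclideanSpace ℝ (Fin N)} (hα : α ∈ R.posRoots) :
    Integrable (fun u => f u * relDev s α u) (R.gibbsMeasure β) := by
  refine (integrable_div hβ (f := fun u => f u * inner ℝ α (u - s)) (by fun_prop) hα).congr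
    (Eventually.of_forall fun u => ?_)
  simp only [relDev]
  ring

theorem integrable_mul_relDev_mul_relDev (hβ : 2 < β) {f : EuclideanSpace ℝ (Fin N) → ℝ}
    (hf : f.HasTemperateGrowth) {α γ : EuclideanSpace ℝ (Fin N)} (hα : α ∈ R.posRoots)
    (hγ : γ ∈ R.posRoots) :
    Integrable (fun u => f u * relDev s α u * relDev s γ u) (R.gibbsMeasure β) := by
  refine (integrable_div_div hβ (f := fun u => f u * inner ℝ α (u - s) * inner ℝ γ (u - s))
    (by fun_prop) hα hγ).congr (Eventually.of_forall fun u => ?_)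
  simp only [relDev]
  ring

theorem integral_deriv (hs : R.IsCritical s) (hβ : 1 < β)
    {f f' : EuclideanSpace ℝ (Fin N) → ℝ} (hf : f.HasTemperateGrowth) (hf' : f'.HasTemperateGrowth)
    (v : EuclideanSpace ℝ (Fin N)) (hd : ∀ u, HasLineDerivAt ℝ f (f' u) u v) :
    ∫ u, f' u ∂(R.gibbsMeasure β) = β * ∫ u, f u * (inner ℝ (u - s) v +
      ∑ α ∈ R.posRoots, relDev s α u * inner ℝ (scaledRoot s α) v) ∂(R.gibbsMeasure β) := by
  have hβ0 : 0 < β := by linarith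
  rw [integral_gibbsMeasure hβ0, integral_deriv_mul_gibbs hβ0 (fun _ _ => hβ) hf hf' v hd,
    ← integral_gibbsMeasure hβ0, ← integral_const_mul]
  refine integral_congr_ae ?_
  filter_upwards [ae_mem_openChamber hβ0] with u hu
  rw [← force_eq hs hu]
  simp_rw [mul_div_assoc]
  rw [← Finset.mul_sum]
  ring

theorem integral_deriv_mul_one_sub (hs : R.IsCritical s) (hβ : 2 < β)
    {f f' : EuclideanSpace ℝ (Fin N) → ℝ} (hf : f.HasTemperateGrowth) (hf' : f'.HasTemperateGrowth)
    (v : EuclideanSpace ℝ (Fin N)) (hd : ∀ u, HasLineDerivAt ℝ f (f' u) u v)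
    {γ : EuclideanSpace ℝ (Fin N)} (hγ : γ ∈ R.posRoots) :
    ∫ u, f' u * (1 - relDev s γ u) ∂(R.gibbsMeasure β) =
      ∫ u, f u * (1 - relDev s γ u) * (β * (inner ℝ (u - s) v +
        ∑ α ∈ R.posRoots, relDev s α u * inner ℝ (scaledRoot s α) v) +
        inner ℝ (scaledRoot s γ) v * (1 - relDev s γ u)) ∂(R.gibbsMeasure β) := by
  classical
  have hβ0 : 0 < β := by linarith
  have h := integral_deriv_mul_gibbs hβ0 (R := R) (fun α _ => update_gt (γ := γ) hβ α) hf hf' v hd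
  simp_rw [gibbs_update (R := R) (e := fun _ => β)
    (fun _ _ => by linarith : ∀ α ∈ R.posRoots, 1 < β)
    hγ] at h
  have key : ∀ g : EuclideanSpace ℝ (Fin N) → ℝ,
      ∫ u, g u * (1 - relDev s γ u) ∂(R.gibbsMeasure β) = (inner ℝ γ s : ℝ) *
        ((∫ u, g u * (R.gibbs β (fun _ => β) u / inner ℝ γ u)) /
          ∫ x, R.gibbs β (fun _ => β) x) := by
    intro g
    have h1 : (fun u => g u * (R.gibbs β (fun _ => β) u / inner ℝ γ u)) =
        fun u => (g u / inner ℝ γ u) * R.gibbs β (fun _ => β) u := by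
      funext u; ring
    rw [h1, ← integral_gibbsMeasure hβ0, ← integral_const_mul]
    refine integral_congr_ae ?_
    filter_upwards [ae_mem_openChamber hβ0] with u hu
    rw [div_eq_mul_inv, one_sub_relDev hs hγ hu]
    have := (hs.inner_pos hγ).ne'
    field_simp
  rw [key, h, ← key]
  refine integral_congr_ae ?_
  filter_upwards [ae_mem_openChamber hβ0] with u hu
  rw [← force_eq hs hu]
  have h2 : ∑ α ∈ R.posRoots, Function.update (fun _ : EuclideanSpace ℝ (Fin N) => β) γ (β - 1) α *
      inner ℝ α v / (inner ℝ α u : ℝ) = β * ∑ α ∈ R.posRoots, inner ℝ α v / (inner ℝ α u : ℝ) -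
      inner ℝ γ v / (inner ℝ γ u : ℝ) := by
    rw [Finset.mul_sum, ← Finset.add_sum_erase _ _ hγ, Function.update_self,
      ← Finset.add_sum_erase _ (fun α => β * (inner ℝ α v / (inner ℝ α u : ℝ))) hγ]
    have : ∑ x ∈ R.posRoots.erase γ, Function.update (fun _ : EuclideanSpace ℝ (Fin N) => β) γ
        (β - 1) x * inner ℝ x v / (inner ℝ x u : ℝ) =
        ∑ x ∈ R.posRoots.erase γ, β * (inner ℝ x v / (inner ℝ x u : ℝ)) :=
      Finset.sum_congr rfl fun x hx => by
        rw [Function.update_of_ne (Finset.ne_of_mem_erase hx)]; ring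
    rw [this]
    ring
  rw [h2, div_eq_mul_inv (inner ℝ γ v) _, one_sub_relDev hs hγ hu, scaledRoot,
    real_inner_smul_left]
  ring

end DunklRootSystem

namespace DunklRootSystem

variable {N : ℕ} {R : DunklRootSystem N} {β : ℝ} {s : EuclideanSpace ℝ (Fin N)}

theorem inner_scaledRoot_eq (hs : R.IsCritical s) {α u : EuclideanSpace ℝ (Fin N)}
    (hα : α ∈ R.posRoots) :
    1 + inner ℝ (scaledRoot s α) (u - s) = inner ℝ α u / (inner ℝ α s : ℝ) := by
  have := (hs.inner_pos hα).ne'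
  rw [scaledRoot, real_inner_smul_left, inner_sub_right]
  field_simp
  ring

theorem relDev_mul_nonneg (hs : R.IsCritical s) {α u : EuclideanSpace ℝ (Fin N)}
    (hα : α ∈ R.posRoots) (hu : u ∈ R.openChamber) :
    0 ≤ relDev s α u * inner ℝ (scaledRoot s α) (u - s) := by
  have h1 := relDev_eq hs hα hu
  have h2 := inner_scaledRoot_eq hs (u := u) hα
  have h3 : 0 < inner ℝ α u / (inner ℝ α s : ℝ) := div_pos (hu α hα) (hs.inner_pos hα)
  have h4 : relDev s α u * inner ℝ (scaledRoot s α) (u - s) =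
      relDev s α u ^ 2 * (1 + inner ℝ (scaledRoot s α) (u - s)) := by
    linear_combination (-relDev s α u) * h1
  rw [h4, h2]
  positivity

theorem one_sub_relDev_pos (hs : R.IsCritical s) {α u : EuclideanSpace ℝ (Fin N)}
    (hα : α ∈ R.posRoots) (hu : u ∈ R.openChamber) : 0 < 1 - relDev s α u := by
  have h1 := one_sub_relDev hs hα hu
  have h2 := hs.inner_pos hα
  have h3 := inv_pos.2 (hu α hα)
  rw [h1] at h3
  exact (pos_iff_pos_of_mul_pos h3).1 (inv_pos.2 h2)

theorem integrable_mul_force (hβ : 1 < β) {f : EuclideanSpace ℝ (Fin N) → ℝ}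
    (hf : f.HasTemperateGrowth) (v : EuclideanSpace ℝ (Fin N)) :
    Integrable (fun u => f u * (inner ℝ (u - s) v +
      ∑ α ∈ R.posRoots, relDev s α u * inner ℝ (scaledRoot s α) v)) (R.gibbsMeasure β) := by
  have h : Integrable (fun u => f u * inner ℝ (u - s) v +
      ∑ α ∈ R.posRoots, (f u * relDev s α u) * inner ℝ (scaledRoot s α) v) (R.gibbsMeasure β) :=
    (integrable_of_temperate (by linarith) (by fun_prop)).add
      (integrable_finsetSum _ fun α hα => (integrable_mul_relDev hβ hf hα).mul_const _)
  refine h.congr (Eventually.of_forall fun u => ?_)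
  simp only
  rw [mul_add, Finset.mul_sum]
  simp_rw [mul_assoc]

theorem integrable_mul_one_sub_mul_force (hβ : 2 < β) {f : EuclideanSpace ℝ (Fin N) → ℝ}
    (hf : f.HasTemperateGrowth) (v : EuclideanSpace ℝ (Fin N)) {γ : EuclideanSpace ℝ (Fin N)}
    (hγ : γ ∈ R.posRoots) :
    Integrable (fun u => f u * (1 - relDev s γ u) * (β * (inner ℝ (u - s) v +
        ∑ α ∈ R.posRoots, relDev s α u * inner ℝ (scaledRoot s α) v) +
        inner ℝ (scaledRoot s γ) v * (1 - relDev s γ u))) (R.gibbsMeasure β) := by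
  have hf1 : (fun u => f u * inner ℝ (u - s) v).HasTemperateGrowth := by fun_prop
  have h1 := (integrable_mul_force (R := R) (s := s) (by linarith : 1 < β) hf v).const_mul β
  have h2 := (integrable_mul_relDev (R := R) (s := s) (by linarith : 1 < β) hf1 hγ).const_mul β
  have h3 : Integrable (fun u => ∑ α ∈ R.posRoots, (β * inner ℝ (scaledRoot s α) v) *
      (f u * relDev s γ u * relDev s α u)) (R.gibbsMeasure β) :=
    integrable_finsetSum _ fun α hα => (integrable_mul_relDev_mul_relDev hβ hf hγ hα).const_mul _
  have h4 := (integrable_of_temperate (R := R) (by linarith : 0 < β) hf).const_mul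
    (inner ℝ (scaledRoot s γ) v)
  have h5 := (integrable_mul_relDev (R := R) (s := s) (by linarith : 1 < β) hf hγ).const_mul
    (-2 * inner ℝ (scaledRoot s γ) v)
  have h6 := (integrable_mul_relDev_mul_relDev (s := s) hβ hf hγ hγ).const_mul
    (inner ℝ (scaledRoot s γ) v)
  refine ((((h1.sub h2).sub h3).add h4).add (h5.add h6)).congr (Eventually.of_forall fun u => ?_)
  simp only [Pi.add_apply, Pi.sub_apply]
  have : ∑ α ∈ R.posRoots, (β * inner ℝ (scaledRoot s α) v) * (f u * relDev s γ u * relDev s α u) =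
      β * (f u * relDev s γ u) * ∑ α ∈ R.posRoots, relDev s α u * inner ℝ (scaledRoot s α) v := by
    rw [Finset.mul_sum]
    exact Finset.sum_congr rfl fun α _ => by ring
  rw [this]
  ring

theorem hasLineDerivAt_radial (s b : EuclideanSpace ℝ (Fin N)) (k : ℕ)
    (u : EuclideanSpace ℝ (Fin N)) :
    HasLineDerivAt ℝ (fun u => (‖u - s‖ ^ 2) ^ k * inner ℝ b (u - s))
      (2 * k * (‖u - s‖ ^ 2) ^ (k - 1) * (inner ℝ b (u - s) * inner ℝ b (u - s)) +
        (‖u - s‖ ^ 2) ^ k * (inner ℝ b b : ℝ)) u b := by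
  have h4 : HasDerivAt (fun t : ℝ => u + t • b - s) b 0 := by
    simpa using (((hasDerivAt_id (0 : ℝ)).smul_const b).const_add u).sub_const s
  have h1 := (h4.norm_sq.pow k).mul ((hasDerivAt_const (0 : ℝ) b).inner ℝ h4)
  unfold HasLineDerivAt
  convert! h1 using 1
  simp only [zero_smul, add_zero, inner_zero_left, Pi.pow_apply]
  rw [real_inner_comm b (u - s)]
  ring

theorem radial_sum (k : ℕ) (q : ℝ) : 2 * k * q ^ (k - 1) * q + q ^ k * N = (N + 2 * k) * q ^ k := by
  rcases k with _ | k
  · simp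
  · simp only [Nat.add_sub_cancel, pow_succ]
    ring

theorem sum_radial (s : EuclideanSpace ℝ (Fin N)) (k : ℕ) (u : EuclideanSpace ℝ (Fin N)) :
    ∑ i, (2 * k * (‖u - s‖ ^ 2) ^ (k - 1) * (inner ℝ (EuclideanSpace.basisFun (Fin N) ℝ i) (u - s) *
        inner ℝ (EuclideanSpace.basisFun (Fin N) ℝ i) (u - s)) +
        (‖u - s‖ ^ 2) ^ k * (inner ℝ (EuclideanSpace.basisFun (Fin N) ℝ i)
          (EuclideanSpace.basisFun (Fin N) ℝ i) : ℝ)) = (N + 2 * k) * (‖u - s‖ ^ 2) ^ k := by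
  have h1 : ∑ i, (inner ℝ (EuclideanSpace.basisFun (Fin N) ℝ i) (u - s) *
        inner ℝ (EuclideanSpace.basisFun (Fin N) ℝ i) (u - s) : ℝ) = ‖u - s‖ ^ 2 := by
    rw [← real_inner_self_eq_norm_sq,
      ← (EuclideanSpace.basisFun (Fin N) ℝ).sum_inner_mul_inner (u - s) (u - s)]
    exact Finset.sum_congr rfl fun i _ => by rw [real_inner_comm (u - s)]
  have h2 : ∀ i, (inner ℝ (EuclideanSpace.basisFun (Fin N) ℝ i)
      (EuclideanSpace.basisFun (Fin N) ℝ i) : ℝ) = 1 := fun i => by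
    rw [real_inner_self_eq_norm_sq, (EuclideanSpace.basisFun (Fin N) ℝ).norm_eq_one, one_pow]
  rw [Finset.sum_add_distrib, ← Finset.mul_sum, h1]
  simp_rw [h2]
  rw [← radial_sum]
  simp [mul_comm]

theorem sum_inner_mul_force (s u : EuclideanSpace ℝ (Fin N)) :
    ∑ i, (inner ℝ (EuclideanSpace.basisFun (Fin N) ℝ i) (u - s) : ℝ) *
      (inner ℝ (u - s) (EuclideanSpace.basisFun (Fin N) ℝ i) + ∑ α ∈ R.posRoots, relDev s α u *
        inner ℝ (scaledRoot s α) (EuclideanSpace.basisFun (Fin N) ℝ i)) =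
      ‖u - s‖ ^ 2 + ∑ α ∈ R.posRoots, relDev s α u * inner ℝ (scaledRoot s α) (u - s) := by
  simp_rw [mul_add, Finset.sum_add_distrib, Finset.mul_sum]
  rw [Finset.sum_comm]
  have h : ∀ x : EuclideanSpace ℝ (Fin N), ∑ i,
      (inner ℝ (EuclideanSpace.basisFun (Fin N) ℝ i) (u - s) : ℝ) *
        inner ℝ x (EuclideanSpace.basisFun (Fin N) ℝ i) = inner ℝ x (u - s) := fun x => by
    rw [← (EuclideanSpace.basisFun (Fin N) ℝ).sum_inner_mul_inner x (u - s)]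
    exact Finset.sum_congr rfl fun i _ => mul_comm _ _
  rw [h, real_inner_self_eq_norm_sq]
  congr 1
  refine Finset.sum_congr rfl fun α _ => ?_
  rw [← h (scaledRoot s α), Finset.mul_sum]
  exact Finset.sum_congr rfl fun i _ => by ring

theorem temperate_normSq_pow (s : EuclideanSpace ℝ (Fin N)) (k : ℕ) :
    Function.HasTemperateGrowth fun u : EuclideanSpace ℝ (Fin N) => (‖u - s‖ ^ 2) ^ k := by
  have h1 : Function.HasTemperateGrowth fun u : EuclideanSpace ℝ (Fin N) => u - s := by fun_prop
  exact ((Function.hasTemperateGrowth_norm_sq (EuclideanSpace ℝ (Fin N))).comp h1).pow k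

/-- Integration by parts against the radial field `‖z‖^{2k} z`. -/
theorem integral_radial (hs : R.IsCritical s) (hβ : 1 < β) (k : ℕ) :
    ((N : ℝ) + 2 * k) * ∫ u, (‖u - s‖ ^ 2) ^ k ∂(R.gibbsMeasure β) =
      β * ∫ u, (‖u - s‖ ^ 2) ^ k * (‖u - s‖ ^ 2 + ∑ α ∈ R.posRoots,
        relDev s α u * inner ℝ (scaledRoot s α) (u - s)) ∂(R.gibbsMeasure β) := by
  have hq := temperate_normSq_pow s
  have h1 := fun i => integral_deriv hs hβ
    (f := fun u => (‖u - s‖ ^ 2) ^ k * inner ℝ (EuclideanSpace.basisFun (Fin N) ℝ i) (u - s))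
    (by have := hq k; fun_prop) (by have := hq k; have := hq (k - 1); fun_prop) _
    (hasLineDerivAt_radial s (EuclideanSpace.basisFun (Fin N) ℝ i) k)
  have h2 := Finset.sum_congr (s₁ := Finset.univ) rfl fun i _ => h1 i
  rw [← Finset.mul_sum, ← integral_finsetSum, ← integral_finsetSum] at h2
  · simp_rw [sum_radial, integral_const_mul, mul_assoc, ← Finset.mul_sum,
      sum_inner_mul_force] at h2
    exact h2
  · intro i _
    exact integrable_mul_force hβ (by have := hq k; fun_prop) _
  · intro i _
    exact integrable_of_temperate (by linarith)
      (by have := hq k; have := hq (k - 1); fun_prop)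

theorem integrable_radial (hβ : 1 < β) (k : ℕ) :
    Integrable (fun u => (‖u - s‖ ^ 2) ^ k * (‖u - s‖ ^ 2 + ∑ α ∈ R.posRoots,
        relDev s α u * inner ℝ (scaledRoot s α) (u - s))) (R.gibbsMeasure β) := by
  have hq := temperate_normSq_pow s
  simp_rw [← sum_inner_mul_force (R := R), Finset.mul_sum, ← mul_assoc]
  refine integrable_finsetSum _ fun i _ => ?_
  exact integrable_mul_force hβ (by have := hq k; fun_prop) _

/-- Integration by parts against the field `‖z‖^{2k} z / γ · u`. -/
theorem integral_radial_one_sub (hs : R.IsCritical s) (hβ : 2 < β) (k : ℕ)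
    {γ : EuclideanSpace ℝ (Fin N)} (hγ : γ ∈ R.posRoots) :
    ((N : ℝ) + 2 * k) * ∫ u, (‖u - s‖ ^ 2) ^ k * (1 - relDev s γ u) ∂(R.gibbsMeasure β) =
      ∫ u, (‖u - s‖ ^ 2) ^ k * (1 - relDev s γ u) * (β * (‖u - s‖ ^ 2 + ∑ α ∈ R.posRoots,
        relDev s α u * inner ℝ (scaledRoot s α) (u - s)) +
          inner ℝ (scaledRoot s γ) (u - s) * (1 - relDev s γ u)) ∂(R.gibbsMeasure β) ∧
    Integrable (fun u => (‖u - s‖ ^ 2) ^ k * (1 - relDev s γ u) * (β * (‖u - s‖ ^ 2 +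
      ∑ α ∈ R.posRoots, relDev s α u * inner ℝ (scaledRoot s α) (u - s)) +
          inner ℝ (scaledRoot s γ) (u - s) * (1 - relDev s γ u))) (R.gibbsMeasure β) := by
  have hq := temperate_normSq_pow s
  set b := EuclideanSpace.basisFun (Fin N) ℝ with hb
  have hsum : ∀ u, ∑ i, (‖u - s‖ ^ 2) ^ k * inner ℝ (b i) (u - s) * (1 - relDev s γ u) *
      (β * (inner ℝ (u - s) (b i) + ∑ α ∈ R.posRoots, relDev s α u *
        inner ℝ (scaledRoot s α) (b i)) + inner ℝ (scaledRoot s γ) (b i) * (1 - relDev s γ u)) =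
      (‖u - s‖ ^ 2) ^ k * (1 - relDev s γ u) * (β * (‖u - s‖ ^ 2 +
      ∑ α ∈ R.posRoots, relDev s α u * inner ℝ (scaledRoot s α) (u - s)) +
          inner ℝ (scaledRoot s γ) (u - s) * (1 - relDev s γ u)) := by
    intro u
    rw [← sum_inner_mul_force (R := R), ← b.sum_inner_mul_inner (scaledRoot s γ) (u - s),
      Finset.mul_sum, Finset.sum_mul, ← Finset.sum_add_distrib, Finset.mul_sum]
    exact Finset.sum_congr rfl fun i _ => by ring
  have hint : ∀ i ∈ (Finset.univ : Finset (Fin N)), Integrable (fun u =>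
      (‖u - s‖ ^ 2) ^ k * inner ℝ (b i) (u - s) * (1 - relDev s γ u) *
      (β * (inner ℝ (u - s) (b i) + ∑ α ∈ R.posRoots, relDev s α u *
        inner ℝ (scaledRoot s α) (b i)) + inner ℝ (scaledRoot s γ) (b i) * (1 - relDev s γ u)))
      (R.gibbsMeasure β) := fun i _ =>
    integrable_mul_one_sub_mul_force hβ (by have := hq k; fun_prop) _ hγ
  constructor
  · have h1 := fun i => integral_deriv_mul_one_sub hs hβ
      (f := fun u => (‖u - s‖ ^ 2) ^ k * inner ℝ (b i) (u - s))
      (by have := hq k; fun_prop) (by have := hq k; have := hq (k - 1); fun_prop) _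
      (hasLineDerivAt_radial s (b i) k) hγ
    have h2 := Finset.sum_congr (s₁ := Finset.univ) rfl fun i _ => h1 i
    rw [← integral_finsetSum, ← integral_finsetSum _ hint] at h2
    · simp_rw [← Finset.sum_mul, hb, sum_radial, mul_assoc, integral_const_mul] at h2
      rw [h2]
      refine integral_congr_ae (Eventually.of_forall fun u => ?_)
      simp only
      rw [← hsum u]
      exact Finset.sum_congr rfl fun i _ => by ring
    · intro i _
      simp_rw [mul_sub, mul_one]
      have ht : Function.HasTemperateGrowth (fun u => (2 * k * (‖u - s‖ ^ 2) ^ (k - 1) *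
        (inner ℝ (b i) (u - s) * inner ℝ (b i) (u - s)) +
        (‖u - s‖ ^ 2) ^ k * (inner ℝ (b i) (b i) : ℝ))) := by
        have := hq k; have := hq (k - 1); fun_prop
      exact (integrable_of_temperate (by linarith) ht).sub
        (integrable_mul_relDev (by linarith) ht hγ)
  · exact (integrable_finsetSum _ hint).congr (Eventually.of_forall hsum)

/-- Integration by parts along the radial field `u - s`: the part of `-∇F` beyond the linear term
`s - u` pulls towards `s`, so the moments of `‖u - s‖²` are bounded as for a Gaussian of variance
`β⁻¹`. -/
theorem integral_normSq_pow_succ_le (hs : R.IsCritical s) (hβ : 1 < β) (k : ℕ) :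
    ∫ u, (‖u - s‖ ^ 2) ^ (k + 1) ∂(R.gibbsMeasure β) ≤
      (N + 2 * k) / β * ∫ u, (‖u - s‖ ^ 2) ^ k ∂(R.gibbsMeasure β) := by
  have hβ0 : 0 < β := by linarith
  rw [div_mul_eq_mul_div, le_div_iff₀ hβ0, integral_radial hs hβ, mul_comm]
  refine mul_le_mul_of_nonneg_left ?_ hβ0.le
  refine integral_mono_ae (integrable_of_temperate hβ0 (temperate_normSq_pow s _))
    (integrable_radial hβ k) ?_
  filter_upwards [ae_mem_openChamber hβ0] with u hu
  rw [pow_succ]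
  refine mul_le_mul_of_nonneg_left ?_ (by positivity)
  exact le_add_of_nonneg_right (Finset.sum_nonneg fun α hα => relDev_mul_nonneg hs hα hu)

/-- The companion bound for the singular variable `relDev s γ`, one factor `β⁻¹` for its square.
-/
theorem integral_normSq_pow_mul_sq_le (hs : R.IsCritical s) {k : ℕ} (hβ : 2 < β)
    (hβk : 4 * (N + 2 * k + 1) ≤ β) {γ : EuclideanSpace ℝ (Fin N)} (hγ : γ ∈ R.posRoots) :
    ∫ u, (‖u - s‖ ^ 2) ^ k * relDev s γ u * relDev s γ u ∂(R.gibbsMeasure β) ≤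
      4 * (N + 2 * k + 1) / β * ∫ u, (‖u - s‖ ^ 2) ^ k ∂(R.gibbsMeasure β) := by
  have hβ0 : 0 < β := by linarith
  have hq := temperate_normSq_pow s k
  obtain ⟨h1, h2⟩ := integral_radial_one_sub hs hβ k hγ
  have hI0 := integrable_of_temperate (R := R) hβ0 hq
  have hI1 := integrable_mul_relDev (R := R) (s := s) (by linarith : 1 < β) hq hγ
  have hI2 := integrable_mul_relDev_mul_relDev (R := R) (s := s) hβ hq hγ hγ
  set D : ℝ := N + 2 * k with hD
  have hD0 : 0 ≤ D := by positivity
  have h3 : ∫ u, ((‖u - s‖ ^ 2) ^ k * relDev s γ u + (β - 1) * ((‖u - s‖ ^ 2) ^ k * relDev s γ u *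
      relDev s γ u)) ∂(R.gibbsMeasure β) ≤
      ∫ u, D * ((‖u - s‖ ^ 2) ^ k - (‖u - s‖ ^ 2) ^ k * relDev s γ u) ∂(R.gibbsMeasure β) := by
    rw [integral_const_mul]
    have : ∫ u, ((‖u - s‖ ^ 2) ^ k - (‖u - s‖ ^ 2) ^ k * relDev s γ u) ∂(R.gibbsMeasure β) =
      ∫ u, (‖u - s‖ ^ 2) ^ k * (1 - relDev s γ u) ∂(R.gibbsMeasure β) := by
      simp_rw [mul_sub, mul_one]
    rw [this, h1]
    refine integral_mono_ae (hI1.add (hI2.const_mul (β - 1))) h2 ?_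
    filter_upwards [ae_mem_openChamber hβ0] with u hu
    have e1 := relDev_eq hs hγ hu
    have e2 := one_sub_relDev_pos hs hγ hu
    have e3 : relDev s γ u * inner ℝ (scaledRoot s γ) (u - s) ≤ ∑ α ∈ R.posRoots,
        relDev s α u * inner ℝ (scaledRoot s α) (u - s) :=
      Finset.single_le_sum (f := fun α => relDev s α u * inner ℝ (scaledRoot s α) (u - s))
        (fun α hα => relDev_mul_nonneg hs hα hu) hγ
    have e4 : (0 : ℝ) ≤ (‖u - s‖ ^ 2) ^ k := by positivity
    have e5 : (1 - relDev s γ u) * (β * (relDev s γ u * inner ℝ (scaledRoot s γ) (u - s)) +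
        inner ℝ (scaledRoot s γ) (u - s) * (1 - relDev s γ u)) ≤
        (1 - relDev s γ u) * (β * (‖u - s‖ ^ 2 + ∑ α ∈ R.posRoots,
        relDev s α u * inner ℝ (scaledRoot s α) (u - s)) +
          inner ℝ (scaledRoot s γ) (u - s) * (1 - relDev s γ u)) := by
      refine mul_le_mul_of_nonneg_left ?_ e2.le
      gcongr
      nlinarith [sq_nonneg ‖u - s‖]
    have e6 : (1 - relDev s γ u) * (β * (relDev s γ u * inner ℝ (scaledRoot s γ) (u - s)) +
        inner ℝ (scaledRoot s γ) (u - s) * (1 - relDev s γ u)) =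
        β * relDev s γ u ^ 2 + relDev s γ u * (1 - relDev s γ u) := by
      have : inner ℝ (scaledRoot s γ) (u - s) * (1 - relDev s γ u) = relDev s γ u := by
        linarith
      linear_combination (β * relDev s γ u + (1 - relDev s γ u)) * this
    calc (‖u - s‖ ^ 2) ^ k * relDev s γ u + (β - 1) * ((‖u - s‖ ^ 2) ^ k * relDev s γ u *
          relDev s γ u)
        = (‖u - s‖ ^ 2) ^ k * (β * relDev s γ u ^ 2 + relDev s γ u * (1 - relDev s γ u)) := by ring
      _ ≤ _ := by
        rw [mul_assoc, ← e6]
        exact mul_le_mul_of_nonneg_left e5 e4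
  have h4 : ∫ u, ((‖u - s‖ ^ 2) ^ k * relDev s γ u + (β - 1) * ((‖u - s‖ ^ 2) ^ k * relDev s γ u *
      relDev s γ u)) ∂(R.gibbsMeasure β) = ∫ u, (‖u - s‖ ^ 2) ^ k * relDev s γ u ∂(R.gibbsMeasure β)
      + (β - 1) * ∫ u, (‖u - s‖ ^ 2) ^ k * relDev s γ u * relDev s γ u ∂(R.gibbsMeasure β) := by
    rw [integral_add hI1 (hI2.const_mul _), integral_const_mul]
  rw [h4, integral_const_mul, integral_sub hI0 hI1] at h3
  have h5 : -∫ u, (‖u - s‖ ^ 2) ^ k * relDev s γ u ∂(R.gibbsMeasure β) ≤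
      ((∫ u, (‖u - s‖ ^ 2) ^ k ∂(R.gibbsMeasure β)) +
        ∫ u, (‖u - s‖ ^ 2) ^ k * relDev s γ u * relDev s γ u ∂(R.gibbsMeasure β)) / 2 := by
    rw [← integral_neg, ← integral_add hI0 hI2, ← integral_div]
    refine integral_mono hI1.neg ((hI0.add hI2).div_const 2) fun u => ?_
    have e4 : (0 : ℝ) ≤ (‖u - s‖ ^ 2) ^ k := by positivity
    simp only
    nlinarith [mul_nonneg e4 (sq_nonneg (1 + relDev s γ u))]
  have hA : 0 ≤ ∫ u, (‖u - s‖ ^ 2) ^ k * relDev s γ u * relDev s γ u ∂(R.gibbsMeasure β) :=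
    integral_nonneg fun u => by
      simp only [Pi.zero_apply, mul_assoc]
      exact mul_nonneg (by positivity) (mul_self_nonneg _)
  have hB : 0 ≤ ∫ u, (‖u - s‖ ^ 2) ^ k ∂(R.gibbsMeasure β) :=
    integral_nonneg fun u => by simp only [Pi.zero_apply]; positivity
  set A := ∫ u, (‖u - s‖ ^ 2) ^ k * relDev s γ u * relDev s γ u ∂(R.gibbsMeasure β)
  set B := ∫ u, (‖u - s‖ ^ 2) ^ k ∂(R.gibbsMeasure β)
  rw [div_mul_eq_mul_div, le_div_iff₀ hβ0]
  have h6 := mul_le_mul_of_nonneg_left h5 (by linarith : 0 ≤ D + 1)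
  nlinarith [mul_le_mul_of_nonneg_right hβk hA, mul_nonneg hD0 hB, mul_nonneg hD0 hA]

end DunklRootSystem

/-! ### Expansion of the moments in powers of `1 / β` -/

namespace DunklRootSystem

variable {N : ℕ} {R : DunklRootSystem N} {s : EuclideanSpace ℝ (Fin N)}

theorem isBigO_normSq_pow (hs : R.IsCritical s) (k : ℕ) :
    (fun β : ℝ => ∫ u, (‖u - s‖ ^ 2) ^ k ∂(R.gibbsMeasure β)) =O[atTop]
      fun β : ℝ => β⁻¹ ^ k := by
  induction k with
  | zero =>
    refine Asymptotics.IsBigO.of_bound 1 ?_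
    filter_upwards [eventually_gt_atTop 0] with β hβ
    have := isProbabilityMeasure_gibbsMeasure (R := R) hβ
    simp
  | succ k ih =>
    have h1 : (fun β : ℝ => ∫ u, (‖u - s‖ ^ 2) ^ (k + 1) ∂(R.gibbsMeasure β)) =O[atTop]
        fun β : ℝ => β⁻¹ * ∫ u, (‖u - s‖ ^ 2) ^ k ∂(R.gibbsMeasure β) := by
      refine Asymptotics.IsBigO.of_bound (N + 2 * k) ?_
      filter_upwards [eventually_gt_atTop 1] with β hβ
      have hβ0 : 0 < β := by linarith
      have h2 := integral_normSq_pow_succ_le hs hβ k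
      have hB : 0 ≤ ∫ u, (‖u - s‖ ^ 2) ^ k ∂(R.gibbsMeasure β) :=
        integral_nonneg fun u => by simp only [Pi.zero_apply]; positivity
      have hB' : 0 ≤ ∫ u, (‖u - s‖ ^ 2) ^ (k + 1) ∂(R.gibbsMeasure β) :=
        integral_nonneg fun u => by simp only [Pi.zero_apply]; positivity
      rw [Real.norm_of_nonneg hB', Real.norm_of_nonneg (by positivity)]
      rwa [div_eq_mul_inv, mul_assoc] at h2
    refine h1.trans ?_
    simp_rw [pow_succ' (_ : ℝ)⁻¹]
    exact (Asymptotics.isBigO_refl _ _).mul ih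

theorem isBigO_normSq_pow_mul_sq (hs : R.IsCritical s) (k : ℕ) {γ : EuclideanSpace ℝ (Fin N)}
    (hγ : γ ∈ R.posRoots) :
    (fun β : ℝ => ∫ u, (‖u - s‖ ^ 2) ^ k * relDev s γ u * relDev s γ u ∂(R.gibbsMeasure β))
      =O[atTop] fun β : ℝ => β⁻¹ ^ (k + 1) := by
  have h1 : (fun β : ℝ => ∫ u, (‖u - s‖ ^ 2) ^ k * relDev s γ u * relDev s γ u
      ∂(R.gibbsMeasure β)) =O[atTop]
      fun β : ℝ => β⁻¹ * ∫ u, (‖u - s‖ ^ 2) ^ k ∂(R.gibbsMeasure β) := by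
    refine Asymptotics.IsBigO.of_bound (4 * (N + 2 * k + 1)) ?_
    filter_upwards [eventually_gt_atTop 2, eventually_ge_atTop (4 * (N + 2 * k + 1) : ℝ)]
      with β hβ hβk
    have hβ0 : 0 < β := by linarith
    have h2 := integral_normSq_pow_mul_sq_le hs hβ hβk hγ
    have hB : 0 ≤ ∫ u, (‖u - s‖ ^ 2) ^ k ∂(R.gibbsMeasure β) :=
      integral_nonneg fun u => by simp only [Pi.zero_apply]; positivity
    have hB' : 0 ≤ ∫ u, (‖u - s‖ ^ 2) ^ k * relDev s γ u * relDev s γ u ∂(R.gibbsMeasure β) :=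
      integral_nonneg fun u => by
        simp only [Pi.zero_apply, mul_assoc]
        exact mul_nonneg (by positivity) (mul_self_nonneg _)
    rw [Real.norm_of_nonneg hB', Real.norm_of_nonneg (by positivity)]
    rwa [div_eq_mul_inv, mul_assoc] at h2
  refine h1.trans ?_
  simp_rw [pow_succ' (_ : ℝ)⁻¹]
  exact (Asymptotics.isBigO_refl _ _).mul (isBigO_normSq_pow hs k)

/-- An integrand dominated by `C (q^k + q^l r²)`, `q = ‖z‖²`, has mean `O(β^{-j})` when
`j ≤ k` and `j ≤ l + 1`. -/
theorem isBigO_of_le (hs : R.IsCritical s) {γ : EuclideanSpace ℝ (Fin N)} (hγ : γ ∈ R.posRoots)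
    (k l j : ℕ) (hk : j ≤ k) (hl : j ≤ l + 1) {f : EuclideanSpace ℝ (Fin N) → ℝ} (C : ℝ)
    (hf : ∀ u ∈ R.openChamber, |f u| ≤ C * ((‖u - s‖ ^ 2) ^ k +
      (‖u - s‖ ^ 2) ^ l * relDev s γ u * relDev s γ u)) :
    (fun β : ℝ => ∫ u, f u ∂(R.gibbsMeasure β)) =O[atTop] fun β : ℝ => β⁻¹ ^ j := by
  have hmono : ∀ i, j ≤ i → (fun β : ℝ => β⁻¹ ^ i) =O[atTop] fun β : ℝ => β⁻¹ ^ j := by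
    intro i hi
    refine Asymptotics.IsBigO.of_bound 1 ?_
    filter_upwards [eventually_ge_atTop 1] with β hβ
    have hβ0 : 0 < β := by linarith
    rw [Real.norm_of_nonneg (by positivity), Real.norm_of_nonneg (by positivity), one_mul]
    exact pow_le_pow_of_le_one (by positivity) (inv_le_one_of_one_le₀ hβ) hi
  have h1 := (((isBigO_normSq_pow hs k).trans (hmono k hk)).add
    ((isBigO_normSq_pow_mul_sq hs l hγ).trans (hmono _ hl))).const_mul_left C
  refine Asymptotics.IsBigO.trans (Asymptotics.IsBigO.of_bound 1 ?_) h1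
  filter_upwards [eventually_gt_atTop 2] with β hβ
  have hI := integrable_of_temperate (R := R) (by linarith : 0 < β) (temperate_normSq_pow s k)
  have hI2 := integrable_mul_relDev_mul_relDev (R := R) (s := s) hβ (temperate_normSq_pow s l) hγ hγ
  rw [one_mul, ← integral_add hI hI2, ← integral_const_mul]
  refine (norm_integral_le_of_norm_le ((hI.add hI2).const_mul C) ?_).trans (le_abs_self _)
  filter_upwards [ae_mem_openChamber (by linarith : 0 < β)] with u hu
  exact hf u hu

/-- The Hessian of the energy at the critical point `s`. -/
noncomputable def hess (R : DunklRootSystem N) (s : EuclideanSpace ℝ (Fin N)) :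
    EuclideanSpace ℝ (Fin N) →ₗ[ℝ] EuclideanSpace ℝ (Fin N) :=
  LinearMap.id + ∑ α ∈ R.posRoots,
    (innerₛₗ ℝ (scaledRoot s α)).smulRight (scaledRoot s α)

theorem hess_apply (v : EuclideanSpace ℝ (Fin N)) : R.hess s v =
    v + ∑ α ∈ R.posRoots, (inner ℝ (scaledRoot s α) v : ℝ) • scaledRoot s α := by
  simp [hess]

theorem inner_hess (v w : EuclideanSpace ℝ (Fin N)) : inner ℝ (R.hess s v) w =
    inner ℝ v w + ∑ α ∈ R.posRoots,
      (inner ℝ (scaledRoot s α) v : ℝ) * inner ℝ (scaledRoot s α) w := by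
  rw [hess_apply, inner_add_left, sum_inner]
  simp_rw [real_inner_smul_left]

theorem hess_isSymmetric : (R.hess s).IsSymmetric := fun v w => by
  rw [inner_hess, ← real_inner_comm v (R.hess s w), inner_hess, real_inner_comm v w]
  simp_rw [mul_comm]

theorem norm_sq_le_inner_hess (v : EuclideanSpace ℝ (Fin N)) :
    ‖v‖ ^ 2 ≤ inner ℝ (R.hess s v) v := by
  rw [inner_hess, real_inner_self_eq_norm_sq]
  exact le_add_of_nonneg_right (Finset.sum_nonneg fun α _ => mul_self_nonneg _)

theorem hess_surjective : Function.Surjective (R.hess s) := by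
  refine LinearMap.injective_iff_surjective.1 ?_
  rw [← LinearMap.ker_eq_bot, LinearMap.ker_eq_bot']
  intro v hv
  have h := norm_sq_le_inner_hess (R := R) (s := s) v
  rw [hv, inner_zero_left] at h
  exact norm_eq_zero.1 (pow_eq_zero_iff two_ne_zero |>.1 (le_antisymm h (sq_nonneg _)))

/-- Integration by parts, with the linear part of the force isolated. -/
theorem integral_mul_inner_hess (hs : R.IsCritical s) {β : ℝ} (hβ : 1 < β)
    {f f' : EuclideanSpace ℝ (Fin N) → ℝ} (hf : f.HasTemperateGrowth) (hf' : f'.HasTemperateGrowth)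
    (v : EuclideanSpace ℝ (Fin N)) (hd : ∀ u, HasLineDerivAt ℝ f (f' u) u v) :
    ∫ u, f u * inner ℝ (R.hess s v) (u - s) ∂(R.gibbsMeasure β) =
      β⁻¹ * ∫ u, f' u ∂(R.gibbsMeasure β) + ∑ α ∈ R.posRoots, inner ℝ (scaledRoot s α) v *
        ∫ u, f u * (inner ℝ (scaledRoot s α) (u - s) * relDev s α u) ∂(R.gibbsMeasure β) := by
  have hβ0 : 0 < β := by linarith
  rw [integral_deriv hs hβ hf hf' v hd, inv_mul_cancel_left₀ hβ0.ne']
  have hI : ∀ α ∈ R.posRoots, Integrable (fun u => inner ℝ (scaledRoot s α) v *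
      (f u * (inner ℝ (scaledRoot s α) (u - s) * relDev s α u))) (R.gibbsMeasure β) := by
    intro α hα
    have := (integrable_mul_relDev (s := s) hβ
      (f := fun u => f u * inner ℝ (scaledRoot s α) (u - s)) (by fun_prop) hα).const_mul
        (inner ℝ (scaledRoot s α) v)
    refine this.congr (Eventually.of_forall fun u => ?_)
    simp only
    ring
  simp_rw [← integral_const_mul]
  rw [← integral_finsetSum _ hI, ← integral_add (integrable_mul_force hβ hf v)
    (integrable_finsetSum _ hI)]
  refine integral_congr_ae ?_
  filter_upwards [ae_mem_openChamber hβ0] with u hu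
  rw [inner_hess, mul_add, mul_add, add_assoc, real_inner_comm v (u - s), Finset.mul_sum,
    Finset.mul_sum, ← Finset.sum_add_distrib]
  congr 1
  refine Finset.sum_congr rfl fun α hα => ?_
  linear_combination (-(f u * inner ℝ (scaledRoot s α) v)) * relDev_eq hs hα hu

theorem abs_inner_pow_le (f z : EuclideanSpace ℝ (Fin N)) (k : ℕ) :
    |(inner ℝ f z : ℝ)| ^ k ≤ ‖f‖ ^ k * ‖z‖ ^ k := by
  rw [← mul_pow]
  exact pow_le_pow_left₀ (abs_nonneg _) (abs_real_inner_le_norm f z) k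

theorem isBigO_inner_mul_relDev (hs : R.IsCritical s) {α : EuclideanSpace ℝ (Fin N)}
    (hα : α ∈ R.posRoots) (f : EuclideanSpace ℝ (Fin N)) :
    (fun β : ℝ => ∫ u, 1 * (inner ℝ f (u - s) * relDev s α u) ∂(R.gibbsMeasure β)) =O[atTop]
      fun β : ℝ => β⁻¹ ^ 1 := by
  refine isBigO_of_le hs hα 1 0 1 le_rfl le_rfl (‖f‖ ^ 2 + 1) fun u _ => ?_
  have h1 := abs_real_inner_le_norm f (u - s)
  rw [one_mul, abs_mul, pow_one, pow_zero, one_mul]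
  set r := relDev s α u
  have h2 : r * r = |r| ^ 2 := by rw [sq_abs]; ring
  rw [h2]
  nlinarith [abs_nonneg r, sq_nonneg (‖f‖ * ‖u - s‖ - |r|), norm_nonneg f, norm_nonneg (u - s),
    mul_le_mul_of_nonneg_right h1 (abs_nonneg r), mul_nonneg (sq_nonneg ‖f‖) (sq_nonneg |r|),
    sq_nonneg (‖u - s‖), sq_nonneg (|r|)]

theorem isBigO_cubic_mul_relDev (hs : R.IsCritical s) {α : EuclideanSpace ℝ (Fin N)}
    (hα : α ∈ R.posRoots) (a b c : EuclideanSpace ℝ (Fin N)) :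
    (fun β : ℝ => ∫ u, (inner ℝ a (u - s) * inner ℝ b (u - s)) *
      (inner ℝ c (u - s) * relDev s α u) ∂(R.gibbsMeasure β)) =O[atTop]
      fun β : ℝ => β⁻¹ ^ 2 := by
  refine isBigO_of_le hs hα 2 1 2 le_rfl le_rfl (‖a‖ * ‖b‖ * ‖c‖) fun u _ => ?_
  rw [abs_mul, abs_mul, abs_mul, pow_one]
  set r := relDev s α u
  have h2 : r * r = |r| ^ 2 := by rw [sq_abs]; ring
  rw [mul_assoc (‖u - s‖ ^ 2), h2]
  calc |(inner ℝ a (u - s) : ℝ)| * |(inner ℝ b (u - s) : ℝ)| * (|(inner ℝ c (u - s) : ℝ)| * |r|)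
      ≤ (‖a‖ * ‖u - s‖) * (‖b‖ * ‖u - s‖) * ((‖c‖ * ‖u - s‖) * |r|) := by
        gcongr <;> exact abs_real_inner_le_norm _ _
    _ = ‖a‖ * ‖b‖ * ‖c‖ * (‖u - s‖ ^ 2 * (‖u - s‖ * |r|)) := by ring
    _ ≤ _ := by
        gcongr
        nlinarith [sq_nonneg (‖u - s‖ - |r|), sq_nonneg ‖u - s‖, sq_nonneg (‖u - s‖ + |r|)]

theorem hasLineDerivAt_inner_sub (w v u : EuclideanSpace ℝ (Fin N)) :
    HasLineDerivAt ℝ (fun u => (inner ℝ w (u - s) : ℝ)) (inner ℝ w v) u v := by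
  have h4 : HasDerivAt (fun t : ℝ => u + t • v - s) v 0 := by
    simpa using (((hasDerivAt_id (0 : ℝ)).smul_const v).const_add u).sub_const s
  have := (hasDerivAt_const (0 : ℝ) w).inner ℝ h4
  unfold HasLineDerivAt
  simpa using this

theorem isBigO_integral_inner (hs : R.IsCritical s) (v : EuclideanSpace ℝ (Fin N)) :
    (fun β : ℝ => ∫ u, (inner ℝ v (u - s) : ℝ) ∂(R.gibbsMeasure β)) =O[atTop]
      fun β : ℝ => β⁻¹ ^ 1 := by
  obtain ⟨v, rfl⟩ := hess_surjective (R := R) (s := s) v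
  have h1 : (fun β : ℝ => ∑ α ∈ R.posRoots, inner ℝ (scaledRoot s α) v *
      ∫ u, 1 * (inner ℝ (scaledRoot s α) (u - s) * relDev s α u) ∂(R.gibbsMeasure β)) =O[atTop]
      fun β : ℝ => β⁻¹ ^ 1 :=
    Asymptotics.IsBigO.fun_sum fun α hα => (isBigO_inner_mul_relDev hs hα _).const_mul_left _
  refine h1.congr' ?_ EventuallyEq.rfl
  filter_upwards [eventually_gt_atTop 1] with β hβ
  have h2 := integral_mul_inner_hess hs hβ (f := fun _ => 1) (f' := fun _ => 0) (by fun_prop)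
    (by fun_prop) v (fun u => by
      unfold HasLineDerivAt
      exact hasDerivAt_const _ _)
  simp only [one_mul, integral_zero, mul_zero, zero_add] at h2
  simp only [one_mul]
  exact h2.symm

theorem isBigO_integral_cubic (hs : R.IsCritical s) (w x v : EuclideanSpace ℝ (Fin N)) :
    (fun β : ℝ => ∫ u, (inner ℝ w (u - s) * inner ℝ x (u - s)) * inner ℝ v (u - s)
      ∂(R.gibbsMeasure β)) =O[atTop] fun β : ℝ => β⁻¹ ^ 2 := by
  obtain ⟨v, rfl⟩ := hess_surjective (R := R) (s := s) v
  have h1 : (fun β : ℝ => ∑ α ∈ R.posRoots, inner ℝ (scaledRoot s α) v *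
      ∫ u, (inner ℝ w (u - s) * inner ℝ x (u - s)) *
        (inner ℝ (scaledRoot s α) (u - s) * relDev s α u) ∂(R.gibbsMeasure β)) =O[atTop]
      fun β : ℝ => β⁻¹ ^ 2 :=
    Asymptotics.IsBigO.fun_sum fun α hα => (isBigO_cubic_mul_relDev hs hα _ _ _).const_mul_left _
  have h2 : (fun β : ℝ => β⁻¹ * (inner ℝ w v * (∫ u, (inner ℝ x (u - s) : ℝ) ∂(R.gibbsMeasure β)) +
      inner ℝ x v * (∫ u, (inner ℝ w (u - s) : ℝ) ∂(R.gibbsMeasure β)))) =O[atTop]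
      fun β : ℝ => β⁻¹ ^ 2 := by
    have : (fun β : ℝ => β⁻¹ ^ 2) = fun β : ℝ => β⁻¹ * β⁻¹ ^ 1 := by funext β; ring
    rw [this]
    exact (Asymptotics.isBigO_refl _ _).mul (((isBigO_integral_inner hs x).const_mul_left _).add
      ((isBigO_integral_inner hs w).const_mul_left _))
  refine (h2.add h1).congr' ?_ EventuallyEq.rfl
  filter_upwards [eventually_gt_atTop 1] with β hβ
  have hβ0 : 0 < β := by linarith
  have h3 := integral_mul_inner_hess hs hβ
    (f := fun u => (inner ℝ w (u - s) * inner ℝ x (u - s) : ℝ))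
    (f' := fun u => inner ℝ w v * inner ℝ x (u - s) + inner ℝ x v * inner ℝ w (u - s))
    (by fun_prop) (by fun_prop) v (fun u => by
      have := HasDerivAt.mul (hasLineDerivAt_inner_sub (s := s) w v u)
        (hasLineDerivAt_inner_sub (s := s) x v u)
      unfold HasLineDerivAt
      convert! this using 1
      simp only [zero_smul, add_zero]
      ring)
  rw [h3, integral_add (integrable_of_temperate hβ0 (by fun_prop))
    (integrable_of_temperate hβ0 (by fun_prop)), integral_const_mul, integral_const_mul]

/-- To leading order the covariance of `u - s` is `β⁻¹` times the inverse Hessian. -/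
theorem isBigO_integral_quadratic (hs : R.IsCritical s) (w v : EuclideanSpace ℝ (Fin N)) :
    (fun β : ℝ => (∫ u, (inner ℝ w (u - s) * inner ℝ (R.hess s v) (u - s) : ℝ)
      ∂(R.gibbsMeasure β)) - β⁻¹ * inner ℝ w v) =O[atTop] fun β : ℝ => β⁻¹ ^ 2 := by
  have h1 : (fun β : ℝ => ∑ α ∈ R.posRoots, inner ℝ (scaledRoot s α) v *
      ((∫ u, (inner ℝ w (u - s) * inner ℝ (scaledRoot s α) (u - s)) *
        inner ℝ (scaledRoot s α) (u - s) ∂(R.gibbsMeasure β)) -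
      ∫ u, (inner ℝ w (u - s) * inner ℝ (scaledRoot s α) (u - s)) *
        (inner ℝ (scaledRoot s α) (u - s) * relDev s α u) ∂(R.gibbsMeasure β))) =O[atTop]
      fun β : ℝ => β⁻¹ ^ 2 :=
    Asymptotics.IsBigO.fun_sum fun α hα => ((isBigO_integral_cubic hs _ _ _).sub
      (isBigO_cubic_mul_relDev hs hα _ _ _)).const_mul_left _
  refine h1.congr' ?_ EventuallyEq.rfl
  filter_upwards [eventually_gt_atTop 1] with β hβ
  have hβ0 : 0 < β := by linarith
  have := isProbabilityMeasure_gibbsMeasure (R := R) hβ0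
  rw [integral_mul_inner_hess hs hβ (f := fun u => (inner ℝ w (u - s) : ℝ))
    (f' := fun u => inner ℝ w v) (by fun_prop) (by fun_prop) v
    (hasLineDerivAt_inner_sub (s := s) w v)]
  simp only [integral_const, probReal_univ, smul_eq_mul, one_mul, add_sub_cancel_left]
  refine Finset.sum_congr rfl fun α hα => ?_
  congr 1
  rw [← integral_sub (integrable_of_temperate hβ0 (by fun_prop))]
  · refine integral_congr_ae ?_
    filter_upwards [ae_mem_openChamber hβ0] with u hu
    linear_combination (-(inner ℝ w (u - s) * inner ℝ (scaledRoot s α) (u - s))) *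
      relDev_eq hs hα hu
  · have := integrable_mul_relDev (s := s) hβ (f := fun u => inner ℝ w (u - s) *
      inner ℝ (scaledRoot s α) (u - s) * inner ℝ (scaledRoot s α) (u - s)) (by fun_prop) hα
    refine this.congr (Eventually.of_forall fun u => ?_)
    simp only
    ring

end DunklRootSystem

namespace DunklRootSystem

variable {N : ℕ} {R : DunklRootSystem N} {s : EuclideanSpace ℝ (Fin N)}

theorem _root_.MeasureTheory.Integrable.fun_sub {X : Type*} [MeasurableSpace X] {μ : Measure X}
    {f g : X → ℝ} (hf : Integrable f μ) (hg : Integrable g μ) :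
    Integrable (fun x => f x - g x) μ :=
  hf.sub hg

theorem exists_expansion_inner_mul_relDev (hs : R.IsCritical s) {α : EuclideanSpace ℝ (Fin N)}
    (hα : α ∈ R.posRoots) :
    ∃ c : ℝ, (fun β : ℝ => (∫ u, 1 * (inner ℝ (scaledRoot s α) (u - s) * relDev s α u)
      ∂(R.gibbsMeasure β)) - β⁻¹ * c) =O[atTop] fun β : ℝ => β⁻¹ ^ 2 := by
  obtain ⟨w, hw⟩ := hess_surjective (R := R) (s := s) (scaledRoot s α)
  refine ⟨inner ℝ (scaledRoot s α) w, ?_⟩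
  set f := scaledRoot s α with hf
  have h1 := ((isBigO_integral_quadratic hs f w).sub (isBigO_integral_cubic hs f f f)).add
    (isBigO_cubic_mul_relDev hs hα f f f)
  refine h1.congr' ?_ EventuallyEq.rfl
  filter_upwards [eventually_gt_atTop 1] with β hβ
  have hβ0 : 0 < β := by linarith
  have hI : Integrable (fun u => (inner ℝ f (u - s) * inner ℝ f (u - s)) *
      (inner ℝ f (u - s) * relDev s α u)) (R.gibbsMeasure β) := by
    refine (integrable_mul_relDev (s := s) hβ (f := fun u => inner ℝ f (u - s) *
      inner ℝ f (u - s) * inner ℝ f (u - s)) (by fun_prop) hα).congr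
      (Eventually.of_forall fun u => ?_)
    simp only
    ring
  have hI2 : Integrable (fun u => (inner ℝ f (u - s) * inner ℝ f (u - s) : ℝ))
    (R.gibbsMeasure β) := integrable_of_temperate hβ0 (by fun_prop)
  have hI3 : Integrable (fun u => (inner ℝ f (u - s) * inner ℝ f (u - s) * inner ℝ f (u - s) : ℝ))
    (R.gibbsMeasure β) := integrable_of_temperate hβ0 (by fun_prop)
  have key : ∫ u, 1 * (inner ℝ f (u - s) * relDev s α u) ∂(R.gibbsMeasure β) =
      ∫ u, (inner ℝ f (u - s) * inner ℝ f (u - s) -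
        inner ℝ f (u - s) * inner ℝ f (u - s) * inner ℝ f (u - s) +
        (inner ℝ f (u - s) * inner ℝ f (u - s)) * (inner ℝ f (u - s) * relDev s α u))
        ∂(R.gibbsMeasure β) := by
    refine integral_congr_ae ?_
    filter_upwards [ae_mem_openChamber hβ0] with u hu
    linear_combination (inner ℝ f (u - s) - inner ℝ f (u - s) * inner ℝ f (u - s)) *
      relDev_eq hs hα hu
  rw [key, integral_add (hI2.fun_sub hI3) hI, integral_sub hI2 hI3, hw]
  ring

theorem exists_expansion_inner (hs : R.IsCritical s) (v : EuclideanSpace ℝ (Fin N)) :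
    ∃ c : ℝ, (fun β : ℝ => (∫ u, (inner ℝ v (u - s) : ℝ) ∂(R.gibbsMeasure β)) - β⁻¹ * c)
      =O[atTop] fun β : ℝ => β⁻¹ ^ 2 := by
  obtain ⟨v, rfl⟩ := hess_surjective (R := R) (s := s) v
  choose! c hc using fun α hα => exists_expansion_inner_mul_relDev hs (α := α) hα
  refine ⟨∑ α ∈ R.posRoots, inner ℝ (scaledRoot s α) v * c α, ?_⟩
  have h1 : (fun β : ℝ => ∑ α ∈ R.posRoots, inner ℝ (scaledRoot s α) v *
      ((∫ u, 1 * (inner ℝ (scaledRoot s α) (u - s) * relDev s α u) ∂(R.gibbsMeasure β)) -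
        β⁻¹ * c α)) =O[atTop] fun β : ℝ => β⁻¹ ^ 2 :=
    Asymptotics.IsBigO.fun_sum fun α hα => (hc α hα).const_mul_left _
  refine h1.congr' ?_ EventuallyEq.rfl
  filter_upwards [eventually_gt_atTop 1] with β hβ
  have h2 := integral_mul_inner_hess hs hβ (f := fun _ => 1) (f' := fun _ => 0) (by fun_prop)
    (by fun_prop) v (fun u => by
      unfold HasLineDerivAt
      exact hasDerivAt_const _ _)
  simp only [one_mul, integral_zero, mul_zero, zero_add] at h2
  simp only [one_mul]
  rw [h2, Finset.mul_sum, ← Finset.sum_sub_distrib]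
  exact Finset.sum_congr rfl fun α _ => by ring

/-- The second-order expansion of the mean of `((α · s) / (α · u))²`. -/
theorem exists_expansion_sq (hs : R.IsCritical s) {α : EuclideanSpace ℝ (Fin N)}
    (hα : α ∈ R.posRoots) :
    ∃ c : ℝ, (fun β : ℝ => (∫ u, (1 - relDev s α u) ^ 2 ∂(R.gibbsMeasure β)) - 1 - β⁻¹ * c)
      =O[atTop] fun β : ℝ => β⁻¹ ^ 2 := by
  set f := scaledRoot s α with hf
  obtain ⟨w, hw⟩ := hess_surjective (R := R) (s := s) f
  obtain ⟨c, hc⟩ := exists_expansion_inner hs f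
  refine ⟨-2 * c + 3 * inner ℝ f w, ?_⟩
  have h2 : (fun β : ℝ => ∫ u, (inner ℝ f (u - s) * relDev s α u) ^ 2 ∂(R.gibbsMeasure β))
      =O[atTop] fun β : ℝ => β⁻¹ ^ 2 := by
    refine isBigO_of_le hs hα 2 1 2 le_rfl le_rfl (‖f‖ ^ 2) fun u _ => ?_
    rw [abs_of_nonneg (sq_nonneg _), mul_pow, ← sq_abs (inner ℝ f (u - s))]
    have h3 := abs_inner_pow_le f (u - s) 2
    calc |(inner ℝ f (u - s) : ℝ)| ^ 2 * relDev s α u ^ 2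
        ≤ (‖f‖ ^ 2 * ‖u - s‖ ^ 2) * relDev s α u ^ 2 := by gcongr
      _ = ‖f‖ ^ 2 * (0 + (‖u - s‖ ^ 2) ^ 1 * relDev s α u * relDev s α u) := by ring
      _ ≤ _ := by gcongr; positivity
  have h1 := ((((hc.const_mul_left (-2)).add
    ((isBigO_integral_quadratic hs f w).const_mul_left 3)).sub
    ((isBigO_integral_cubic hs f f f).const_mul_left 4)).add
    ((isBigO_cubic_mul_relDev hs hα f f f).const_mul_left 4)).add h2
  refine h1.congr' ?_ EventuallyEq.rfl
  filter_upwards [eventually_gt_atTop 2] with β hβ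
  have hβ0 : 0 < β := by linarith
  have := isProbabilityMeasure_gibbsMeasure (R := R) hβ0
  have hI0 : Integrable (fun u => (inner ℝ f (u - s) : ℝ)) (R.gibbsMeasure β) :=
    integrable_of_temperate hβ0 (by fun_prop)
  have hI1 : Integrable (fun u => (inner ℝ f (u - s) * inner ℝ f (u - s) : ℝ))
    (R.gibbsMeasure β) := integrable_of_temperate hβ0 (by fun_prop)
  have hI2 : Integrable (fun u => (inner ℝ f (u - s) * inner ℝ f (u - s) * inner ℝ f (u - s) : ℝ))
    (R.gibbsMeasure β) := integrable_of_temperate hβ0 (by fun_prop)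
  have hI3 : Integrable (fun u => (inner ℝ f (u - s) * inner ℝ f (u - s)) *
      (inner ℝ f (u - s) * relDev s α u)) (R.gibbsMeasure β) := by
    refine (integrable_mul_relDev (s := s) (by linarith : 1 < β) (f := fun u => inner ℝ f (u - s) *
      inner ℝ f (u - s) * inner ℝ f (u - s)) (by fun_prop) hα).congr
      (Eventually.of_forall fun u => ?_)
    simp only
    ring
  have hI4 : Integrable (fun u => (inner ℝ f (u - s) * relDev s α u) ^ 2) (R.gibbsMeasure β) := by
    refine (integrable_mul_relDev_mul_relDev (s := s) hβ (f := fun u => inner ℝ f (u - s) *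
      inner ℝ f (u - s)) (by fun_prop) hα hα).congr (Eventually.of_forall fun u => ?_)
    simp only
    ring
  have key : ∫ u, (1 - relDev s α u) ^ 2 ∂(R.gibbsMeasure β) =
      ∫ u, (1 + ((((-2) * inner ℝ f (u - s) +
      3 * (inner ℝ f (u - s) * inner ℝ f (u - s))) -
      4 * (inner ℝ f (u - s) * inner ℝ f (u - s) * inner ℝ f (u - s))) +
      4 * ((inner ℝ f (u - s) * inner ℝ f (u - s)) * (inner ℝ f (u - s) * relDev s α u)) +
      (inner ℝ f (u - s) * relDev s α u) ^ 2)) ∂(R.gibbsMeasure β) := by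
    refine integral_congr_ae ?_
    filter_upwards [ae_mem_openChamber hβ0] with u hu
    have h := relDev_eq hs hα hu
    rw [← hf] at h
    set y : ℝ := inner ℝ f (u - s)
    set r := relDev s α u
    linear_combination (-2 + (y - y * r + r) + 2 * y - 4 * y ^ 2 + 0 * r) * h
  rw [key, integral_add (integrable_const _)
    (((((hI0.const_mul (-2)).fun_add (hI1.const_mul 3)).fun_sub (hI2.const_mul 4)).fun_add
      (hI3.const_mul 4)).fun_add hI4),
    integral_add ((((hI0.const_mul (-2)).fun_add (hI1.const_mul 3)).fun_sub
      (hI2.const_mul 4)).fun_add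
      (hI3.const_mul 4)) hI4,
    integral_add (((hI0.const_mul (-2)).fun_add (hI1.const_mul 3)).fun_sub (hI2.const_mul 4))
      (hI3.const_mul 4),
    integral_sub ((hI0.const_mul (-2)).fun_add (hI1.const_mul 3)) (hI2.const_mul 4),
    integral_add (hI0.const_mul (-2)) (hI1.const_mul 3), integral_const_mul, integral_const_mul,
    integral_const_mul, integral_const_mul, hw]
  simp only [integral_const, probReal_univ, smul_eq_mul, one_mul]
  ring

/-! ### Limits of means of smooth functions -/

theorem exists_integral_weighted_le (hs : R.IsCritical s) (K : ℕ) {γ : EuclideanSpace ℝ (Fin N)}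
    (hγ : γ ∈ R.posRoots) : ∃ C : ℝ, ∀ᶠ β in atTop, ∀ δ : ℝ, 0 < δ →
    ∫ u, (1 + (‖u - s‖ ^ 2) ^ K) * (δ * (‖u - s‖ ^ 2 + relDev s γ u ^ 2) +
      δ⁻¹ * ((‖u - s‖ ^ 2) ^ 2 + ‖u - s‖ ^ 2 * relDev s γ u ^ 2)) ∂(R.gibbsMeasure β) ≤
        C * (δ * β⁻¹ + δ⁻¹ * β⁻¹ ^ 2) ∧
    Integrable (fun u => (1 + (‖u - s‖ ^ 2) ^ K) * (δ * (‖u - s‖ ^ 2 + relDev s γ u ^ 2) +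
      δ⁻¹ * ((‖u - s‖ ^ 2) ^ 2 + ‖u - s‖ ^ 2 * relDev s γ u ^ 2))) (R.gibbsMeasure β) := by
  have hle : ∀ j i, j ≤ i → (fun β : ℝ => β⁻¹ ^ i) =O[atTop] fun β : ℝ => β⁻¹ ^ j := by
    intro j i hi
    refine Asymptotics.IsBigO.of_bound 1 ?_
    filter_upwards [eventually_ge_atTop 1] with β hβ
    have hβ0 : 0 < β := by linarith
    rw [Real.norm_of_nonneg (by positivity), Real.norm_of_nonneg (by positivity), one_mul]
    exact pow_le_pow_of_le_one (by positivity) (inv_le_one_of_one_le₀ hβ) hi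
  have hA := ((isBigO_normSq_pow hs 1).add (isBigO_normSq_pow_mul_sq hs 0 hγ)).add
    (((isBigO_normSq_pow hs (K + 1)).trans (hle 1 _ (by omega))).add
      ((isBigO_normSq_pow_mul_sq hs K hγ).trans (hle 1 _ (by omega))))
  have hB := ((isBigO_normSq_pow hs 2).add (isBigO_normSq_pow_mul_sq hs 1 hγ)).add
    (((isBigO_normSq_pow hs (K + 2)).trans (hle 2 _ (by omega))).add
      ((isBigO_normSq_pow_mul_sq hs (K + 1) hγ).trans (hle 2 _ (by omega))))
  obtain ⟨a, ha⟩ := hA.bound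
  obtain ⟨b, hb⟩ := hB.bound
  refine ⟨max a b, ?_⟩
  filter_upwards [eventually_gt_atTop 2, ha, hb] with β hβ ha hb δ hδ
  have hβ0 : 0 < β := by linarith
  have i1 := fun k => integrable_of_temperate (R := R) hβ0 (temperate_normSq_pow s k)
  have i2 := fun k => integrable_mul_relDev_mul_relDev (R := R) (s := s) hβ
    (temperate_normSq_pow s k) hγ hγ
  have jA := ((i1 1).fun_add (i2 0)).fun_add ((i1 (K + 1)).fun_add (i2 K))
  have jB := ((i1 2).fun_add (i2 1)).fun_add ((i1 (K + 2)).fun_add (i2 (K + 1)))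
  have jAB := (jA.const_mul δ).fun_add (jB.const_mul δ⁻¹)
  have hfun : (fun u => (1 + (‖u - s‖ ^ 2) ^ K) * (δ * (‖u - s‖ ^ 2 + relDev s γ u ^ 2) +
      δ⁻¹ * ((‖u - s‖ ^ 2) ^ 2 + ‖u - s‖ ^ 2 * relDev s γ u ^ 2))) =
      fun u => δ * ((‖u - s‖ ^ 2) ^ 1 + (‖u - s‖ ^ 2) ^ 0 * relDev s γ u * relDev s γ u +
        ((‖u - s‖ ^ 2) ^ (K + 1) + (‖u - s‖ ^ 2) ^ K * relDev s γ u * relDev s γ u)) +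
      δ⁻¹ * ((‖u - s‖ ^ 2) ^ 2 + (‖u - s‖ ^ 2) ^ 1 * relDev s γ u * relDev s γ u +
        ((‖u - s‖ ^ 2) ^ (K + 2) + (‖u - s‖ ^ 2) ^ (K + 1) * relDev s γ u * relDev s γ u)) := by
    funext u; ring
  rw [hfun]
  refine ⟨?_, jAB⟩
  rw [integral_add (jA.const_mul δ) (jB.const_mul δ⁻¹), integral_const_mul, integral_const_mul,
    integral_add ((i1 1).fun_add (i2 0)) ((i1 (K + 1)).fun_add (i2 K)), integral_add (i1 1) (i2 0),
    integral_add (i1 (K + 1)) (i2 K), integral_add ((i1 2).fun_add (i2 1))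
    ((i1 (K + 2)).fun_add (i2 (K + 1))), integral_add (i1 2) (i2 1),
    integral_add (i1 (K + 2)) (i2 (K + 1))]
  rw [Real.norm_of_nonneg (by positivity : (0 : ℝ) ≤ β⁻¹ ^ 1)] at ha
  rw [Real.norm_of_nonneg (by positivity : (0 : ℝ) ≤ β⁻¹ ^ 2)] at hb
  have ha' := (le_abs_self _).trans (ha.trans (mul_le_mul_of_nonneg_right (le_max_left a b)
    (by positivity)))
  have hb' := (le_abs_self _).trans (hb.trans (mul_le_mul_of_nonneg_right (le_max_right a b)
    (by positivity)))
  have e1 := mul_le_mul_of_nonneg_left ha' hδ.le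
  have e2 := mul_le_mul_of_nonneg_left hb' (inv_pos.2 hδ).le
  refine (add_le_add e1 e2).trans (le_of_eq ?_)
  ring

/-- A function that is `O(‖z‖³)` near `s`, in the weak sense of the bound below, has mean
`o(1 / β)`. The bound is used with `δ = β^{-1/2}`. -/
theorem tendsto_mul_integral_of_le (hs : R.IsCritical s) (K : ℕ) {γ : EuclideanSpace ℝ (Fin N)}
    (hγ : γ ∈ R.posRoots) {f : EuclideanSpace ℝ (Fin N) → ℝ} (D : ℝ) (hD : 0 ≤ D)
    (hf : ∀ u ∈ R.openChamber, ∀ δ : ℝ, 0 < δ → |f u| ≤ D * ((1 + (‖u - s‖ ^ 2) ^ K) *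
      (δ * (‖u - s‖ ^ 2 + relDev s γ u ^ 2) +
      δ⁻¹ * ((‖u - s‖ ^ 2) ^ 2 + ‖u - s‖ ^ 2 * relDev s γ u ^ 2)))) :
    Tendsto (fun β : ℝ => β * ∫ u, f u ∂(R.gibbsMeasure β)) atTop (𝓝 0) := by
  obtain ⟨C, hC⟩ := exists_integral_weighted_le hs K hγ
  have hlim : Tendsto (fun β : ℝ => 2 * D * C * (Real.sqrt β)⁻¹) atTop (𝓝 0) := by
    have := (tendsto_inv_atTop_zero.comp Real.tendsto_sqrt_atTop).const_mul (2 * D * C)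
    rwa [mul_zero] at this
  refine squeeze_zero_norm' ?_ hlim
  filter_upwards [hC, eventually_gt_atTop 0] with β hCβ hβ0
  obtain ⟨h1, h2⟩ := hCβ (Real.sqrt β)⁻¹ (inv_pos.2 (Real.sqrt_pos.2 hβ0))
  have h3 := norm_integral_le_of_norm_le (μ := R.gibbsMeasure β) (f := f) (h2.const_mul D) (by
    filter_upwards [ae_mem_openChamber hβ0] with u hu
    exact hf u hu _ (inv_pos.2 (Real.sqrt_pos.2 hβ0)))
  rw [integral_const_mul] at h3
  rw [norm_mul, Real.norm_of_nonneg hβ0.le]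
  have h4 := mul_le_mul_of_nonneg_left (h3.trans (mul_le_mul_of_nonneg_left h1 hD)) hβ0.le
  refine h4.trans (le_of_eq ?_)
  have hsq : Real.sqrt β * Real.sqrt β = β := Real.mul_self_sqrt hβ0.le
  have hs0 := (Real.sqrt_pos.2 hβ0).ne'
  have hβi : β⁻¹ = (Real.sqrt β)⁻¹ * (Real.sqrt β)⁻¹ := by rw [← mul_inv, hsq]
  rw [hβi, inv_inv]
  nth_rewrite 1 [← hsq]
  field_simp
  norm_num

end DunklRootSystem

namespace DunklRootSystem

variable {N : ℕ} {R : DunklRootSystem N} {s : EuclideanSpace ℝ (Fin N)}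

/-- Laplace's method to leading order. -/
theorem tendsto_integral_of_le (hs : R.IsCritical s) {g : EuclideanSpace ℝ (Fin N) → ℝ}
    (hg : g.HasTemperateGrowth) (w : EuclideanSpace ℝ (Fin N)) (C : ℝ) (K : ℕ)
    (hgw : ∀ u, |g u - g s - inner ℝ w (u - s)| ≤ C * (‖u - s‖ ^ 2 * (1 + (‖u - s‖ ^ 2) ^ K))) :
    Tendsto (fun β : ℝ => ∫ u, g u ∂(R.gibbsMeasure β)) atTop (𝓝 (g s)) := by
  have hlim : Tendsto (fun β : ℝ => β⁻¹ ^ 1) atTop (𝓝 0) := by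
    simpa using tendsto_inv_atTop_zero (𝕜 := ℝ)
  have h1 := (isBigO_integral_inner hs w).trans_tendsto hlim
  have hlim2 : ∀ k : ℕ, Tendsto (fun β : ℝ => ∫ u, (‖u - s‖ ^ 2) ^ (k + 1) ∂(R.gibbsMeasure β))
      atTop (𝓝 0) := fun k => (isBigO_normSq_pow hs (k + 1)).trans_tendsto (by
    have := (tendsto_inv_atTop_zero (𝕜 := ℝ)).pow (k + 1)
    rwa [zero_pow (by omega)] at this)
  have h2 : Tendsto (fun β : ℝ => ∫ u, (g u - g s - inner ℝ w (u - s)) ∂(R.gibbsMeasure β))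
      atTop (𝓝 0) := by
    have hb := (((hlim2 0).add (hlim2 K)).const_mul C)
    rw [add_zero, mul_zero] at hb
    refine squeeze_zero_norm' ?_ hb
    filter_upwards [eventually_gt_atTop 0] with β hβ
    have i1 := fun k => integrable_of_temperate (R := R) hβ (temperate_normSq_pow s k)
    rw [← integral_add (i1 _) (i1 _), ← integral_const_mul]
    refine norm_integral_le_of_norm_le (((i1 _).add (i1 _)).const_mul C)
      (Eventually.of_forall fun u => ?_)
    refine (hgw u).trans (le_of_eq ?_)
    ring
  have h3 := (h2.add h1).add_const (g s)
  rw [add_zero, zero_add] at h3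
  refine h3.congr' ?_
  filter_upwards [eventually_gt_atTop 0] with β hβ
  have := isProbabilityMeasure_gibbsMeasure (R := R) hβ
  have hI0 : Integrable (fun u => (inner ℝ w (u - s) : ℝ)) (R.gibbsMeasure β) :=
    integrable_of_temperate hβ (by fun_prop)
  have hI1 := integrable_of_temperate (R := R) hβ hg
  rw [integral_sub (hI1.fun_sub (integrable_const _)) hI0, integral_sub hI1 (integrable_const _)]
  simp

theorem mul_le_weighted {a b δ : ℝ} (hδ : 0 < δ) : a * b ≤ δ * a ^ 2 + δ⁻¹ * b ^ 2 := by
  have h : δ * a ^ 2 + δ⁻¹ * b ^ 2 - 2 * (a * b) = δ * (a - δ⁻¹ * b) ^ 2 := by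
    field_simp
    ring
  have h2 : 0 ≤ δ * (a - δ⁻¹ * b) ^ 2 := by positivity
  have h3 : 0 ≤ δ * a ^ 2 + δ⁻¹ * b ^ 2 := by positivity
  linarith

/-- The covariance, to leading order, of `((α · s) / (α · u))²` with a smooth function `g` that
vanishes at `s` and has gradient `hess v` there. -/
theorem tendsto_mul_integral_sq_sub_one_mul (hs : R.IsCritical s) {α : EuclideanSpace ℝ (Fin N)}
    (hα : α ∈ R.posRoots) {g : EuclideanSpace ℝ (Fin N) → ℝ}
    (hg : g.HasTemperateGrowth) (v : EuclideanSpace ℝ (Fin N)) (C : ℝ) (K : ℕ)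
    (hg1 : ∀ u, |g u| ≤ C * (‖u - s‖ * (1 + (‖u - s‖ ^ 2) ^ K)))
    (hg2 : ∀ u, |g u - inner ℝ (R.hess s v) (u - s)| ≤
      C * (‖u - s‖ ^ 2 * (1 + (‖u - s‖ ^ 2) ^ K))) :
    Tendsto (fun β : ℝ => β * ∫ u, ((1 - relDev s α u) ^ 2 - 1) * g u ∂(R.gibbsMeasure β)) atTop
      (𝓝 (-2 * inner ℝ (scaledRoot s α) v)) := by
  set f := scaledRoot s α with hf
  set w := R.hess s v with hw
  have h1 : Tendsto (fun β : ℝ => β * ∫ u, (((1 - relDev s α u) ^ 2 - 1) * g u +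
      2 * (inner ℝ f (u - s) * inner ℝ w (u - s))) ∂(R.gibbsMeasure β)) atTop (𝓝 0) := by
    rcases eq_or_ne s (s + α) with h0 | h0
    · exact absurd (left_eq_add.1 h0) (R.ne_zero_of_mem_posRoots hα)
    have hC : 0 ≤ C := by
      have := (abs_nonneg _).trans (hg1 (s + α))
      have h3 : 0 < ‖s + α - s‖ := by
        rw [add_sub_cancel_left]; exact R.norm_pos_of_mem_posRoots hα
      have h4 : 0 < ‖s + α - s‖ * (1 + (‖s + α - s‖ ^ 2) ^ K) := by positivity
      nlinarith
    refine tendsto_mul_integral_of_le hs K hα (2 * (‖f‖ * C) + 2 * (‖f‖ * C) + C) (by positivity)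
      fun u hu δ hδ => ?_
    have h := relDev_eq hs hα hu
    rw [← hf] at h
    set r := relDev s α u
    set y : ℝ := inner ℝ f (u - s)
    set l : ℝ := inner ℝ w (u - s)
    set z := ‖u - s‖
    set L := 1 + (z ^ 2) ^ K with hL
    have hz : 0 ≤ z := norm_nonneg _
    have hL0 : 0 ≤ L := by positivity
    have hy : |y| ≤ ‖f‖ * z := abs_real_inner_le_norm _ _
    have e1 : ((1 - r) ^ 2 - 1) * g u + 2 * (y * l) =
        -(2 * (y * (g u - l))) + 2 * (y * (r * g u)) + r ^ 2 * g u := by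
      linear_combination (-2) * g u * h
    rw [e1]
    have b1 : |2 * (y * (g u - l))| ≤ 2 * (‖f‖ * C) * (L * (z * z ^ 2)) := by
      rw [abs_mul, abs_mul, abs_of_nonneg (zero_le_two (α := ℝ))]
      calc 2 * (|y| * |g u - l|) ≤ 2 * ((‖f‖ * z) * (C * (z ^ 2 * L))) := by
            gcongr; exact hg2 u
        _ = _ := by ring
    have b2 : |2 * (y * (r * g u))| ≤ 2 * (‖f‖ * C) * (L * (z * (z * |r|))) := by
      rw [abs_mul, abs_mul, abs_mul, abs_of_nonneg (zero_le_two (α := ℝ))]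
      calc 2 * (|y| * (|r| * |g u|)) ≤ 2 * ((‖f‖ * z) * (|r| * (C * (z * L)))) := by
            gcongr; exact hg1 u
        _ = _ := by ring
    have b3 : |r ^ 2 * g u| ≤ C * (L * (|r| * (z * |r|))) := by
      rw [abs_mul, abs_of_nonneg (sq_nonneg r), ← sq_abs r]
      calc |r| ^ 2 * |g u| ≤ |r| ^ 2 * (C * (z * L)) := by
            gcongr; exact hg1 u
        _ = _ := by ring
    set Q := δ * (z ^ 2 + r ^ 2) + δ⁻¹ * ((z ^ 2) ^ 2 + z ^ 2 * r ^ 2) with hQ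
    have hr2 : |r| ^ 2 = r ^ 2 := sq_abs r
    have n1 : 0 ≤ δ * z ^ 2 := by positivity
    have n2 : 0 ≤ δ * r ^ 2 := by positivity
    have n3 : 0 ≤ δ⁻¹ * (z ^ 2) ^ 2 := by positivity
    have n4 : 0 ≤ δ⁻¹ * (z ^ 2 * r ^ 2) := by positivity
    have q1 : z * z ^ 2 ≤ Q := by
      have := mul_le_weighted (a := z) (b := z ^ 2) hδ
      rw [hQ, mul_add, mul_add]; linarith
    have q2 : z * (z * |r|) ≤ Q := by
      have := mul_le_weighted (a := z) (b := z * |r|) hδ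
      rw [mul_pow, hr2] at this
      rw [hQ, mul_add, mul_add]; linarith
    have q3 : |r| * (z * |r|) ≤ Q := by
      have := mul_le_weighted (a := |r|) (b := z * |r|) hδ
      rw [mul_pow, hr2] at this
      rw [hQ, mul_add, mul_add]; linarith
    calc _ ≤ |2 * (y * (g u - l))| + |2 * (y * (r * g u))| + |r ^ 2 * g u| := by
          refine (abs_add_le _ _).trans (add_le_add_left ((abs_add_le _ _).trans ?_) _)
          rw [abs_neg]
      _ ≤ 2 * (‖f‖ * C) * (L * Q) + 2 * (‖f‖ * C) * (L * Q) + C * (L * Q) := by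
          refine add_le_add (add_le_add (b1.trans ?_) (b2.trans ?_)) (b3.trans ?_) <;> gcongr
      _ = _ := by ring
  have h2 : Tendsto (fun β : ℝ => β * ∫ u, (inner ℝ f (u - s) * inner ℝ w (u - s) : ℝ)
      ∂(R.gibbsMeasure β)) atTop (𝓝 (inner ℝ f v)) := by
    have h3 : Tendsto (fun β : ℝ => β * ((∫ u, (inner ℝ f (u - s) * inner ℝ w (u - s) : ℝ)
        ∂(R.gibbsMeasure β)) - β⁻¹ * inner ℝ f v)) atTop (𝓝 0) := by
      have h4 := (Asymptotics.isBigO_refl (fun β : ℝ => β) atTop).mul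
        (isBigO_integral_quadratic hs f v)
      refine h4.trans_tendsto (tendsto_inv_atTop_zero.congr' ?_)
      filter_upwards [eventually_gt_atTop 0] with β hβ
      field_simp
    have h5 := h3.add_const (inner ℝ f v)
    rw [zero_add] at h5
    refine h5.congr' ?_
    filter_upwards [eventually_gt_atTop 0] with β hβ
    field_simp
    ring
  have h6 := h1.sub (h2.const_mul 2)
  rw [zero_sub, ← neg_mul] at h6
  refine h6.congr' ?_
  filter_upwards [eventually_gt_atTop 2] with β hβ
  have hβ0 : 0 < β := by linarith
  have i1 : Integrable (fun u => ((1 - relDev s α u) ^ 2 - 1) * g u) (R.gibbsMeasure β) := by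
    refine ((integrable_mul_relDev_mul_relDev (s := s) hβ hg hα hα).fun_sub
      ((integrable_mul_relDev (s := s) (by linarith : 1 < β) hg hα).const_mul 2)).congr
      (Eventually.of_forall fun u => ?_)
    simp only
    ring
  have i2 : Integrable (fun u => (inner ℝ f (u - s) * inner ℝ w (u - s) : ℝ)) (R.gibbsMeasure β) :=
    integrable_of_temperate hβ0 (by fun_prop)
  rw [integral_add i1 (i2.const_mul 2), integral_const_mul]
  ring

end DunklRootSystem

/-! ### Polynomials and their difference quotients -/

/-- `PolyLT n p`: the function `p` on `ℝ^N` is polynomial of degree `< n`. -/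
inductive PolyLT {N : ℕ} : ℕ → (EuclideanSpace ℝ (Fin N) → ℝ) → Prop
  | zero (n : ℕ) : PolyLT n fun _ => 0
  | const (n : ℕ) (c : ℝ) : PolyLT (n + 1) fun _ => c
  | add {n : ℕ} {p q : EuclideanSpace ℝ (Fin N) → ℝ} : PolyLT n p → PolyLT n q →
      PolyLT n fun x => p x + q x
  | inner_mul_succ {n : ℕ} (b : EuclideanSpace ℝ (Fin N)) {p : EuclideanSpace ℝ (Fin N) → ℝ} :
      PolyLT (n + 1) p → PolyLT (n + 2) fun x => inner ℝ b x * p x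

namespace PolyLT

variable {N n k : ℕ} {p q : EuclideanSpace ℝ (Fin N) → ℝ}

theorem eq_zero (hp : PolyLT 0 p) : p = fun _ => 0 := by
  generalize hn : 0 = n at hp
  induction hp with
  | zero => rfl
  | const => omega
  | add _ _ h1 h2 => subst hn; rw [h1 rfl, h2 rfl]; simp
  | inner_mul_succ => omega

theorem succ (hp : PolyLT n p) : PolyLT (n + 1) p := by
  induction hp with
  | zero => exact zero _
  | const n c => exact const _ c
  | add _ _ h1 h2 => exact h1.add h2
  | inner_mul_succ b _ h => exact h.inner_mul_succ b

theorem mono (hp : PolyLT n p) (h : n ≤ k) : PolyLT k p := by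
  induction h with
  | refl => exact hp
  | step _ h => exact h.succ

theorem inner_mul (hp : PolyLT n p) (b : EuclideanSpace ℝ (Fin N)) :
    PolyLT (n + 1) fun x => inner ℝ b x * p x := by
  cases n with
  | zero =>
    rw [hp.eq_zero]
    simpa using zero 1
  | succ n => exact hp.inner_mul_succ b

theorem const_mul (hp : PolyLT n p) (c : ℝ) : PolyLT n fun x => c * p x := by
  induction hp with
  | zero => simpa using zero _
  | const n d => exact const _ _
  | add _ _ h1 h2 =>
    simp only [mul_add]
    exact h1.add h2
  | inner_mul_succ b _ h =>
    simp only [mul_left_comm c]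
    exact h.inner_mul_succ b

theorem sub (hp : PolyLT n p) (hq : PolyLT n q) : PolyLT n fun x => p x - q x := by
  have := hp.add (hq.const_mul (-1))
  simpa [← sub_eq_add_neg] using this

theorem sum {ι : Type*} (S : Finset ι) {f : ι → EuclideanSpace ℝ (Fin N) → ℝ}
    (h : ∀ i ∈ S, PolyLT n (f i)) : PolyLT n fun x => ∑ i ∈ S, f i x := by
  classical
  induction S using Finset.induction_on with
  | empty => simpa using zero n
  | insert a S ha ih =>
    simp only [Finset.sum_insert ha]
    exact (h a (Finset.mem_insert_self a S)).add
      (ih fun i hi => h i (Finset.mem_insert_of_mem hi))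

theorem mul (hp : PolyLT (k + 1) p) (hq : PolyLT n q) : PolyLT (k + n) fun x => p x * q x := by
  generalize hm : k + 1 = m at hp
  induction hp generalizing k with
  | zero => simpa using zero _
  | const m c => exact (hq.const_mul c).mono (by omega)
  | add _ _ h1 h2 =>
    simp only [add_mul]
    exact (h1 hm).add (h2 hm)
  | @inner_mul_succ m b p _ h =>
    simp only [mul_assoc]
    have := (h rfl).inner_mul b
    exact this.mono (by omega)

theorem comp_isometry (hp : PolyLT n p)
    (w : EuclideanSpace ℝ (Fin N) ≃ₗᵢ[ℝ] EuclideanSpace ℝ (Fin N)) : PolyLT n fun x => p (w x) := by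
  induction hp with
  | zero => exact zero _
  | const n c => exact const _ c
  | add _ _ h1 h2 => exact h1.add h2
  | inner_mul_succ b _ h =>
    have hb : ∀ x, (inner ℝ b (w x) : ℝ) = inner ℝ (w.symm b) x := fun x => by
      rw [← w.inner_map_map (w.symm b), w.apply_symm_apply]
    simp only [hb]
    exact h.inner_mul_succ _

theorem contDiff (hp : PolyLT n p) {j : WithTop ℕ∞} : ContDiff ℝ j p := by
  induction hp with
  | zero => exact contDiff_const
  | const n c => exact contDiff_const
  | add _ _ h1 h2 => exact h1.add h2
  | inner_mul_succ b _ h => exact (contDiff_const.inner ℝ contDiff_id).mul h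

theorem differentiableAt (hp : PolyLT n p) (x : EuclideanSpace ℝ (Fin N)) :
    DifferentiableAt ℝ p x :=
  (hp.contDiff (j := 1)).differentiable (by norm_num) x

theorem temperate (hp : PolyLT n p) : p.HasTemperateGrowth := by
  induction hp with
  | zero => fun_prop
  | const n c => fun_prop
  | add _ _ h1 h2 => exact h1.add h2
  | inner_mul_succ b _ h => fun_prop

theorem fderiv_inner_mul (hp : PolyLT n p) (b x v : EuclideanSpace ℝ (Fin N)) :
    fderiv ℝ (fun x => inner ℝ b x * p x) x v =
      inner ℝ b v * p x + inner ℝ b x * fderiv ℝ p x v := by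
  have h1 : HasFDerivAt (fun x => (inner ℝ b x : ℝ)) (innerSL ℝ b) x :=
    (innerSL ℝ b).hasFDerivAt
  rw [(h1.fun_mul (hp.differentiableAt x).hasFDerivAt).fderiv]
  simp
  ring

theorem fderiv_add_apply (hp : PolyLT n p) (hq : PolyLT k q) (x v : EuclideanSpace ℝ (Fin N)) :
    fderiv ℝ (fun x => p x + q x) x v = fderiv ℝ p x v + fderiv ℝ q x v := by
  rw [fderiv_fun_add (hp.differentiableAt x) (hq.differentiableAt x)]
  rfl

theorem fderiv_pred (hp : PolyLT n p) (v : EuclideanSpace ℝ (Fin N)) :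
    PolyLT (n - 1) fun x => fderiv ℝ p x v := by
  induction hp with
  | zero => simpa using zero _
  | const n c => simpa using zero _
  | add h1 h2 ih1 ih2 =>
    simp only [h1.fderiv_add_apply h2]
    exact ih1.add ih2
  | inner_mul_succ b h ih =>
    simp only [h.fderiv_inner_mul]
    exact (h.const_mul _).add (ih.inner_mul b)

/-- Euler's identity. -/
theorem exists_euler (hp : PolyLT n p) : ∃ q : EuclideanSpace ℝ (Fin N) → ℝ, PolyLT (n - 1) q ∧
    ∀ x, fderiv ℝ p x x = ((n : ℝ) - 1) * p x + q x := by
  induction hp with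
  | zero n => exact ⟨_, zero _, fun x => by simp⟩
  | const n c =>
    cases n with
    | zero => exact ⟨_, zero _, fun x => by simp⟩
    | succ n => exact ⟨_, const n (-((n : ℝ) + 1) * c), fun x => by simp; ring⟩
  | add h1 h2 ih1 ih2 =>
    obtain ⟨q1, hq1, e1⟩ := ih1
    obtain ⟨q2, hq2, e2⟩ := ih2
    refine ⟨_, hq1.add hq2, fun x => ?_⟩
    rw [h1.fderiv_add_apply h2, e1, e2]
    ring
  | inner_mul_succ b h ih =>
    obtain ⟨q, hq, e⟩ := ih
    refine ⟨_, hq.inner_mul b, fun x => ?_⟩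
    rw [h.fderiv_inner_mul, e]
    push_cast
    ring

/-- The difference quotient of `p` in the direction of a root, and its singular part compared
with the derivative, are polynomial. -/
theorem exists_dividedDifference (hp : PolyLT n p) {α : EuclideanSpace ℝ (Fin N)} (hα : α ≠ 0) :
    ∃ d e : EuclideanSpace ℝ (Fin N) → ℝ, PolyLT (n - 1) d ∧ PolyLT (n - 1) e ∧
      (∀ x, p x - p (dunklRefl α x) = inner ℝ α x * d x) ∧
      ∀ x, fderiv ℝ p x α - 1 / 2 * ‖α‖ ^ 2 * d x = inner ℝ α x * e x := by
  induction hp with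
  | zero n => exact ⟨_, _, zero _, zero _, fun x => by simp, fun x => by simp⟩
  | const n c => exact ⟨_, _, zero _, zero _, fun x => by simp, fun x => by simp⟩
  | add h1 h2 ih1 ih2 =>
    obtain ⟨d1, e1, hd1, he1, a1, b1⟩ := ih1
    obtain ⟨d2, e2, hd2, he2, a2, b2⟩ := ih2
    refine ⟨_, _, hd1.add hd2, he1.add he2, fun x => ?_, fun x => ?_⟩
    · linear_combination a1 x + a2 x
    · rw [h1.fderiv_add_apply h2]
      linear_combination b1 x + b2 x
  | @inner_mul_succ n b p h ih =>
    obtain ⟨d, e, hd, he, a1, b1⟩ := ih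
    have hα2 : ‖α‖ ^ 2 ≠ 0 := by positivity
    refine ⟨_, _, (hd.inner_mul b).add
      ((h.comp_isometry (dunklRefl α)).const_mul (2 * inner ℝ b α / ‖α‖ ^ 2)),
      (he.inner_mul b).add (hd.succ.const_mul (inner ℝ b α)), fun x => ?_, fun x => ?_⟩
    · simp only [inner_dunklRefl]
      linear_combination (inner ℝ b x) * a1 x
    · rw [h.fderiv_inner_mul]
      have : 2 * inner ℝ b α / ‖α‖ ^ 2 * ‖α‖ ^ 2 = 2 * inner ℝ b α :=
        div_mul_cancel₀ _ hα2
      linear_combination (inner ℝ b x) * b1 x - 1 / 2 * p (dunklRefl α x) * this +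
        inner ℝ b α * a1 x

theorem pow_le_one_add_pow {q : ℝ} (hq : 0 ≤ q) {j K : ℕ} (h : j ≤ K) : q ^ j ≤ 1 + q ^ K := by
  rcases le_total q 1 with h1 | h1
  · have := pow_le_one₀ (n := j) hq h1
    have : 0 ≤ q ^ K := by positivity
    linarith
  · have := pow_le_pow_right₀ h1 h
    linarith

theorem norm_mul_one_add_pow_le (z : EuclideanSpace ℝ (Fin N)) (K : ℕ) :
    ‖z‖ * (1 + (‖z‖ ^ 2) ^ K) ≤ 4 * (1 + (‖z‖ ^ 2) ^ (K + 1)) := by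
  have hz := norm_nonneg z
  have hq : 0 ≤ ‖z‖ ^ 2 := by positivity
  have h1 : ‖z‖ ≤ 1 + ‖z‖ ^ 2 := by nlinarith [sq_nonneg (‖z‖ - 1)]
  have h2 := pow_le_one_add_pow hq (show 1 ≤ K + 1 by omega)
  have h3 := pow_le_one_add_pow hq (show K ≤ K + 1 by omega)
  have h4 : (0 : ℝ) ≤ (‖z‖ ^ 2) ^ K := by positivity
  calc ‖z‖ * (1 + (‖z‖ ^ 2) ^ K) ≤ (1 + ‖z‖ ^ 2) * (1 + (‖z‖ ^ 2) ^ K) := by gcongr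
    _ = 1 + (‖z‖ ^ 2) ^ 1 + (‖z‖ ^ 2) ^ K + (‖z‖ ^ 2) ^ (K + 1) := by ring
    _ ≤ _ := by linarith

theorem abs_fderiv_apply_le (p : EuclideanSpace ℝ (Fin N) → ℝ) (s z : EuclideanSpace ℝ (Fin N)) :
    |fderiv ℝ p s z| ≤ ‖fderiv ℝ p s‖ * ‖z‖ :=
  (fderiv ℝ p s).le_opNorm z

theorem abs_sub_le_of_taylor {s : EuclideanSpace ℝ (Fin N)} {C : ℝ} {K : ℕ} (hC : 0 ≤ C)
    {u : EuclideanSpace ℝ (Fin N)}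
    (h : |p u - p s - fderiv ℝ p s (u - s)| ≤ C * (‖u - s‖ ^ 2 * (1 + (‖u - s‖ ^ 2) ^ K))) :
    |p u - p s| ≤ (‖fderiv ℝ p s‖ + 4 * C) * (‖u - s‖ * (1 + (‖u - s‖ ^ 2) ^ (K + 1))) := by
  have h1 := abs_fderiv_apply_le p s (u - s)
  have h2 := norm_mul_one_add_pow_le (u - s) K
  have h3 : |p u - p s| ≤ |p u - p s - fderiv ℝ p s (u - s)| + |fderiv ℝ p s (u - s)| := by
    have := abs_add_le (p u - p s - fderiv ℝ p s (u - s)) (fderiv ℝ p s (u - s))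
    rwa [sub_add_cancel] at this
  have h4 : (0 : ℝ) ≤ (‖u - s‖ ^ 2) ^ (K + 1) := by positivity
  calc |p u - p s| ≤ C * (‖u - s‖ ^ 2 * (1 + (‖u - s‖ ^ 2) ^ K)) + ‖fderiv ℝ p s‖ * ‖u - s‖ :=
        h3.trans (add_le_add h h1)
    _ = C * (‖u - s‖ * (‖u - s‖ * (1 + (‖u - s‖ ^ 2) ^ K))) + ‖fderiv ℝ p s‖ * (‖u - s‖ * 1) := by
        ring
    _ ≤ C * (‖u - s‖ * (4 * (1 + (‖u - s‖ ^ 2) ^ (K + 1)))) +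
        ‖fderiv ℝ p s‖ * (‖u - s‖ * (1 + (‖u - s‖ ^ 2) ^ (K + 1))) := by
        gcongr
        linarith
    _ = _ := by ring

/-- A first-order Taylor expansion with polynomially bounded remainder. -/
theorem exists_taylor (hp : PolyLT n p) (s : EuclideanSpace ℝ (Fin N)) :
    ∃ (C : ℝ) (K : ℕ), 0 ≤ C ∧ ∀ u,
      |p u - p s - fderiv ℝ p s (u - s)| ≤ C * (‖u - s‖ ^ 2 * (1 + (‖u - s‖ ^ 2) ^ K)) := by
  induction hp with
  | zero => exact ⟨0, 0, le_rfl, fun u => by simp⟩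
  | const n c => exact ⟨0, 0, le_rfl, fun u => by simp⟩
  | @add n p q hp hq h1 h2 =>
    obtain ⟨C, K, hC, h1⟩ := h1
    obtain ⟨D, L, hD, h2⟩ := h2
    refine ⟨2 * C + 2 * D, K + L, by positivity, fun u => ?_⟩
    rw [hp.fderiv_add_apply hq]
    have hq0 : 0 ≤ ‖u - s‖ ^ 2 := by positivity
    have e1 := pow_le_one_add_pow hq0 (show K ≤ K + L by omega)
    have e2 := pow_le_one_add_pow hq0 (show L ≤ K + L by omega)
    have e3 : (0 : ℝ) ≤ (‖u - s‖ ^ 2) ^ (K + L) := by positivity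
    calc _ = |(p u - p s - fderiv ℝ p s (u - s)) + (q u - q s - fderiv ℝ q s (u - s))| := by
          congr 1; ring
      _ ≤ C * (‖u - s‖ ^ 2 * (1 + (‖u - s‖ ^ 2) ^ K)) +
          D * (‖u - s‖ ^ 2 * (1 + (‖u - s‖ ^ 2) ^ L)) :=
        (abs_add_le _ _).trans (add_le_add (h1 u) (h2 u))
      _ ≤ C * (‖u - s‖ ^ 2 * (2 * (1 + (‖u - s‖ ^ 2) ^ (K + L)))) +
          D * (‖u - s‖ ^ 2 * (2 * (1 + (‖u - s‖ ^ 2) ^ (K + L)))) := by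
        gcongr <;> linarith
      _ = _ := by ring
  | @inner_mul_succ n b p hp h =>
    obtain ⟨C, K, hC, h⟩ := h
    set D := ‖fderiv ℝ p s‖ + 4 * C with hD
    have hD0 : 0 ≤ D := by positivity
    refine ⟨|inner ℝ b s| * (2 * C) + ‖b‖ * D, K + 1, by positivity, fun u => ?_⟩
    rw [hp.fderiv_inner_mul]
    have h2 := abs_sub_le_of_taylor hC (h u)
    rw [← hD] at h2
    have hq0 : 0 ≤ ‖u - s‖ ^ 2 := by positivity
    have e1 := pow_le_one_add_pow hq0 (show K ≤ K + 1 by omega)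
    have e3 : (0 : ℝ) ≤ (‖u - s‖ ^ 2) ^ (K + 1) := by positivity
    calc _ = |inner ℝ b s * (p u - p s - fderiv ℝ p s (u - s)) +
          inner ℝ b (u - s) * (p u - p s)| := by
          congr 1
          rw [inner_sub_right]
          ring
      _ ≤ |inner ℝ b s| * (C * (‖u - s‖ ^ 2 * (1 + (‖u - s‖ ^ 2) ^ K))) +
          (‖b‖ * ‖u - s‖) * (D * (‖u - s‖ * (1 + (‖u - s‖ ^ 2) ^ (K + 1)))) := by
        refine (abs_add_le _ _).trans ?_
        rw [abs_mul, abs_mul]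
        gcongr
        · exact h u
        · exact abs_real_inner_le_norm _ _
      _ ≤ |inner ℝ b s| * (C * (‖u - s‖ ^ 2 * (2 * (1 + (‖u - s‖ ^ 2) ^ (K + 1))))) +
          (‖b‖ * ‖u - s‖) * (D * (‖u - s‖ * (1 + (‖u - s‖ ^ 2) ^ (K + 1)))) := by
        gcongr
        linarith
      _ = _ := by ring

end PolyLT

/-! ### Difference operators on the reflection group -/

namespace DunklRootSystem

variable {N : ℕ} (R : DunklRootSystem N)

/-- The reflection along a positive root as an element of the reflection group (and `1` for other
vectors). -/
noncomputable def reflElt (α : EuclideanSpace ℝ (Fin N)) : R.weylGroup :=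
  open Classical in
  if h : α ∈ R.posRoots then
    ⟨dunklRefl α, R.dunklRefl_mem_weylGroup (R.mem_posRoots.1 h).1⟩
  else 1

variable {R}

theorem coe_reflElt {α : EuclideanSpace ℝ (Fin N)} (hα : α ∈ R.posRoots) :
    (R.reflElt α).1 = dunklRefl α := by
  rw [reflElt, dif_pos hα]

theorem reflElt_mul_self (α : EuclideanSpace ℝ (Fin N)) : R.reflElt α * R.reflElt α = 1 := by
  by_cases hα : α ∈ R.posRoots
  · apply Subtype.ext
    rw [Subgroup.coe_mul, coe_reflElt hα, dunklRefl_mul_self, Subgroup.coe_one]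
  · rw [reflElt, dif_neg hα, mul_one]

theorem mul_reflElt_apply (w : R.weylGroup) {α : EuclideanSpace ℝ (Fin N)} (hα : α ∈ R.posRoots)
    (x : EuclideanSpace ℝ (Fin N)) : (w * R.reflElt α).1 x = w.1 (dunklRefl α x) := by
  rw [Subgroup.coe_mul, coe_reflElt hα]
  rfl

variable (R) in
/-- The operator `φ ↦ ∑_α c_α (φ - φ(· σ_α))` on functions on the reflection group. -/
noncomputable def reflSum (c : EuclideanSpace ℝ (Fin N) → ℝ) :
    EuclideanSpace ℝ R.weylGroup →ₗ[ℝ] EuclideanSpace ℝ R.weylGroup where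
  toFun φ := WithLp.toLp 2 fun w => ∑ α ∈ R.posRoots, c α * (φ w - φ (w * R.reflElt α))
  map_add' φ ψ := by
    ext w
    simp only [PiLp.add_apply, ← Finset.sum_add_distrib]
    exact Finset.sum_congr rfl fun α _ => by ring
  map_smul' a φ := by
    ext w
    simp only [PiLp.smul_apply, smul_eq_mul, RingHom.id_apply, Finset.mul_sum]
    exact Finset.sum_congr rfl fun α _ => by ring

theorem reflSum_apply (c : EuclideanSpace ℝ (Fin N) → ℝ) (φ : EuclideanSpace ℝ R.weylGroup)
    (w : R.weylGroup) :
    R.reflSum c φ w = ∑ α ∈ R.posRoots, c α * (φ w - φ (w * R.reflElt α)) := rfl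

theorem inner_eq_sum (φ ψ : EuclideanSpace ℝ R.weylGroup) :
    (inner ℝ φ ψ : ℝ) = ∑ w, φ w * ψ w := by
  simp [PiLp.inner_apply, mul_comm]

theorem sum_mul_reflElt (α : EuclideanSpace ℝ (Fin N)) (f : R.weylGroup → ℝ) :
    ∑ w, f (w * R.reflElt α) = ∑ w, f w :=
  Fintype.sum_equiv (Equiv.mulRight (R.reflElt α)) _ _ fun _ => rfl

theorem inner_reflSum (c : EuclideanSpace ℝ (Fin N) → ℝ) (φ ψ : EuclideanSpace ℝ R.weylGroup) :
    (inner ℝ φ (R.reflSum c ψ) : ℝ) = ∑ α ∈ R.posRoots, c α / 2 *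
      ∑ w, (φ w - φ (w * R.reflElt α)) * (ψ w - ψ (w * R.reflElt α)) := by
  rw [inner_eq_sum]
  simp only [reflSum_apply, Finset.mul_sum]
  rw [Finset.sum_comm]
  refine Finset.sum_congr rfl fun α _ => ?_
  have h1 := sum_mul_reflElt (R := R) α fun w => φ w * (ψ w - ψ (w * R.reflElt α))
  simp only [mul_assoc, reflElt_mul_self, mul_one] at h1
  have h2 : ∑ w : R.weylGroup, φ (w * R.reflElt α) * (ψ (w * R.reflElt α) - ψ w) +
      ∑ w : R.weylGroup, φ w * (ψ w - ψ (w * R.reflElt α)) =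
      ∑ w : R.weylGroup, (φ w - φ (w * R.reflElt α)) * (ψ w - ψ (w * R.reflElt α)) := by
    rw [← Finset.sum_add_distrib]
    exact Finset.sum_congr rfl fun w _ => by ring
  have h3 : ∑ w : R.weylGroup, φ w * (c α * (ψ w - ψ (w * R.reflElt α))) =
      c α * ∑ w : R.weylGroup, φ w * (ψ w - ψ (w * R.reflElt α)) := by
    rw [Finset.mul_sum]
    exact Finset.sum_congr rfl fun w _ => by ring
  rw [h3, ← Finset.mul_sum, ← h2, h1]
  ring

theorem reflSum_isSymmetric (c : EuclideanSpace ℝ (Fin N) → ℝ) : (R.reflSum c).IsSymmetric := by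
  intro φ ψ
  rw [real_inner_comm, inner_reflSum, inner_reflSum]
  simp only [mul_comm]

/-! ### The action of the generator on polynomials -/

theorem sum_posRoots_map {w : EuclideanSpace ℝ (Fin N) ≃ₗᵢ[ℝ] EuclideanSpace ℝ (Fin N)}
    (hw : w ∈ R.weylGroup) {g : EuclideanSpace ℝ (Fin N) → ℝ} (hg : ∀ α, g (-α) = g α) :
    ∑ α ∈ R.posRoots, g (w α) = ∑ α ∈ R.posRoots, g α := by
  classical
  have h1 : ∀ f : EuclideanSpace ℝ (Fin N) → ℝ, (∀ α, f (-α) = f α) →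
      ∑ α ∈ R.roots, f α = 2 * ∑ α ∈ R.posRoots, f α := by
    intro f hf
    rw [← Finset.sum_filter_add_sum_filter_not R.roots (fun α => 0 < (inner ℝ R.m α : ℝ)), two_mul]
    refine congrArg₂ (· + ·) (by simp [posRoots]) ?_
    refine Finset.sum_nbij' (fun α => -α) (fun α => -α) (fun α hα => ?_) (fun α hα => ?_)
      (fun _ _ => neg_neg _) (fun _ _ => neg_neg _) fun α _ => (hf α).symm
    · rw [Finset.mem_filter] at hα
      rcases R.mem_posRoots_or_neg hα.1 with h | h
      · exact absurd (R.mem_posRoots.1 h).2 hα.2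
      · exact h
    · rw [Finset.mem_filter]
      have h2 := R.mem_posRoots.1 hα
      refine ⟨R.neg_mem_roots h2.1, ?_⟩
      rw [inner_neg_right]
      linarith [h2.2]
  have h2 : ∑ α ∈ R.roots, g (w α) = ∑ α ∈ R.roots, g α := by
    have hmem : ∀ v ∈ R.weylGroup, ∀ α ∈ R.roots, v α ∈ R.roots := fun v hv α hα => by
      have := R.weylGroup_image_roots hv
      rw [← Finset.mem_coe, ← this]
      exact ⟨α, hα, rfl⟩
    exact Finset.sum_nbij' (fun α => w α) (fun α => w⁻¹ α) (fun α hα => hmem w hw α hα)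
      (fun α hα => hmem _ (R.weylGroup.inv_mem hw) α hα) (fun α _ => w.symm_apply_apply α)
      (fun α _ => w.apply_symm_apply α) fun _ _ => rfl
  have h3 := h1 (fun α => g (w α)) fun α => by rw [map_neg, hg]
  have h4 := h1 g hg
  linarith

variable (R) in
/-- The operator
`p ↦ x · ∇p - ∑_α (α · ∇p / (α · x) - ½ ‖α‖² (p - p ∘ σ_α) / (α · x)²)`, the first-order part
(in the freezing limit) of the generator of the Dunkl process. -/
noncomputable def radialOp (p : EuclideanSpace ℝ (Fin N) → ℝ) (x : EuclideanSpace ℝ (Fin N)) : ℝ :=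
  fderiv ℝ p x x - ∑ α ∈ R.posRoots, (fderiv ℝ p x α / inner ℝ α x -
    1 / 2 * ‖α‖ ^ 2 * (p x - p (dunklRefl α x)) / (inner ℝ α x) ^ 2)

theorem radialOp_map (p : EuclideanSpace ℝ (Fin N) → ℝ) (w : R.weylGroup)
    (u : EuclideanSpace ℝ (Fin N)) : R.radialOp p (w.1 u) =
      fderiv ℝ p (w.1 u) (w.1 (u - ∑ α ∈ R.posRoots, (inner ℝ α u : ℝ)⁻¹ • α)) +
      ∑ α ∈ R.posRoots, 1 / 2 * ‖α‖ ^ 2 / (inner ℝ α u) ^ 2 *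
        (p (w.1 u) - p ((w * R.reflElt α).1 u)) := by
  rw [radialOp, ← sum_posRoots_map w.2, map_sub, map_sub, map_sum, map_sum, sub_add,
    ← Finset.sum_sub_distrib]
  · congr 1
    refine Finset.sum_congr rfl fun α hα => ?_
    rw [mul_reflElt_apply w hα, dunklRefl_map, w.1.inner_map_map, w.1.norm_map, map_smul, map_smul,
      smul_eq_mul]
    have : (w.1 * dunklRefl α * w.1⁻¹) (w.1 u) = w.1 (dunklRefl α u) := by
      change w.1 (dunklRefl α (w.1.symm (w.1 u))) = _
      rw [w.1.symm_apply_apply]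
    rw [this]
    ring
  · intro α
    rw [dunklRefl_neg, inner_neg_left, norm_neg, map_neg, neg_div_neg_eq, neg_sq]

theorem _root_.PolyLT.exists_radialOp {n : ℕ} {p : EuclideanSpace ℝ (Fin N) → ℝ}
    (hp : PolyLT n p) : ∃ q, PolyLT (n - 1) q ∧ ∀ x, (∀ α ∈ R.posRoots, (inner ℝ α x : ℝ) ≠ 0) →
      R.radialOp p x = ((n : ℝ) - 1) * p x + q x := by
  obtain ⟨q, hq, hqe⟩ := hp.exists_euler
  choose! d e hd he h1 h2 using fun α (hα : α ∈ R.posRoots) =>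
    hp.exists_dividedDifference (R.ne_zero_of_mem_posRoots hα)
  refine ⟨_, hq.sub (PolyLT.sum R.posRoots he), fun x hx => ?_⟩
  rw [radialOp, hqe, add_sub_assoc]
  congr 2
  refine Finset.sum_congr rfl fun α hα => ?_
  have h3 := hx α hα
  have e1 := h1 α hα x
  have e2 := h2 α hα x
  rw [e1]
  field_simp
  linear_combination 2 * e2

theorem radialOp_add {n k : ℕ} {p q : EuclideanSpace ℝ (Fin N) → ℝ} (hp : PolyLT n p)
    (hq : PolyLT k q) (x : EuclideanSpace ℝ (Fin N)) :
    R.radialOp (fun x => p x + q x) x = R.radialOp p x + R.radialOp q x := by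
  simp only [radialOp, hp.fderiv_add_apply hq]
  rw [← sub_eq_zero]
  have h : ∀ A B C D E : ℝ, A + B - C - (A - D + (B - E)) = D + E - C := fun _ _ _ _ _ => by ring
  rw [h, ← Finset.sum_add_distrib, sub_eq_zero]
  exact Finset.sum_congr rfl fun α _ => by ring

theorem radialOp_const_mul {n : ℕ} {p : EuclideanSpace ℝ (Fin N) → ℝ} (hp : PolyLT n p) (c : ℝ)
    (x : EuclideanSpace ℝ (Fin N)) :
    R.radialOp (fun x => c * p x) x = c * R.radialOp p x := by
  have h : ∀ v, fderiv ℝ (fun x => c * p x) x v = c * fderiv ℝ p x v := fun v => by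
    rw [fderiv_const_mul (hp.differentiableAt x)]
    rfl
  simp only [radialOp, h, mul_sub, Finset.mul_sum]
  congr 1
  exact Finset.sum_congr rfl fun α _ => by ring

/-! ### Restriction to the orbit of the critical point -/

variable (R) in
/-- The restriction of `p` to the orbit of `s`, as a function on the group. -/
noncomputable def orbitEval (s : EuclideanSpace ℝ (Fin N)) (p : EuclideanSpace ℝ (Fin N) → ℝ) :
    EuclideanSpace ℝ R.weylGroup :=
  WithLp.toLp 2 fun w => p (w.1 s)

theorem orbitEval_apply (s : EuclideanSpace ℝ (Fin N)) (p : EuclideanSpace ℝ (Fin N) → ℝ)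
    (w : R.weylGroup) : R.orbitEval s p w = p (w.1 s) := rfl

/-- The weights `½ ‖α‖² / (α · s)²`. -/
noncomputable def _root_.freezingWeight (s α : EuclideanSpace ℝ (Fin N)) : ℝ :=
  1 / 2 * ‖α‖ ^ 2 / (inner ℝ α s) ^ 2

variable {s : EuclideanSpace ℝ (Fin N)}

theorem inner_map_ne_zero {u : EuclideanSpace ℝ (Fin N)} (hu : u ∈ R.openChamber)
    (w : R.weylGroup) {α : EuclideanSpace ℝ (Fin N)} (hα : α ∈ R.posRoots) :
    (inner ℝ α (w.1 u) : ℝ) ≠ 0 := by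
  have hβ : w.1.symm α ∈ R.roots := by
    have := R.weylGroup_image_roots (R.weylGroup.inv_mem w.2)
    rw [← Finset.mem_coe, ← this]
    exact ⟨α, (R.mem_posRoots.1 hα).1, rfl⟩
  rw [← w.1.symm.inner_map_map, w.1.symm_apply_apply]
  rcases R.mem_posRoots_or_neg hβ with h | h
  · exact (hu _ h).ne'
  · have := hu _ h
    rw [inner_neg_left] at this
    exact (neg_pos.1 this).ne

theorem orbitEval_radialOp (hs : R.IsCritical s) (p : EuclideanSpace ℝ (Fin N) → ℝ) :
    R.orbitEval s (R.radialOp p) = R.reflSum (freezingWeight s) (R.orbitEval s p) := by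
  ext w
  rw [orbitEval_apply, radialOp_map, ← hs.2, sub_self, map_zero, map_zero, zero_add]
  rfl

theorem orbitEval_congr (hs : R.IsCritical s) {p q : EuclideanSpace ℝ (Fin N) → ℝ}
    (h : ∀ x, (∀ α ∈ R.posRoots, (inner ℝ α x : ℝ) ≠ 0) → p x = q x) :
    R.orbitEval s p = R.orbitEval s q := by
  ext w
  exact h _ fun α hα => inner_map_ne_zero hs.1 w hα

theorem reflSum_orbitEval (hs : R.IsCritical s) {n : ℕ} {p q : EuclideanSpace ℝ (Fin N) → ℝ}
    (h : ∀ x, (∀ α ∈ R.posRoots, (inner ℝ α x : ℝ) ≠ 0) →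
      R.radialOp p x = ((n : ℝ) - 1) * p x + q x) :
    R.reflSum (freezingWeight s) (R.orbitEval s p) =
      ((n : ℝ) - 1) • R.orbitEval s p + R.orbitEval s q := by
  rw [← orbitEval_radialOp hs, orbitEval_congr hs h]
  rfl

theorem IsCritical.map_injective (hs : R.IsCritical s) {w v : R.weylGroup}
    (h : w.1 s = v.1 s) : w = v := by
  have h1 : (v⁻¹ * w).1 s = s := by
    change v.1.symm (w.1 s) = s
    rw [h, v.1.symm_apply_apply]
  have h2 := R.eq_one_of_map_openChamber (v⁻¹ * w).2 hs.1 (by rw [h1]; exact hs.1)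
  have h3 : v⁻¹ * w = 1 := Subtype.ext h2
  exact (inv_mul_eq_one.1 h3).symm

/-- Interpolation on the orbit, which is free. -/
theorem exists_orbitEval_eq (hs : R.IsCritical s) (φ : EuclideanSpace ℝ R.weylGroup) :
    ∃ n p, PolyLT n p ∧ R.orbitEval s p = φ := by
  classical
  have hprod : ∀ (w : R.weylGroup) (S : Finset R.weylGroup), ∃ p,
      PolyLT (S.card + 1) p ∧ ∀ x, p x = ∏ v ∈ S, inner ℝ (w.1 s - v.1 s) (x - v.1 s) := by
    intro w S
    induction S using Finset.induction_on with
    | empty => exact ⟨_, PolyLT.const 0 1, fun x => by simp⟩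
    | insert v S hv ih =>
      obtain ⟨p, hp, e⟩ := ih
      refine ⟨_, (hp.inner_mul (w.1 s - v.1 s)).add
        (hp.succ.const_mul (-inner ℝ (w.1 s - v.1 s) (v.1 s))) |>.mono ?_, fun x => ?_⟩
      · rw [Finset.card_insert_of_notMem hv]
      · rw [Finset.prod_insert hv, e, inner_sub_right]
        ring
  choose p hp e using fun w => hprod w (Finset.univ.erase w)
  have hne : ∀ w, p w (w.1 s) ≠ 0 := fun w => by
    rw [e, Finset.prod_ne_zero_iff]
    intro v hv h
    rw [inner_self_eq_zero, sub_eq_zero] at h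
    exact (Finset.ne_of_mem_erase hv) (hs.map_injective h.symm)
  have hz : ∀ w v, v ≠ w → p w (v.1 s) = 0 := fun w v h => by
    rw [e]
    refine Finset.prod_eq_zero (i := v) (Finset.mem_erase.2 ⟨h, Finset.mem_univ _⟩) ?_
    rw [sub_self, inner_zero_right]
  refine ⟨Fintype.card R.weylGroup + 1, fun x => ∑ w, φ w / p w (w.1 s) * p w x,
    PolyLT.sum _ fun w _ => ((hp w).mono ?_).const_mul _, ?_⟩
  · exact Nat.succ_le_succ (Finset.card_le_univ _)
  · ext v
    rw [orbitEval_apply, Finset.sum_eq_single v]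
    · exact div_mul_cancel₀ _ (hne v)
    · intro w _ hw
      rw [hz w v hw.symm, mul_zero]
    · simp

/-- Correction of lower-order terms of a polynomial lift. -/
theorem exists_radialOp_correction (hs : R.IsCritical s) (m : ℕ) : ∀ (j : ℕ), j ≤ m →
    ∀ r, PolyLT j r → R.orbitEval s r = 0 → ∃ c, PolyLT j c ∧ R.orbitEval s c = 0 ∧
      ∀ x, (∀ α ∈ R.posRoots, (inner ℝ α x : ℝ) ≠ 0) → R.radialOp c x = m * c x + r x := by
  intro j
  induction j with
  | zero =>
    intro _ r hr _
    refine ⟨_, hr, ?_, fun x _ => ?_⟩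
    · assumption
    · rw [hr.eq_zero]
      simp [radialOp]
  | succ j ih =>
    intro hj r hr h0
    obtain ⟨q, hq, e⟩ := hr.exists_radialOp (R := R)
    have hjm : (j : ℝ) - m ≠ 0 := by
      have : (j : ℝ) + 1 ≤ m := by exact_mod_cast hj
      exact (show (j : ℝ) - m < 0 by linarith).ne
    have hq0 : R.orbitEval s q = 0 := by
      have h1 := reflSum_orbitEval hs e
      rw [h0, map_zero, smul_zero, zero_add] at h1
      exact h1.symm
    set b := ((j : ℝ) - m)⁻¹ with hb
    have hbm : b * (j - m) = 1 := inv_mul_cancel₀ hjm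
    obtain ⟨c, hc, hc0, hce⟩ := ih (by omega) (fun x => -b * q x) (hq.const_mul _) (by
      ext w
      have := congrArg (fun φ => φ w) hq0
      simp only [orbitEval_apply] at this ⊢
      rw [this]
      simp)
    refine ⟨_, (hr.const_mul b).add hc.succ, ?_, fun x hx => ?_⟩
    · ext w
      have e1 := congrArg (fun φ => φ w) h0
      have e2 := congrArg (fun φ => φ w) hc0
      simp only [orbitEval_apply] at e1 e2 ⊢
      rw [e1, e2]
      simp
    · rw [radialOp_add (hr.const_mul b) hc, radialOp_const_mul hr, e x hx, hce x hx]
      push_cast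
      linear_combination r x * hbm

/-- The spectral theory of the frozen generator: its eigenvalues are natural numbers, and an
eigenfunction of eigenvalue `m` extends to a polynomial of degree at most `m` that is an
eigenfunction of `radialOp`, and is orthogonal to the restrictions of all polynomials of smaller
degree. -/
theorem exists_polynomial_lift (hs : R.IsCritical s) {φ : EuclideanSpace ℝ R.weylGroup}
    (hφ : φ ≠ 0) {μ : ℝ} (hμ : R.reflSum (freezingWeight s) φ = μ • φ) :
    ∃ m : ℕ, μ = m ∧ (∃ p, PolyLT (m + 1) p ∧ R.orbitEval s p = φ ∧
      ∀ x, (∀ α ∈ R.posRoots, (inner ℝ α x : ℝ) ≠ 0) → R.radialOp p x = m * p x) ∧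
      ∀ q, PolyLT m q → (inner ℝ φ (R.orbitEval s q) : ℝ) = 0 := by
  classical
  have hex : ∃ n p, PolyLT n p ∧ R.orbitEval s p = φ := exists_orbitEval_eq hs φ
  obtain ⟨p, hp, hpe⟩ := Nat.find_spec hex
  have hmin := fun k => Nat.find_min hex (m := k)
  generalize Nat.find hex = n at hp hmin
  cases n with
  | zero =>
    refine absurd ?_ hφ
    rw [← hpe, hp.eq_zero]
    rfl
  | succ m =>
    obtain ⟨q, hq, e⟩ := hp.exists_radialOp (R := R)
    have h1 := reflSum_orbitEval hs e
    rw [hpe, hμ] at h1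
    push_cast at h1 e
    rw [add_sub_cancel_right] at h1
    have hμm : μ = m := by
      by_contra hne
      have hne' := sub_ne_zero.2 hne
      refine hmin m (Nat.lt_succ_self m) ⟨_, hq.const_mul (μ - m)⁻¹, ?_⟩
      have h2 : R.orbitEval s q = (μ - m) • φ := by
        rw [sub_smul, h1, add_sub_cancel_left]
      have h3 : R.orbitEval s (fun x => (μ - m)⁻¹ * q x) = (μ - m)⁻¹ • R.orbitEval s q := rfl
      rw [h3, h2, smul_smul, inv_mul_cancel₀ hne', one_smul]
    refine ⟨m, hμm, ?_, ?_⟩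
    · have hq0 : R.orbitEval s q = 0 := by
        rw [hμm] at h1
        exact left_eq_add.1 h1
      obtain ⟨c, hc, hc0, hce⟩ := exists_radialOp_correction hs m m le_rfl (fun x => -1 * q x)
        (hq.const_mul _) (by
          have h3 : R.orbitEval s (fun x => -1 * q x) = (-1 : ℝ) • R.orbitEval s q := rfl
          rw [h3, hq0, smul_zero])
      refine ⟨_, hp.add hc.succ, ?_, fun x hx => ?_⟩
      · have h3 : R.orbitEval s (fun x => p x + c x) = R.orbitEval s p + R.orbitEval s c := rfl
        rw [h3, hpe, hc0, add_zero]
      · rw [radialOp_add hp hc, e x hx, hce x hx]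
        ring
    · have hsub : ∀ j, j ≤ m → ∀ r, PolyLT j r → (inner ℝ φ (R.orbitEval s r) : ℝ) = 0 := by
        intro j
        induction j with
        | zero =>
          intro _ r hr
          rw [hr.eq_zero]
          exact inner_zero_right φ
        | succ j ih =>
          intro hj r hr
          obtain ⟨q, hq, e⟩ := hr.exists_radialOp (R := R)
          have h1 := reflSum_orbitEval hs e
          have h2 := reflSum_isSymmetric (R := R) (freezingWeight s) φ (R.orbitEval s r)
          rw [hμ, h1, inner_add_right, ih (by omega) q hq, real_inner_smul_left,
            real_inner_smul_right, hμm] at h2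
          push_cast at h2
          have h3 : ((m : ℝ) - j) * inner ℝ φ (R.orbitEval s r) = 0 := by linarith
          refine (mul_eq_zero.1 h3).resolve_left ?_
          have : (j : ℝ) + 1 ≤ m := by exact_mod_cast hj
          exact (show (0 : ℝ) < m - j by linarith).ne'
      exact hsub m le_rfl

end DunklRootSystem

namespace DunklRootSystem

variable {N : ℕ} {R : DunklRootSystem N} {s : EuclideanSpace ℝ (Fin N)}

/-! ### Derivatives of eigenfunctions at the critical point -/

variable (R) in
/-- The derivative of `u ↦ p (w u)` at `s` along `v`, as a function of `w`. -/
noncomputable def orbitGrad (s : EuclideanSpace ℝ (Fin N)) (p : EuclideanSpace ℝ (Fin N) → ℝ)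
    (v : EuclideanSpace ℝ (Fin N)) : EuclideanSpace ℝ R.weylGroup :=
  WithLp.toLp 2 fun w => fderiv ℝ p (w.1 s) (w.1 v)

theorem orbitGrad_apply (p : EuclideanSpace ℝ (Fin N) → ℝ) (v : EuclideanSpace ℝ (Fin N))
    (w : R.weylGroup) : R.orbitGrad s p v w = fderiv ℝ p (w.1 s) (w.1 v) := rfl

/-- Minus the derivative along `v` of the weights `½ ‖α‖² / (α · u)²` at `u = s`. -/
noncomputable def _root_.freezingWeightDeriv {N : ℕ} (s v α : EuclideanSpace ℝ (Fin N)) : ℝ :=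
  2 * freezingWeight s α * inner ℝ (scaledRoot s α) v

/-- The eigenvalue equation of `radialOp`, differentiated at `s`. -/
theorem orbitGrad_hess (hs : R.IsCritical s) {n : ℕ} {p : EuclideanSpace ℝ (Fin N) → ℝ}
    (hp : PolyLT n p) {m : ℝ}
    (h : ∀ x, (∀ α ∈ R.posRoots, (inner ℝ α x : ℝ) ≠ 0) → R.radialOp p x = m * p x)
    (v : EuclideanSpace ℝ (Fin N)) :
    R.orbitGrad s p (R.hess s v) + R.reflSum (freezingWeight s) (R.orbitGrad s p v) -
      m • R.orbitGrad s p v = R.reflSum (freezingWeightDeriv s v) (R.orbitEval s p) := by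
  ext w
  have hu : HasDerivAt (fun t : ℝ => s + t • v) v 0 := by
    simpa using ((hasDerivAt_id (0 : ℝ)).smul_const v).const_add s
  have hpu : ∀ w : R.weylGroup, HasDerivAt (fun t : ℝ => p (w.1 (s + t • v)))
      (fderiv ℝ p (w.1 s) (w.1 v)) 0 := by
    intro w
    have h1 : HasDerivAt (fun t : ℝ => w.1 s + t • w.1 v) (w.1 v) 0 := by
      simpa using ((hasDerivAt_id (0 : ℝ)).smul_const (w.1 v)).const_add (w.1 s)
    have h2 : HasFDerivAt p (fderiv ℝ p (w.1 s)) (w.1 s + (0 : ℝ) • w.1 v) := by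
      rw [zero_smul, add_zero]
      exact (hp.differentiableAt _).hasFDerivAt
    simp only [map_add, map_smul]
    exact h2.comp_hasDerivAt 0 h1
  have hin : ∀ α, HasDerivAt (fun t : ℝ => (inner ℝ α (s + t • v) : ℝ)) (inner ℝ α v) 0 := by
    intro α
    have := (hasDerivAt_const (0 : ℝ) α).inner ℝ hu
    simpa using this
  have hforce : HasDerivAt (fun t : ℝ => w.1 ((s + t • v) -
      ∑ α ∈ R.posRoots, (inner ℝ α (s + t • v) : ℝ)⁻¹ • α)) (w.1 (R.hess s v)) 0 := by
    have h1 : HasDerivAt (fun t : ℝ => (s + t • v) -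
        ∑ α ∈ R.posRoots, (inner ℝ α (s + t • v) : ℝ)⁻¹ • α) (R.hess s v) 0 := by
      have h2 : ∀ α ∈ R.posRoots, HasDerivAt (fun t : ℝ => (inner ℝ α (s + t • v) : ℝ)⁻¹ • α)
          ((-inner ℝ α v / (inner ℝ α s) ^ 2 : ℝ) • α) 0 := fun α hα => by
        have h3 := ((hin α).fun_inv (by simpa using (hs.inner_pos hα).ne')).smul_const α
        simpa using h3
      convert! hu.fun_sub (HasDerivAt.fun_sum h2) using 1
      rw [hess_apply, sub_eq_add_neg, ← Finset.sum_neg_distrib]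
      congr 1
      refine Finset.sum_congr rfl fun α hα => ?_
      rw [scaledRoot, real_inner_smul_left, smul_smul, ← neg_smul]
      congr 1
      have := (hs.inner_pos hα).ne'
      field_simp
    exact (w.1.toContinuousLinearEquiv.toContinuousLinearMap.hasFDerivAt).comp_hasDerivAt 0 h1
  have hD : DifferentiableAt ℝ (fun t : ℝ => fderiv ℝ p (w.1 (s + t • v))) 0 := by
    have h1 : Differentiable ℝ (fderiv ℝ p) :=
      ((hp.contDiff (j := 2)).fderiv_right (m := 1) (by norm_num)).differentiable (by norm_num)
    have h2 : DifferentiableAt ℝ (fun t : ℝ => w.1 (s + t • v)) 0 :=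
      ((w.1.toContinuousLinearEquiv.toContinuousLinearMap.hasFDerivAt).comp_hasDerivAt 0
        hu).differentiableAt
    exact (h1 _).comp 0 h2
  have hL := (hD.hasDerivAt.clm_apply hforce).fun_add (HasDerivAt.fun_sum (u := R.posRoots)
    (A := fun α t => 1 / 2 * ‖α‖ ^ 2 / (inner ℝ α (s + t • v)) ^ 2 *
        (p (w.1 (s + t • v)) - p ((w * R.reflElt α).1 (s + t • v))))
    (A' := fun α => freezingWeight s α * (fderiv ℝ p (w.1 s) (w.1 v) -
      fderiv ℝ p ((w * R.reflElt α).1 s) ((w * R.reflElt α).1 v)) -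
      freezingWeightDeriv s v α * (p (w.1 s) - p ((w * R.reflElt α).1 s))) fun α hα => by
    have h0 := (hs.inner_pos hα).ne'
    have h1 := ((hin α).fun_pow 2).fun_inv (by simpa using h0)
    have h2 := (h1.const_mul (1 / 2 * ‖α‖ ^ 2)).fun_mul ((hpu w).fun_sub (hpu (w * R.reflElt α)))
    convert! h2 using 1
    simp only [zero_smul, add_zero, freezingWeightDeriv, freezingWeight, scaledRoot,
      real_inner_smul_left]
    push_cast
    field_simp
    ring)
  have hR := (hpu w).const_mul m
  have hev : (fun t : ℝ => m * p (w.1 (s + t • v))) =ᶠ[𝓝 0] fun t =>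
      fderiv ℝ p (w.1 (s + t • v)) (w.1 ((s + t • v) -
      ∑ α ∈ R.posRoots, (inner ℝ α (s + t • v) : ℝ)⁻¹ • α)) + ∑ α ∈ R.posRoots,
      1 / 2 * ‖α‖ ^ 2 / (inner ℝ α (s + t • v)) ^ 2 *
        (p (w.1 (s + t • v)) - p ((w * R.reflElt α).1 (s + t • v))) := by
    have h1 : ∀ᶠ t in 𝓝 (0 : ℝ), s + t • v ∈ R.openChamber :=
      hu.continuousAt.eventually_mem (R.isOpen_openChamber.mem_nhds (by simpa using hs.1))
    filter_upwards [h1] with t ht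
    rw [← h _ fun α hα => inner_map_ne_zero ht w hα, radialOp_map]
  have key := (hR.congr_of_eventuallyEq hev.symm).unique hL
  have hz : w.1 (s + (0 : ℝ) • v - ∑ α ∈ R.posRoots, (inner ℝ α (s + (0 : ℝ) • v) : ℝ)⁻¹ • α) =
      0 := by
    rw [zero_smul, add_zero, ← hs.2, sub_self, map_zero]
  rw [hz, map_zero, zero_add, zero_smul, add_zero, Finset.sum_sub_distrib] at key
  simp only [PiLp.sub_apply, PiLp.add_apply, PiLp.smul_apply, smul_eq_mul, reflSum_apply,
    orbitGrad_apply, orbitEval_apply]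
  linear_combination -key

/-- For an eigenvector `v` of the Hessian with eigenvalue `h`, the number `h - 1` is a natural
number `k`, and the functions `w ↦ b · w v` are restrictions of polynomials of degree at most `k`.
-/
theorem exists_polynomial_inner_map (hs : R.IsCritical s) {v : EuclideanSpace ℝ (Fin N)}
    (hv0 : v ≠ 0) {h : ℝ} (hv : R.hess s v = h • v) : ∃ k : ℕ, h = k + 1 ∧
    ∀ b : EuclideanSpace ℝ (Fin N), ∃ p, PolyLT (k + 1) p ∧
      ∀ w : R.weylGroup, p (w.1 s) = inner ℝ b (w.1 v) := by
  set φ : EuclideanSpace ℝ (Fin N) → EuclideanSpace ℝ R.weylGroup := fun b =>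
    WithLp.toLp 2 fun w => inner ℝ b (w.1 v) with hφ
  have heig : ∀ b, R.reflSum (freezingWeight s) (φ b) = (h - 1) • φ b := by
    intro b
    ext w
    have h1 : (h - 1) • φ b w = inner ℝ b (w.1 (R.hess s v - v)) := by
      rw [hv, smul_eq_mul, map_sub, map_smul, inner_sub_right, real_inner_smul_right]
      simp only [hφ]
      ring
    rw [PiLp.smul_apply, h1, reflSum_apply, hess_apply, add_sub_cancel_left, map_sum, inner_sum]
    refine Finset.sum_congr rfl fun α hα => ?_
    simp only [hφ]
    rw [mul_reflElt_apply w hα, dunklRefl_apply, map_sub, map_smul, map_smul, inner_sub_right,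
      real_inner_smul_right, real_inner_smul_right, scaledRoot, map_smul, real_inner_smul_right,
      real_inner_smul_left, freezingWeight]
    have h2 := (R.norm_pos_of_mem_posRoots hα).ne'
    have h3 := (hs.inner_pos hα).ne'
    field_simp
    ring
  have hne : φ v ≠ 0 := fun h0 => by
    have h1 : φ v 1 = 0 := by rw [h0]; rfl
    exact hv0 (inner_self_eq_zero.1 (h1 : (inner ℝ v v : ℝ) = 0))
  obtain ⟨k, hk, -⟩ := exists_polynomial_lift hs hne (heig v)
  refine ⟨k, by linarith, fun b => ?_⟩
  by_cases hb : φ b = 0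
  · refine ⟨_, PolyLT.zero _, fun w => ?_⟩
    have h1 : φ b w = 0 := by rw [hb]; rfl
    exact h1.symm
  · obtain ⟨j, hj, ⟨p, hp, hpe, -⟩, -⟩ := exists_polynomial_lift hs hb (heig b)
    have hjk : j = k := by
      rw [hk] at hj
      exact_mod_cast hj.symm
    refine ⟨p, hjk ▸ hp, fun w => ?_⟩
    exact congrArg (fun f => f w) hpe

/-- The operators `reflSum (freezingWeightDeriv s v)` raise the degree by less than the Hessian
eigenvalue. -/
theorem exists_reflSum_freezingWeightDeriv (hs : R.IsCritical s) {v : EuclideanSpace ℝ (Fin N)}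
    {h : ℝ} (hv : R.hess s v = h • v) {k : ℕ}
    (hk : ∀ b : EuclideanSpace ℝ (Fin N), ∃ p, PolyLT (k + 1) p ∧
      ∀ w : R.weylGroup, p (w.1 s) = inner ℝ b (w.1 v))
    {ψ : EuclideanSpace ℝ R.weylGroup} (hψ : ψ ≠ 0) {e : ℕ}
    (he : R.reflSum (freezingWeight s) ψ = (e : ℝ) • ψ) :
    ∃ q, PolyLT (k + e) q ∧ R.reflSum (freezingWeightDeriv s v) ψ = R.orbitEval s q := by
  obtain ⟨e', he', ⟨p, hp, hpe, hpr⟩, -⟩ := exists_polynomial_lift hs hψ he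
  obtain rfl : e = e' := by exact_mod_cast he'
  choose P hP hPe using hk
  set b := EuclideanSpace.basisFun (Fin N) ℝ
  set g : EuclideanSpace ℝ (Fin N) → ℝ := fun x => ∑ i, P (b i) x * fderiv ℝ p x (b i) with hg
  have hgp : PolyLT (k + e) g := PolyLT.sum _ fun i _ => (hP (b i)).mul (hp.fderiv_pred (b i))
  have hga : R.orbitGrad s p v = R.orbitEval s g := by
    ext w
    rw [orbitGrad_apply, orbitEval_apply, hg]
    simp only [hPe]
    conv_lhs => rw [← b.sum_repr' (w.1 v), map_sum]
    simp only [map_smul, smul_eq_mul]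
  obtain ⟨q, hq, hqe⟩ := hgp.exists_radialOp (R := R)
  have h1 := orbitGrad_hess hs hp hpr v
  rw [hpe, hv] at h1
  have h2 : R.orbitGrad s p (h • v) = h • R.orbitGrad s p v := by
    ext w
    simp only [orbitGrad_apply, PiLp.smul_apply, map_smul]
  rw [h2, hga, reflSum_orbitEval hs hqe] at h1
  refine ⟨_, (hgp.const_mul (h + (((k + e : ℕ) : ℝ) - 1) - e)).add (hq.mono (Nat.sub_le _ _)), ?_⟩
  rw [← h1]
  ext w
  simp only [PiLp.sub_apply, PiLp.add_apply, PiLp.smul_apply, smul_eq_mul, orbitEval_apply]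
  ring

/-- The positivity behind the sign of the first-order correction. -/
theorem inner_reflSum_orbitGrad_nonneg (hs : R.IsCritical s) {v : EuclideanSpace ℝ (Fin N)}
    (hv0 : v ≠ 0) {h : ℝ} (hv : R.hess s v = h • v) {φ : EuclideanSpace ℝ R.weylGroup} {m : ℕ}
    (hφ : ∀ q, PolyLT m q → (inner ℝ φ (R.orbitEval s q) : ℝ) = 0)
    {n : ℕ} {p : EuclideanSpace ℝ (Fin N) → ℝ} (hp : PolyLT n p) (hpe : R.orbitEval s p = φ)
    (hpr : ∀ x, (∀ α ∈ R.posRoots, (inner ℝ α x : ℝ) ≠ 0) → R.radialOp p x = m * p x) :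
    0 ≤ (inner ℝ (R.reflSum (freezingWeightDeriv s v) φ) (R.orbitGrad s p v) : ℝ) ∧
    ((inner ℝ (R.reflSum (freezingWeightDeriv s v) φ) (R.orbitGrad s p v) : ℝ) = 0 →
      R.reflSum (freezingWeightDeriv s v) φ = 0) := by
  obtain ⟨k, hk, hkb⟩ := exists_polynomial_inner_map hs hv0 hv
  set a := R.orbitGrad s p v with ha
  set Bφ := R.reflSum (freezingWeightDeriv s v) φ with hB
  have hsym := reflSum_isSymmetric (R := R) (freezingWeight s)
  have h1 := orbitGrad_hess hs hp hpr v
  have h2 : R.orbitGrad s p (R.hess s v) = h • a := by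
    ext w
    simp only [ha, orbitGrad_apply, PiLp.smul_apply, hv, map_smul]
  rw [hpe, h2, ← ha, ← hB] at h1
  set b := hsym.eigenvectorBasis (n := Module.finrank ℝ (EuclideanSpace ℝ R.weylGroup)) rfl
  have hterm : ∀ i, 0 ≤ inner ℝ Bφ (b i) * inner ℝ (b i) a ∧
      (inner ℝ Bφ (b i) * inner ℝ (b i) a = 0 → inner ℝ Bφ (b i) = 0) := by
    intro i
    have hb0 : b i ≠ 0 := fun h0 => by
      have := b.orthonormal.1 i
      rw [h0, norm_zero] at this
      exact zero_ne_one this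
    have hbe : R.reflSum (freezingWeight s) (b i) = (hsym.eigenvalues rfl i : ℝ) • b i :=
      hsym.apply_eigenvectorBasis rfl i
    obtain ⟨e, he, -, -⟩ := exists_polynomial_lift hs hb0 hbe
    rw [he] at hbe
    have h3 : inner ℝ Bφ (b i) = (h + e - m) * inner ℝ (b i) a := by
      rw [← h1, inner_sub_left, inner_add_left, real_inner_smul_left, real_inner_smul_left,
        hsym a (b i), hbe, real_inner_smul_right, real_inner_comm]
      ring
    rcases le_or_gt 0 (h + e - m) with h4 | h4
    · rw [h3]
      refine ⟨by rw [mul_assoc]; exact mul_nonneg h4 (mul_self_nonneg _), fun h5 => ?_⟩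
      rcases mul_eq_zero.1 h5 with h6 | h6
      · exact h6
      · rw [h6, mul_zero]
    · obtain ⟨q, hq, hqe⟩ := exists_reflSum_freezingWeightDeriv hs hv hkb hb0 hbe
      have hkm : k + e ≤ m := by
        have : (k : ℝ) + e ≤ m := by linarith
        exact_mod_cast this
      have h5 : inner ℝ Bφ (b i) = (0 : ℝ) := by
        rw [hB, reflSum_isSymmetric _ φ (b i), hqe]
        exact hφ q (hq.mono hkm)
      rw [h5]
      simp
  have hsum := b.sum_inner_mul_inner Bφ a
  refine ⟨by rw [← hsum]; exact Finset.sum_nonneg fun i _ => (hterm i).1, fun h0 => ?_⟩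
  rw [← hsum, Finset.sum_eq_zero_iff_of_nonneg fun i _ => (hterm i).1] at h0
  rw [← b.sum_repr' Bφ]
  refine Finset.sum_eq_zero fun i _ => ?_
  rw [real_inner_comm, (hterm i).2 (h0 i (Finset.mem_univ i)), zero_smul]

/-- With `V w` the inverse Hessian applied to the gradient of `u ↦ p (w u)` at `s`, the leading
correction to the Rayleigh quotient of `φ` is strictly positive: in an eigenbasis of the Hessian
it is a sum of the nonnegative terms of `inner_reflSum_orbitGrad_nonneg`, and their vanishing
would contradict the action of the operator for the direction `s` itself. -/
theorem exists_hess_inverse_gradient (hs : R.IsCritical s) {φ : EuclideanSpace ℝ R.weylGroup}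
    (hφ0 : φ ≠ 0) {m : ℕ} (hm : 0 < m)
    (hφe : R.reflSum (freezingWeight s) φ = (m : ℝ) • φ)
    (hφ : ∀ q, PolyLT m q → (inner ℝ φ (R.orbitEval s q) : ℝ) = 0)
    {n : ℕ} {p : EuclideanSpace ℝ (Fin N) → ℝ} (hp : PolyLT n p) (hpe : R.orbitEval s p = φ)
    (hpr : ∀ x, (∀ α ∈ R.posRoots, (inner ℝ α x : ℝ) ≠ 0) → R.radialOp p x = m * p x) :
    ∃ V : R.weylGroup → EuclideanSpace ℝ (Fin N),
      (∀ w z, inner ℝ (R.hess s (V w)) z = fderiv ℝ p (w.1 s) (w.1 z)) ∧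
      0 < ∑ w, R.reflSum (freezingWeightDeriv s (V w)) φ w := by
  have hsym := hess_isSymmetric (R := R) (s := s)
  set b := hsym.eigenvectorBasis (n := Module.finrank ℝ (EuclideanSpace ℝ (Fin N))) rfl
  set h := hsym.eigenvalues (n := Module.finrank ℝ (EuclideanSpace ℝ (Fin N))) rfl
  have hbe : ∀ i, R.hess s (b i) = h i • b i := fun i => hsym.apply_eigenvectorBasis rfl i
  have hb1 : ∀ i, ‖b i‖ = 1 := b.orthonormal.1
  have hb0 : ∀ i, b i ≠ 0 := fun i h0 => by
    have := hb1 i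
    rw [h0, norm_zero] at this
    exact zero_ne_one this
  have hh : ∀ i, 0 < h i := fun i => by
    have := norm_sq_le_inner_hess (R := R) (s := s) (b i)
    rw [hbe, real_inner_smul_left, real_inner_self_eq_norm_sq, hb1] at this
    linarith
  have hBlin : ∀ (c : _ → ℝ) (w : R.weylGroup),
      R.reflSum (freezingWeightDeriv s (∑ i, c i • b i)) φ w =
      ∑ i, c i * R.reflSum (freezingWeightDeriv s (b i)) φ w := by
    intro c w
    simp only [reflSum_apply, Finset.mul_sum]
    rw [Finset.sum_comm]
    refine Finset.sum_congr rfl fun α _ => ?_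
    simp only [freezingWeightDeriv, inner_sum, real_inner_smul_right, Finset.mul_sum,
      Finset.sum_mul]
    exact Finset.sum_congr rfl fun i _ => by ring
  refine ⟨fun w => ∑ i, ((h i)⁻¹ * R.orbitGrad s p (b i) w) • b i, fun w z => ?_, ?_⟩
  · simp only [map_sum, map_smul, hbe, smul_smul, sum_inner, real_inner_smul_left]
    conv_rhs => rw [← b.sum_repr' z, map_sum, map_sum]
    refine Finset.sum_congr rfl fun i _ => ?_
    rw [map_smul, map_smul, smul_eq_mul, orbitGrad_apply]
    have := (hh i).ne'
    field_simp
  · have hterm := fun i => inner_reflSum_orbitGrad_nonneg hs (hb0 i) (hbe i) hφ hp hpe hpr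
    have heq : ∑ w, R.reflSum (freezingWeightDeriv s
        (∑ i, ((h i)⁻¹ * R.orbitGrad s p (b i) w) • b i)) φ w =
        ∑ i, (h i)⁻¹ * (inner ℝ (R.reflSum (freezingWeightDeriv s (b i)) φ)
          (R.orbitGrad s p (b i)) : ℝ) := by
      simp only [hBlin, inner_eq_sum, Finset.mul_sum]
      rw [Finset.sum_comm]
      exact Finset.sum_congr rfl fun i _ => Finset.sum_congr rfl fun w _ => by ring
    rw [heq]
    have hnn : ∀ i ∈ Finset.univ, 0 ≤ (h i)⁻¹ * (inner ℝ (R.reflSum (freezingWeightDeriv s (b i)) φ)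
          (R.orbitGrad s p (b i)) : ℝ) := fun i _ => mul_nonneg (inv_pos.2 (hh i)).le (hterm i).1
    refine lt_of_le_of_ne (Finset.sum_nonneg hnn) fun h0 => ?_
    have h1 := (Finset.sum_eq_zero_iff_of_nonneg hnn).1 h0.symm
    have hz : ∀ i, R.reflSum (freezingWeightDeriv s (b i)) φ = 0 := fun i =>
      (hterm i).2 ((mul_eq_zero.1 (h1 i (Finset.mem_univ i))).resolve_left (inv_pos.2 (hh i)).ne')
    -- the direction `s` gives twice the frozen generator, whose value on `φ` is not zero
    have hs2 : ∀ w, R.reflSum (freezingWeightDeriv s s) φ w = 2 * (m * φ w) := by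
      intro w
      have := congrArg (fun f => f w) hφe
      simp only [PiLp.smul_apply, smul_eq_mul] at this
      rw [← this, reflSum_apply, reflSum_apply, Finset.mul_sum]
      refine Finset.sum_congr rfl fun α hα => ?_
      rw [freezingWeightDeriv, scaledRoot, real_inner_smul_left,
        inv_mul_cancel₀ (hs.inner_pos hα).ne']
      ring
    refine hφ0 ?_
    ext w
    have h2 := hs2 w
    have h4 := hBlin (fun i => inner ℝ (b i) s) w
    rw [b.sum_repr' s] at h4
    rw [h4] at h2
    simp only [hz, PiLp.zero_apply, mul_zero, Finset.sum_const_zero] at h2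
    have hm' : (m : ℝ) ≠ 0 := by exact_mod_cast hm.ne'
    rcases mul_eq_zero.1 h2.symm with h3 | h3
    · norm_num at h3
    · exact (mul_eq_zero.1 h3).resolve_left hm'

end DunklRootSystem

namespace DunklRootSystem

variable {N : ℕ} {R : DunklRootSystem N} {s : EuclideanSpace ℝ (Fin N)}

/-! ### The first-order correction on an eigenfunction of the frozen generator -/

variable (R) in
/-- The mean of `((α · s) / (α · u))²` under the Gibbs measure. -/
noncomputable def meanSq (s : EuclideanSpace ℝ (Fin N)) (β : ℝ) (α : EuclideanSpace ℝ (Fin N)) :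
    ℝ :=
  ∫ u, (1 - relDev s α u) ^ 2 ∂(R.gibbsMeasure β)

theorem integrable_sq_mul {β : ℝ} (hβ : 2 < β) {g : EuclideanSpace ℝ (Fin N) → ℝ}
    (hg : g.HasTemperateGrowth) {α : EuclideanSpace ℝ (Fin N)} (hα : α ∈ R.posRoots) :
    Integrable (fun u => (1 - relDev s α u) ^ 2 * g u) (R.gibbsMeasure β) := by
  refine (((integrable_of_temperate (by linarith) hg).fun_add
    (integrable_mul_relDev_mul_relDev (s := s) hβ hg hα hα)).fun_sub
    ((integrable_mul_relDev (s := s) (by linarith : 1 < β) hg hα).const_mul 2)).congr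
    (Eventually.of_forall fun u => ?_)
  simp only
  ring

theorem _root_.PolyLT.fderiv_comp {n : ℕ} {p : EuclideanSpace ℝ (Fin N) → ℝ} (hp : PolyLT n p)
    (w : EuclideanSpace ℝ (Fin N) ≃ₗᵢ[ℝ] EuclideanSpace ℝ (Fin N))
    (x z : EuclideanSpace ℝ (Fin N)) :
    fderiv ℝ (fun x => p (w x)) x z = fderiv ℝ p (w x) (w z) := by
  have h := (hp.differentiableAt (w x)).hasFDerivAt.comp x
    (w.toContinuousLinearEquiv.toContinuousLinearMap.hasFDerivAt (x := x))
  have h2 : HasFDerivAt (fun x => p (w x)) _ x := h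
  rw [h2.fderiv]
  rfl

/-- The polynomial `Δp`. -/
noncomputable def _root_.polyLaplacian {N : ℕ} (p : EuclideanSpace ℝ (Fin N) → ℝ)
    (x : EuclideanSpace ℝ (Fin N)) : ℝ :=
  ∑ i, fderiv ℝ (fun x => fderiv ℝ p x (EuclideanSpace.basisFun (Fin N) ℝ i)) x
    (EuclideanSpace.basisFun (Fin N) ℝ i)

theorem _root_.PolyLT.polyLaplacian {n : ℕ} {p : EuclideanSpace ℝ (Fin N) → ℝ}
    (hp : PolyLT n p) : PolyLT (n - 1 - 1) (polyLaplacian p) :=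
  PolyLT.sum _ fun _ _ => (hp.fderiv_pred _).fderiv_pred _

/-- Integration by parts: the drift term of the generator has mean `β⁻¹ E[Δp]`. -/
theorem integral_force (hs : R.IsCritical s) {β : ℝ} (hβ : 1 < β) {n : ℕ}
    {p : EuclideanSpace ℝ (Fin N) → ℝ} (hp : PolyLT n p) (w : R.weylGroup) :
    Integrable (fun u => fderiv ℝ p (w.1 u) (w.1 (u -
      ∑ α ∈ R.posRoots, (inner ℝ α u : ℝ)⁻¹ • α))) (R.gibbsMeasure β) ∧
    ∫ u, fderiv ℝ p (w.1 u) (w.1 (u - ∑ α ∈ R.posRoots, (inner ℝ α u : ℝ)⁻¹ • α))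
      ∂(R.gibbsMeasure β) = β⁻¹ * ∫ u, polyLaplacian p (w.1 u) ∂(R.gibbsMeasure β) := by
  have hβ0 : 0 < β := by linarith
  set b := EuclideanSpace.basisFun (Fin N) ℝ with hb
  set f : Fin N → EuclideanSpace ℝ (Fin N) → ℝ := fun i u => fderiv ℝ p (w.1 u) (b i) with hf
  have hfp : ∀ i, PolyLT (n - 1) (f i) := fun i => (hp.fderiv_pred (b i)).comp_isometry w.1
  have hae : (fun u => fderiv ℝ p (w.1 u) (w.1 (u -
      ∑ α ∈ R.posRoots, (inner ℝ α u : ℝ)⁻¹ • α))) =ᵐ[R.gibbsMeasure β]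
      fun u => ∑ i, f i u * (inner ℝ (u - s) (w.1.symm (b i)) +
        ∑ α ∈ R.posRoots, relDev s α u * inner ℝ (scaledRoot s α) (w.1.symm (b i))) := by
    filter_upwards [ae_mem_openChamber hβ0] with u hu
    conv_lhs => rw [← b.sum_repr' (w.1 (u - ∑ α ∈ R.posRoots, (inner ℝ α u : ℝ)⁻¹ • α)), map_sum]
    refine Finset.sum_congr rfl fun i _ => ?_
    rw [map_smul, smul_eq_mul, mul_comm, ← force_eq hs hu]
    congr 1
    rw [← w.1.symm.inner_map_map, w.1.symm_apply_apply, real_inner_comm, inner_sub_left, sum_inner]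
    congr 1
    refine Finset.sum_congr rfl fun α _ => ?_
    rw [real_inner_smul_left]
    ring
  have hint : ∀ i, Integrable (fun u => f i u * (inner ℝ (u - s) (w.1.symm (b i)) +
        ∑ α ∈ R.posRoots, relDev s α u * inner ℝ (scaledRoot s α) (w.1.symm (b i))))
        (R.gibbsMeasure β) := fun i => by
    have ht := (hfp i).temperate
    have i1 : Integrable (fun u => f i u * inner ℝ (u - s) (w.1.symm (b i))) (R.gibbsMeasure β) :=
      integrable_of_temperate hβ0 (by fun_prop)
    refine (i1.fun_add (integrable_finsetSum R.posRoots fun α hα =>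
      (integrable_mul_relDev (s := s) hβ ht hα).mul_const
        (inner ℝ (scaledRoot s α) (w.1.symm (b i))))).congr (Eventually.of_forall fun u => ?_)
    simp only [mul_add, Finset.mul_sum, mul_assoc]
  refine ⟨(integrable_finsetSum Finset.univ fun i _ => hint i).congr hae.symm, ?_⟩
  rw [integral_congr_ae hae, integral_finsetSum _ fun i _ => hint i]
  have hfp2 : ∀ i, PolyLT (n - 1 - 1)
      (fun u => fderiv ℝ (fun x => fderiv ℝ p x (b i)) (w.1 u) (b i)) := fun i =>
    ((hp.fderiv_pred (b i)).fderiv_pred (b i)).comp_isometry w.1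
  have hL : ∫ u, polyLaplacian p (w.1 u) ∂(R.gibbsMeasure β) =
      ∑ i, ∫ u, fderiv ℝ (fun x => fderiv ℝ p x (b i)) (w.1 u) (b i) ∂(R.gibbsMeasure β) := by
    rw [← integral_finsetSum]
    · rfl
    · exact fun i _ => integrable_of_temperate hβ0 (hfp2 i).temperate
  rw [hL, Finset.mul_sum]
  refine Finset.sum_congr rfl fun i _ => ?_
  rw [integral_deriv hs hβ (hfp i).temperate (hfp2 i).temperate (w.1.symm (b i)), ← mul_assoc,
    inv_mul_cancel₀ hβ0.ne', one_mul]
  intro u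
  have h1 := ((hfp i).differentiableAt u).hasFDerivAt.hasLineDerivAt (w.1.symm (b i))
  have h2 := (hp.fderiv_pred (b i)).fderiv_comp w.1 u (w.1.symm (b i))
  rw [w.1.apply_symm_apply] at h2
  rwa [h2] at h1

theorem sum_mul_sub_reflElt (α : EuclideanSpace ℝ (Fin N)) (φ g : R.weylGroup → ℝ) :
    ∑ w, φ w * (g w - g (w * R.reflElt α)) = ∑ w, (φ w - φ (w * R.reflElt α)) * g w := by
  have h := sum_mul_reflElt α fun w => φ w * g (w * R.reflElt α)
  simp only [mul_assoc, reflElt_mul_self, mul_one] at h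
  simp only [mul_sub, sub_mul, Finset.sum_sub_distrib]
  rw [h]

/-- The exact identity from which the first-order correction is read off. -/
theorem inner_reflSum_meanSq (hs : R.IsCritical s) {β : ℝ} (hβ : 2 < β)
    {φ : EuclideanSpace ℝ R.weylGroup} {m : ℝ}
    (hφe : R.reflSum (freezingWeight s) φ = m • φ)
    {n : ℕ} {p : EuclideanSpace ℝ (Fin N) → ℝ} (hp : PolyLT n p)
    (hpr : ∀ x, (∀ α ∈ R.posRoots, (inner ℝ α x : ℝ) ≠ 0) → R.radialOp p x = m * p x) :
    (inner ℝ φ (R.reflSum (fun α => freezingWeight s α * R.meanSq s β α) φ) : ℝ) -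
      m * inner ℝ φ φ =
    -(β⁻¹ * ∑ w, φ w * ∫ u, polyLaplacian p (w.1 u) ∂(R.gibbsMeasure β)) -
      ∑ w, ∑ α ∈ R.posRoots, freezingWeight s α * (φ w - φ (w * R.reflElt α)) *
        ∫ u, ((1 - relDev s α u) ^ 2 - 1) * (p (w.1 u) - φ w) ∂(R.gibbsMeasure β) := by
  have hβ0 : 0 < β := by linarith
  have := isProbabilityMeasure_gibbsMeasure (R := R) hβ0
  have hpt : ∀ w : R.weylGroup, (fun u => p (w.1 u)).HasTemperateGrowth := fun w =>
    (hp.comp_isometry w.1).temperate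
  have hpi : ∀ w : R.weylGroup, Integrable (fun u => p (w.1 u)) (R.gibbsMeasure β) := fun w =>
    integrable_of_temperate hβ0 (hpt w)
  have hpsq : ∀ (w : R.weylGroup), ∀ α ∈ R.posRoots,
      Integrable (fun u => (1 - relDev s α u) ^ 2 * p (w.1 u)) (R.gibbsMeasure β) :=
    fun w α hα => integrable_sq_mul hβ (hpt w) hα
  set G : EuclideanSpace ℝ (Fin N) → R.weylGroup → ℝ := fun α w =>
    ∫ u, (1 - relDev s α u) ^ 2 * p (w.1 u) ∂(R.gibbsMeasure β) with hG
  have h1 : ∀ w : R.weylGroup, β⁻¹ * ∫ u, polyLaplacian p (w.1 u) ∂(R.gibbsMeasure β) +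
      ∑ α ∈ R.posRoots, freezingWeight s α * (G α w - G α (w * R.reflElt α)) =
      m * ∫ u, p (w.1 u) ∂(R.gibbsMeasure β) := by
    intro w
    obtain ⟨hi, he⟩ := integral_force hs (by linarith : 1 < β) hp w
    rw [← he, ← integral_const_mul]
    have h2 : ∀ α ∈ R.posRoots, freezingWeight s α * (G α w - G α (w * R.reflElt α)) =
        ∫ u, freezingWeight s α * ((1 - relDev s α u) ^ 2 * p (w.1 u) -
          (1 - relDev s α u) ^ 2 * p ((w * R.reflElt α).1 u)) ∂(R.gibbsMeasure β) := by
      intro α hα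
      rw [integral_const_mul, integral_sub (hpsq w α hα) (hpsq _ α hα)]
    rw [Finset.sum_congr rfl h2, ← integral_finsetSum _ fun α hα =>
      ((hpsq w α hα).fun_sub (hpsq _ α hα)).const_mul _, ← integral_add hi
      (integrable_finsetSum _ fun α hα => ((hpsq w α hα).fun_sub (hpsq _ α hα)).const_mul _)]
    refine integral_congr_ae ?_
    filter_upwards [ae_mem_openChamber hβ0] with u hu
    rw [← hpr _ fun α hα => inner_map_ne_zero hu w hα, radialOp_map]
    congr 1
    refine Finset.sum_congr rfl fun α hα => ?_
    have h3 := one_sub_relDev hs hα hu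
    have h4 := (hs.inner_pos hα).ne'
    have h5 : (1 - relDev s α u) = inner ℝ α s * (inner ℝ α u : ℝ)⁻¹ := by
      rw [h3, mul_inv_cancel_left₀ h4]
    rw [h5, freezingWeight]
    field_simp
  have h6 : ∀ w : R.weylGroup, ∀ α ∈ R.posRoots,
      ∫ u, ((1 - relDev s α u) ^ 2 - 1) * (p (w.1 u) - φ w) ∂(R.gibbsMeasure β) =
        G α w - ∫ u, p (w.1 u) ∂(R.gibbsMeasure β) - φ w * R.meanSq s β α + φ w := by
    intro w α hα
    have i1 : Integrable (fun u => (1 - relDev s α u) ^ 2) (R.gibbsMeasure β) := by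
      simpa using integrable_sq_mul (s := s) hβ (g := fun _ => 1) (by fun_prop) hα
    have h7 : (fun u => ((1 - relDev s α u) ^ 2 - 1) * (p (w.1 u) - φ w)) = fun u =>
        (1 - relDev s α u) ^ 2 * p (w.1 u) - p (w.1 u) - φ w * (1 - relDev s α u) ^ 2 + φ w := by
      funext u; ring
    rw [h7, integral_add ((((hpsq w α hα).fun_sub (hpi w))).fun_sub (i1.const_mul _))
      (integrable_const _), integral_sub ((hpsq w α hα).fun_sub (hpi w)) (i1.const_mul _),
      integral_sub (hpsq w α hα) (hpi w), integral_const_mul]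
    simp [hG, meanSq]
  have h8 : ∑ w, ∑ α ∈ R.posRoots, freezingWeight s α * (φ w - φ (w * R.reflElt α)) *
        ∫ u, ((1 - relDev s α u) ^ 2 - 1) * (p (w.1 u) - φ w) ∂(R.gibbsMeasure β) =
      ∑ w, ∑ α ∈ R.posRoots, freezingWeight s α * ((φ w - φ (w * R.reflElt α)) * G α w) -
      ∑ w, (R.reflSum (freezingWeight s) φ w) * (∫ u, p (w.1 u) ∂(R.gibbsMeasure β)) -
      ∑ w, φ w * R.reflSum (fun α => freezingWeight s α * R.meanSq s β α) φ w +
      ∑ w, φ w * R.reflSum (freezingWeight s) φ w := by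
    rw [← Finset.sum_sub_distrib, ← Finset.sum_sub_distrib, ← Finset.sum_add_distrib]
    refine Finset.sum_congr rfl fun w _ => ?_
    rw [reflSum_apply, reflSum_apply, Finset.sum_mul, Finset.mul_sum, Finset.mul_sum,
      ← Finset.sum_sub_distrib, ← Finset.sum_sub_distrib, ← Finset.sum_add_distrib]
    refine Finset.sum_congr rfl fun α hα => ?_
    rw [h6 w α hα]
    ring
  have h9 : ∑ w, ∑ α ∈ R.posRoots, freezingWeight s α * ((φ w - φ (w * R.reflElt α)) * G α w) =
      ∑ w, φ w * ∑ α ∈ R.posRoots, freezingWeight s α * (G α w - G α (w * R.reflElt α)) := by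
    simp only [Finset.mul_sum]
    rw [Finset.sum_comm, Finset.sum_comm (s := Finset.univ (α := R.weylGroup)) (t := R.posRoots)]
    refine Finset.sum_congr rfl fun α _ => ?_
    rw [← Finset.mul_sum, ← sum_mul_sub_reflElt, Finset.mul_sum]
    exact Finset.sum_congr rfl fun w _ => by ring
  have h10 : ∑ w, φ w * ∑ α ∈ R.posRoots, freezingWeight s α * (G α w - G α (w * R.reflElt α)) =
      ∑ w, φ w * (m * ∫ u, p (w.1 u) ∂(R.gibbsMeasure β)) -
      β⁻¹ * ∑ w, φ w * ∫ u, polyLaplacian p (w.1 u) ∂(R.gibbsMeasure β) := by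
    rw [Finset.mul_sum, ← Finset.sum_sub_distrib]
    refine Finset.sum_congr rfl fun w _ => ?_
    rw [← h1 w]
    ring
  rw [h8, h9, h10, hφe, inner_eq_sum, inner_eq_sum]
  simp only [PiLp.smul_apply, smul_eq_mul, Finset.mul_sum]
  have h11 : ∑ w, m * φ w * (∫ u, p (w.1 u) ∂(R.gibbsMeasure β)) =
      ∑ w, φ w * (m * ∫ u, p (w.1 u) ∂(R.gibbsMeasure β)) :=
    Finset.sum_congr rfl fun w _ => by ring
  have h12 : ∑ w, φ w * (m * φ w) = ∑ w, m * (φ w * φ w) :=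
    Finset.sum_congr rfl fun w _ => by ring
  rw [h11, h12]
  ring

/-- The first-order correction in `β⁻¹` to the Rayleigh quotient of `φ`, in closed form. -/
theorem tendsto_mul_inner_reflSum (hs : R.IsCritical s)
    {φ : EuclideanSpace ℝ R.weylGroup} {m : ℕ}
    (hφe : R.reflSum (freezingWeight s) φ = (m : ℝ) • φ)
    (hφ : ∀ q, PolyLT m q → (inner ℝ φ (R.orbitEval s q) : ℝ) = 0)
    {p : EuclideanSpace ℝ (Fin N) → ℝ} (hp : PolyLT (m + 1) p) (hpe : R.orbitEval s p = φ)
    (hpr : ∀ x, (∀ α ∈ R.posRoots, (inner ℝ α x : ℝ) ≠ 0) → R.radialOp p x = m * p x)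
    {V : R.weylGroup → EuclideanSpace ℝ (Fin N)}
    (hV : ∀ w z, inner ℝ (R.hess s (V w)) z = fderiv ℝ p (w.1 s) (w.1 z)) :
    Tendsto (fun β : ℝ => β *
      ((inner ℝ φ (R.reflSum (fun α => freezingWeight s α * R.meanSq s β α) φ) : ℝ) -
      m * inner ℝ φ φ)) atTop (𝓝 (∑ w, R.reflSum (freezingWeightDeriv s (V w)) φ w)) := by
  have hφw : ∀ w : R.weylGroup, φ w = p (w.1 s) := fun w => by rw [← hpe]; rfl
  have h1 : Tendsto (fun β : ℝ => ∑ w, φ w * ∫ u, polyLaplacian p (w.1 u) ∂(R.gibbsMeasure β))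
      atTop (𝓝 (∑ w, φ w * polyLaplacian p (w.1 s))) := by
    refine tendsto_finsetSum _ fun w _ => Tendsto.const_mul _ ?_
    have hq := hp.polyLaplacian.comp_isometry w.1
    obtain ⟨C, K, -, hC⟩ := hq.exists_taylor s
    refine tendsto_integral_of_le hs hq.temperate
      ((InnerProductSpace.toDual ℝ _).symm (fderiv ℝ (fun x => polyLaplacian p (w.1 x)) s)) C K
      fun u => ?_
    rw [InnerProductSpace.toDual_symm_apply]
    exact hC u
  have h2 : ∑ w, φ w * polyLaplacian p (w.1 s) = 0 := by
    rw [← hφ _ (hp.polyLaplacian.mono (by omega)), inner_eq_sum]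
    rfl
  rw [h2] at h1
  have h3 : ∀ w : R.weylGroup, ∀ α ∈ R.posRoots, Tendsto (fun β : ℝ => β *
      ∫ u, ((1 - relDev s α u) ^ 2 - 1) * (p (w.1 u) - φ w) ∂(R.gibbsMeasure β)) atTop
      (𝓝 (-2 * inner ℝ (scaledRoot s α) (V w))) := by
    intro w α hα
    have hq := hp.comp_isometry w.1
    obtain ⟨C, K, hC0, hC⟩ := hq.exists_taylor s
    set D := ‖fderiv ℝ (fun x => p (w.1 x)) s‖ + 4 * C with hD
    have hCD : C ≤ D := by
      have := norm_nonneg (fderiv ℝ (fun x => p (w.1 x)) s)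
      linarith
    refine tendsto_mul_integral_sq_sub_one_mul hs hα (hq.sub (PolyLT.const m (φ w))).temperate
      (V w) (2 * D) (K + 1)
      (fun u => ?_) fun u => ?_
    · rw [hφw]
      refine (PolyLT.abs_sub_le_of_taylor (p := fun x => p (w.1 x)) hC0 (hC u)).trans ?_
      have : 0 ≤ D := hC0.trans hCD
      rw [← hD]
      gcongr
      linarith
    · rw [hφw, hV, ← hp.fderiv_comp]
      refine (hC u).trans ?_
      have hq0 : 0 ≤ ‖u - s‖ ^ 2 := by positivity
      have e1 := PolyLT.pow_le_one_add_pow hq0 (show K ≤ K + 1 by omega)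
      have e3 : (0 : ℝ) ≤ (‖u - s‖ ^ 2) ^ (K + 1) := by positivity
      calc C * (‖u - s‖ ^ 2 * (1 + (‖u - s‖ ^ 2) ^ K)) ≤
          D * (‖u - s‖ ^ 2 * (2 * (1 + (‖u - s‖ ^ 2) ^ (K + 1)))) := by
            gcongr
            linarith
        _ = _ := by ring
  have h4 : Tendsto (fun β : ℝ => ∑ w, ∑ α ∈ R.posRoots,
      freezingWeight s α * (φ w - φ (w * R.reflElt α)) * (β *
        ∫ u, ((1 - relDev s α u) ^ 2 - 1) * (p (w.1 u) - φ w) ∂(R.gibbsMeasure β))) atTop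
      (𝓝 (∑ w, ∑ α ∈ R.posRoots, freezingWeight s α * (φ w - φ (w * R.reflElt α)) *
        (-2 * inner ℝ (scaledRoot s α) (V w)))) :=
    tendsto_finsetSum _ fun w _ => tendsto_finsetSum _ fun α hα => (h3 w α hα).const_mul _
  have h5 := h1.neg.sub h4
  have h6 : -(0 : ℝ) - ∑ w, ∑ α ∈ R.posRoots, freezingWeight s α * (φ w - φ (w * R.reflElt α)) *
        (-2 * inner ℝ (scaledRoot s α) (V w)) =
      ∑ w, R.reflSum (freezingWeightDeriv s (V w)) φ w := by
    rw [neg_zero, zero_sub, ← Finset.sum_neg_distrib]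
    refine Finset.sum_congr rfl fun w _ => ?_
    rw [reflSum_apply, ← Finset.sum_neg_distrib]
    exact Finset.sum_congr rfl fun α _ => by rw [freezingWeightDeriv]; ring
  rw [h6] at h5
  refine h5.congr' ?_
  filter_upwards [eventually_gt_atTop 2] with β hβ
  have hβ0 : β ≠ 0 := by linarith
  rw [inner_reflSum_meanSq hs hβ hφe hp hpr, mul_sub, mul_neg, mul_inv_cancel_left₀ hβ0,
    Finset.mul_sum]
  congr 1
  refine Finset.sum_congr rfl fun w _ => ?_
  rw [Finset.mul_sum]
  exact Finset.sum_congr rfl fun α _ => by ring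

end DunklRootSystem

namespace DunklRootSystem

variable {N : ℕ} {R : DunklRootSystem N} {s : EuclideanSpace ℝ (Fin N)}

/-! ### The jump rates of the process started at the origin -/

/-- The value of the Dunkl kernel at `x = 0` is `1`, by its normalization. -/
theorem dunklKernel_zero_left (β : ℝ) (y : EuclideanSpace ℝ (Fin N)) : R.dunklKernel β 0 y = 1 := by
  unfold dunklKernel
  split_ifs with h
  · exact h.choose_spec.zero_left y
  · rfl

theorem weight_map {β : ℝ} (w : R.weylGroup) {x : EuclideanSpace ℝ (Fin N)}
    (hx : x ∈ R.openChamber) : R.weight β (w.1 x) = R.weight β x := by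
  have h1 : ∀ v : R.weylGroup, R.weight β (v.1 x) =
      Real.exp (∑ α ∈ R.posRoots, Real.log |(inner ℝ α (v.1 x) : ℝ)| * β) := by
    intro v
    rw [weight, Real.exp_sum]
    refine Finset.prod_congr rfl fun α hα => ?_
    rw [Real.rpow_def_of_pos (abs_pos.2 (inner_map_ne_zero hx v hα))]
  have h2 := sum_posRoots_map w.2 (g := fun α => Real.log |(inner ℝ α (w.1 x) : ℝ)| * β)
    fun α => by rw [inner_neg_left, abs_neg]
  have h3 := h1 1
  rw [h1 w, ← h2]
  simp only [w.1.inner_map_map]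
  exact h3.symm

theorem weight_mul_exp_eq_gibbs {β : ℝ} {x : EuclideanSpace ℝ (Fin N)}
    (hx : x ∈ R.chamber) :
    Real.exp (-‖x‖ ^ 2 / 2) * R.weight β x = R.gibbs 1 (fun _ => β) x := by
  rw [gibbs, weight, mul_comm]
  congr 1
  · exact Finset.prod_congr rfl fun α hα => by rw [abs_of_nonneg (hx α hα), max_eq_left (hx α hα)]
  · congr 1
    ring

theorem gibbs_eq_zero_of_notMem_chamber {β : ℝ} (hβ : 0 < β) {x : EuclideanSpace ℝ (Fin N)}
    (hx : x ∉ R.chamber) : R.gibbs 1 (fun _ => β) x = 0 :=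
  gibbs_eq_zero (fun _ _ => hβ) fun h => hx fun α hα => (h α hα).le

/-- The weight on the whole space is the sum of its transported restrictions to the chamber. -/
theorem weight_mul_exp_eq_sum {β : ℝ} (hβ : 0 < β) (x : EuclideanSpace ℝ (Fin N)) :
    Real.exp (-‖x‖ ^ 2 / 2) * R.weight β x =
      ∑ w : R.weylGroup, R.gibbs 1 (fun _ => β) (w.1 x) := by
  by_cases h : ∃ w : R.weylGroup, w.1 x ∈ R.openChamber
  · obtain ⟨w, hw⟩ := h
    rw [Finset.sum_eq_single w, ← weight_mul_exp_eq_gibbs fun α hα => (hw α hα).le,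
      w.1.norm_map, ← weight_map w⁻¹ hw]
    · congr 2
      exact (w.1.symm_apply_apply x).symm
    · intro v _ hv
      refine gibbs_eq_zero (fun _ _ => hβ) fun h1 => hv ?_
      have h2 : (v * w⁻¹).1 (w.1 x) = v.1 x := congrArg v.1 (w.1.symm_apply_apply x)
      have h3 := R.eq_one_of_map_openChamber (v * w⁻¹).2 hw (by rw [h2]; exact h1)
      exact mul_inv_eq_one.1 (Subtype.ext h3)
    · simp
  · rw [Finset.sum_eq_zero fun w _ => gibbs_eq_zero (fun _ _ => hβ) fun h1 => h ⟨w, h1⟩]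
    obtain ⟨w, hw⟩ := R.exists_map_mem_chamber x
    have h1 : ∃ α ∈ R.posRoots, (inner ℝ α (w.1 x) : ℝ) = 0 := by
      by_contra! h2
      exact h ⟨w, fun α hα => lt_of_le_of_ne (hw α hα) (h2 α hα).symm⟩
    obtain ⟨α, hα, h0⟩ := h1
    have hγ : w.1.symm α ∈ R.roots := by
      have := R.weylGroup_image_roots (R.weylGroup.inv_mem w.2)
      rw [← Finset.mem_coe, ← this]
      exact ⟨α, (R.mem_posRoots.1 hα).1, rfl⟩
    have h2 : (inner ℝ (w.1.symm α) x : ℝ) = 0 := by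
      rw [← w.1.inner_map_map, w.1.apply_symm_apply, h0]
    have h3 : ∃ γ ∈ R.posRoots, (inner ℝ γ x : ℝ) = 0 := by
      rcases R.mem_posRoots_or_neg hγ with h | h
      · exact ⟨_, h, h2⟩
      · exact ⟨_, h, by rw [inner_neg_left, h2, neg_zero]⟩
    obtain ⟨γ, hγ, h4⟩ := h3
    rw [weight, Finset.prod_eq_zero hγ, mul_zero]
    rw [h4, abs_zero, Real.zero_rpow hβ.ne']

theorem gibbs_smul {β : ℝ} (hβ : 0 < β) (u : EuclideanSpace ℝ (Fin N)) :
    R.gibbs 1 (fun _ => β) (Real.sqrt β • u) =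
      (∏ _α ∈ R.posRoots, Real.sqrt β ^ β) * R.gibbs β (fun _ => β) u := by
  have hs := Real.sqrt_nonneg β
  rw [gibbs, gibbs, ← mul_assoc, ← Finset.prod_mul_distrib]
  congr 1
  · refine Finset.prod_congr rfl fun α _ => ?_
    rw [← Real.mul_rpow hs (le_max_right _ _), real_inner_smul_right, mul_max_of_nonneg _ _ hs,
      mul_zero]
  · rw [norm_smul, mul_pow, Real.norm_of_nonneg hs, Real.sq_sqrt hβ.le]
    congr 1
    ring

theorem selbergConst_eq {β : ℝ} (hβ : 0 < β) (hi : Integrable (R.gibbs 1 fun _ => β)) :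
    R.selbergConst β = Fintype.card R.weylGroup * ∫ x, R.gibbs 1 (fun _ => β) x := by
  rw [selbergConst]
  simp only [weight_mul_exp_eq_sum hβ]
  rw [integral_finsetSum]
  · have : ∀ w : R.weylGroup, ∫ x, R.gibbs 1 (fun _ => β) (w.1 x) =
        ∫ x, R.gibbs 1 (fun _ => β) x := fun w =>
      w.1.measurePreserving.integral_comp w.1.toHomeomorph.measurableEmbedding _
    simp [this]
  · intro w _
    exact (w.1.measurePreserving.integrable_comp_emb
      w.1.toHomeomorph.measurableEmbedding).2 hi

/-- The jump rates as moments of the Gibbs measure. -/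
theorem jumpRate_eq (hs : R.IsCritical s) {β : ℝ} (hβ : 0 < β)
    {α : EuclideanSpace ℝ (Fin N)} (hα : α ∈ R.posRoots) :
    R.jumpRate β 1 α 0 = 1 / 2 * (freezingWeight s α * R.meanSq s β α) := by
  set κ : ℝ := ∏ _α ∈ R.posRoots, Real.sqrt β ^ β with hκ
  have hsβ := Real.sqrt_pos.2 hβ
  have hκ0 : 0 < κ := Finset.prod_pos fun _ _ => Real.rpow_pos_of_pos hsβ _
  have hcard : (Fintype.card R.weylGroup : ℝ) ≠ 0 := by exact_mod_cast Fintype.card_ne_zero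
  set G := R.gibbs 1 fun _ => β with hG
  set Z := ∫ u, R.gibbs β (fun _ => β) u with hZ
  have hZ0 : 0 < Z := integral_gibbs_pos hβ
  have hi : Integrable G := by
    have := integrable_mul_gibbs (R := R) (β := 1) (e := fun _ => β) one_pos (fun _ _ => hβ.le)
      (f := fun _ => 1) (by fun_prop)
    simpa using this
  set J := |((Real.sqrt β) ^ Module.finrank ℝ (EuclideanSpace ℝ (Fin N)))⁻¹| with hJ
  have hJ0 : 0 < J := by positivity
  have h1 : κ * Z = J * ∫ x, G x := by
    have := Measure.integral_comp_smul volume G (Real.sqrt β)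
    rw [smul_eq_mul, ← hJ] at this
    rw [← this, hZ, ← integral_const_mul]
    simp only [hG, gibbs_smul hβ, hκ]
  have h2 : ∀ x, R.radialDensity β 1 x 0 =
      Fintype.card R.weylGroup * (Real.exp (-‖x‖ ^ 2 / 2) * R.weight β x) / R.selbergConst β := by
    intro x
    have h3 : ∀ w : R.weylGroup, R.density β 1 x (w.1 0) =
        (Real.exp (-‖x‖ ^ 2 / 2) * R.weight β x) / R.selbergConst β := by
      intro w
      simp only [density, map_zero, smul_zero, dunklKernel_zero_left, Real.sqrt_one, inv_one,
        one_smul, norm_zero, Real.one_rpow, mul_one]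
      rw [zero_pow two_ne_zero, zero_add]
      ring
    simp only [radialDensity, h3, Finset.sum_const, Finset.card_univ, nsmul_eq_mul, mul_div_assoc]
  have h4 : ∫ x in R.chamber, 1 / (inner ℝ α x : ℝ) ^ 2 * R.radialDensity β 1 x 0 =
      Fintype.card R.weylGroup / R.selbergConst β * ∫ x, 1 / (inner ℝ α x : ℝ) ^ 2 * G x := by
    have hmeas : MeasurableSet R.chamber := by
      refine IsClosed.measurableSet ?_
      have : R.chamber = ⋂ α ∈ R.posRoots, {x | 0 ≤ (inner ℝ α x : ℝ)} := by
        ext x; simp [chamber]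
      rw [this]
      exact isClosed_biInter fun α _ => isClosed_le continuous_const (by fun_prop)
    rw [← integral_indicator hmeas, ← integral_const_mul]
    congr 1
    funext x
    by_cases hx : x ∈ R.chamber
    · rw [Set.indicator_of_mem hx, h2, weight_mul_exp_eq_gibbs hx]
      ring
    · rw [Set.indicator_of_notMem hx, hG, gibbs_eq_zero_of_notMem_chamber hβ hx]
      ring
  have h5 : κ * β⁻¹ * ∫ u, (1 / (inner ℝ α u : ℝ) ^ 2) * R.gibbs β (fun _ => β) u =
      J * ∫ x, 1 / (inner ℝ α x : ℝ) ^ 2 * G x := by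
    have := Measure.integral_comp_smul volume (fun x => 1 / (inner ℝ α x : ℝ) ^ 2 * G x)
      (Real.sqrt β)
    rw [smul_eq_mul, ← hJ] at this
    rw [← this, ← integral_const_mul]
    congr 1
    funext u
    rw [hG, gibbs_smul hβ, ← hκ, real_inner_smul_right, mul_pow, Real.sq_sqrt hβ.le]
    ring
  have h6 : R.meanSq s β α = (inner ℝ α s) ^ 2 *
      ((∫ u, (1 / (inner ℝ α u : ℝ) ^ 2) * R.gibbs β (fun _ => β) u) / Z) := by
    rw [hZ, ← integral_gibbsMeasure hβ, meanSq, ← integral_const_mul]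
    refine integral_congr_ae ?_
    filter_upwards [ae_mem_openChamber hβ] with u hu
    have h3 := one_sub_relDev hs hα hu
    have h4 := (hs.inner_pos hα).ne'
    have h5 : (1 - relDev s α u) = inner ℝ α s * (inner ℝ α u : ℝ)⁻¹ := by
      rw [h3, mul_inv_cancel_left₀ h4]
    rw [h5]
    ring
  have hI : (0 : ℝ) < ∫ x, G x := by
    have : 0 < J * ∫ x, G x := by rw [← h1]; positivity
    exact (pos_iff_pos_of_mul_pos this).1 hJ0
  have h7 := (hs.inner_pos hα).ne'
  set Q := ∫ u, (1 / (inner ℝ α u : ℝ) ^ 2) * R.gibbs β (fun _ => β) u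
  set Q' := ∫ x, 1 / (inner ℝ α x : ℝ) ^ 2 * G x
  have h8 : Q' / ∫ x, G x = β⁻¹ * (Q / Z) := by
    have e1 : Q' = κ * β⁻¹ * Q / J := by rw [h5]; field_simp
    have e2 : ∫ x, G x = κ * Z / J := by rw [h1]; field_simp
    rw [e1, e2]
    field_simp
  rw [jumpRate, h4, selbergConst_eq hβ hi, h6, freezingWeight]
  have h9 : (Fintype.card R.weylGroup : ℝ) / (Fintype.card R.weylGroup * ∫ x, G x) * Q' =
      β⁻¹ * (Q / Z) := by
    rw [← h8]
    field_simp
  rw [h9]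
  field_simp
  ring

/-! ### The transition matrix -/

open Classical in
variable (R) in
/-- The generator matrix of the walk on the group with jumps `τ → τ σ_α` at rates `c α`. -/
noncomputable def rateMatrix (c : EuclideanSpace ℝ (Fin N) → ℝ) :
    Matrix R.weylGroup R.weylGroup ℝ :=
  Matrix.of fun τ ν => ∑ α ∈ R.posRoots, c α * ((if τ.1 * dunklRefl α = ν.1 then 1 else 0) -
    (if τ = ν then 1 else 0))

theorem transitionMatrix_eq (β : ℝ) :
    R.transitionMatrix β = R.rateMatrix fun α => R.jumpRate β 1 α 0 := by
  ext τ ν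
  simp only [transitionMatrix, rateMatrix, totalRate, Matrix.of_apply, mul_sub,
    Finset.sum_sub_distrib, Finset.sum_mul]

theorem toEuclideanLin_rateMatrix (c : EuclideanSpace ℝ (Fin N) → ℝ) :
    Matrix.toEuclideanLin (R.rateMatrix c) = -R.reflSum c := by
  ext φ w
  rw [LinearMap.neg_apply, PiLp.neg_apply, reflSum_apply]
  change ∑ ν, R.rateMatrix c w ν * φ ν = _
  simp only [rateMatrix, Matrix.of_apply, Finset.sum_mul]
  rw [Finset.sum_comm, ← Finset.sum_neg_distrib]
  refine Finset.sum_congr rfl fun α hα => ?_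
  have h1 : ∀ ν : R.weylGroup, (w.1 * dunklRefl α = ν.1) ↔ w * R.reflElt α = ν := fun ν => by
    rw [← coe_reflElt hα, ← Subgroup.coe_mul, Subtype.ext_iff]
  simp only [h1, mul_assoc, sub_mul, ite_mul, one_mul, zero_mul, ← Finset.mul_sum,
    Finset.sum_sub_distrib, Finset.sum_ite_eq, Finset.mem_univ, if_true]
  ring

end DunklRootSystem

/-! ### First-order perturbation of the eigenvalues of a symmetric operator -/

namespace LinearMap.IsSymmetric

variable {E : Type*} [NormedAddCommGroup E] [InnerProductSpace ℝ E] {n : ℕ}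
  {T T₀ T₁ : E →ₗ[ℝ] E}

theorem exists_ne_zero_of_card_lt {F ι : Type*} [AddCommGroup F] [Module ℝ F]
    [FiniteDimensional ℝ F] [Fintype ι] (L : F →ₗ[ℝ] E) (ψ : ι → E)
    (h : Fintype.card ι < Module.finrank ℝ F) :
    ∃ a : F, a ≠ 0 ∧ ∀ k, (inner ℝ (ψ k) (L a) : ℝ) = 0 := by
  let G : F →ₗ[ℝ] (ι → ℝ) := LinearMap.pi fun k => (innerₛₗ ℝ (ψ k)).comp L
  have hG : G.ker ≠ ⊥ := LinearMap.ker_ne_bot_of_finrank_lt (by simpa using h)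
  obtain ⟨a, ha, ha0⟩ := Submodule.exists_mem_ne_zero_of_ne_bot hG
  exact ⟨a, ha0, fun k => congrFun (LinearMap.mem_ker.1 ha) k⟩

/-- The generator of the rotation that removes, to first order, the part of `T₁` that maps between
different eigenspaces of `T₀`. -/
theorem exists_rotation (h₁ : T₁.IsSymmetric) (φ : OrthonormalBasis (Fin n) ℝ E) {μ : Fin n → ℝ}
    (h₀ : T₀.IsSymmetric)
    (hμ : ∀ i, T₀ (φ i) = μ i • φ i)
    (hd : ∀ i j, i ≠ j → μ i = μ j → (inner ℝ (φ i) (T₁ (φ j)) : ℝ) = 0) :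
    ∃ X : E →ₗ[ℝ] E, (∀ x y, (inner ℝ (X x) y : ℝ) = -inner ℝ x (X y)) ∧
      ∀ i, T₀ (X (φ i)) - X (T₀ (φ i)) + T₁ (φ i) = (inner ℝ (φ i) (T₁ (φ i)) : ℝ) • φ i := by
  classical
  set c : Fin n → Fin n → ℝ := fun j i =>
    if μ i = μ j then 0 else inner ℝ (φ j) (T₁ (φ i)) / (μ i - μ j) with hc
  have hanti : ∀ i j, c j i = -c i j := by
    intro i j
    by_cases h : μ i = μ j
    · simp [hc, h]
    · have h2 : μ j ≠ μ i := fun h3 => h h3.symm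
      simp only [hc, if_neg h, if_neg h2]
      rw [← h₁, real_inner_comm, ← neg_sub (μ i) (μ j), div_neg, neg_neg]
  set X : E →ₗ[ℝ] E := φ.toBasis.constr ℝ fun i => ∑ j, c j i • φ j with hX
  have hXφ : ∀ i, X (φ i) = ∑ j, c j i • φ j := fun i => by
    have := φ.toBasis.constr_basis ℝ (fun i => ∑ j, c j i • φ j) i
    rwa [φ.coe_toBasis] at this
  have hin : ∀ i j, (inner ℝ (φ j) (X (φ i)) : ℝ) = c j i := fun i j => by
    rw [hXφ, inner_sum]
    simp [real_inner_smul_right, φ.inner_eq_ite]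
  have hskew : ∀ i y, (inner ℝ (X (φ i)) y : ℝ) = -inner ℝ (φ i) (X y) := by
    intro i y
    have h1 : innerₛₗ ℝ (X (φ i)) = -((innerₛₗ ℝ (φ i)).comp X) := by
      refine φ.toBasis.ext fun j => ?_
      rw [φ.coe_toBasis]
      simp only [innerₛₗ_apply_apply, LinearMap.neg_apply, LinearMap.comp_apply]
      rw [real_inner_comm, hin, hin, hanti]
    exact LinearMap.congr_fun h1 y
  refine ⟨X, fun x y => ?_, fun i => ?_⟩
  · rw [← φ.sum_repr' x, map_sum, sum_inner, sum_inner, ← Finset.sum_neg_distrib]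
    refine Finset.sum_congr rfl fun i _ => ?_
    rw [map_smul, real_inner_smul_left, real_inner_smul_left, hskew]
    ring
  · have hext : ∀ x y : E, (∀ j, (inner ℝ (φ j) x : ℝ) = inner ℝ (φ j) y) → x = y := by
      intro x y h
      rw [← φ.sum_repr' x, ← φ.sum_repr' y]
      simp only [h]
    refine hext _ _ fun j => ?_
    rw [hμ, map_smul, inner_add_right, inner_sub_right, ← h₀, hμ,
      real_inner_smul_left, real_inner_smul_right, real_inner_smul_right, hin, φ.inner_eq_ite]
    by_cases hij : j = i
    · subst hij
      simp
    · rw [if_neg hij, mul_zero]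
      by_cases h : μ i = μ j
      · rw [hd j i hij h.symm, h]
        ring
      · simp only [hc, if_neg h]
        have : μ i - μ j ≠ 0 := sub_ne_zero.2 h
        field_simp
        ring

variable [FiniteDimensional ℝ E]

theorem inner_apply_eq_sum (hT : T.IsSymmetric) (hn : Module.finrank ℝ E = n) (y : E) :
    (inner ℝ y (T y) : ℝ) =
      ∑ k, hT.eigenvalues hn k * (inner ℝ (hT.eigenvectorBasis hn k) y : ℝ) ^ 2 := by
  rw [← (hT.eigenvectorBasis hn).sum_inner_mul_inner]
  refine Finset.sum_congr rfl fun k _ => ?_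
  rw [← hT, hT.apply_eigenvectorBasis, real_inner_comm]
  simp only [RCLike.ofReal_real_eq_id, id_eq, real_inner_smul_left]
  ring

/-- One half of the Courant–Fischer principle. -/
theorem le_eigenvalues_of_forall_le (hT : T.IsSymmetric) (hn : Module.finrank ℝ E = n) (i : Fin n)
    {F : Type*} [AddCommGroup F] [Module ℝ F] [FiniteDimensional ℝ F] (L : F →ₗ[ℝ] E)
    (hL : Function.Injective L) (hF : (i : ℕ) < Module.finrank ℝ F) {c : ℝ}
    (h : ∀ a, c * ‖L a‖ ^ 2 ≤ inner ℝ (L a) (T (L a))) : c ≤ hT.eigenvalues hn i := by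
  set ψ := hT.eigenvectorBasis hn with hψ
  obtain ⟨a, ha, h0⟩ := exists_ne_zero_of_card_lt (ι := {k : Fin n // k < i}) L (fun k => ψ k)
    (by
      rw [Fintype.card_subtype]
      have h2 : (Finset.univ.filter fun k : Fin n => k < i) = Finset.Iio i := by ext; simp
      rwa [h2, Fin.card_Iio])
  have hy : 0 < ‖L a‖ ^ 2 := by
    have : L a ≠ 0 := fun h => ha (hL (by rw [h, map_zero]))
    positivity
  have h1 : (inner ℝ (L a) (T (L a)) : ℝ) ≤ hT.eigenvalues hn i * ‖L a‖ ^ 2 := by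
    rw [hT.inner_apply_eq_sum hn, ← ψ.sum_sq_inner_right (L a), Finset.mul_sum]
    refine Finset.sum_le_sum fun k _ => ?_
    rcases lt_or_ge k i with hk | hk
    · rw [h0 ⟨k, hk⟩]
      simp
    · exact mul_le_mul_of_nonneg_right (hT.eigenvalues_antitone hn hk) (sq_nonneg _)
  exact le_of_mul_le_mul_right ((h a).trans h1) hy

/-- The other half of the Courant–Fischer principle. -/
theorem eigenvalues_le_of_forall_le (hT : T.IsSymmetric) (hn : Module.finrank ℝ E = n) (i : Fin n)
    {F : Type*} [AddCommGroup F] [Module ℝ F] [FiniteDimensional ℝ F] (L : F →ₗ[ℝ] E)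
    (hL : Function.Injective L) (hF : n < Module.finrank ℝ F + i + 1) {c : ℝ}
    (h : ∀ a, inner ℝ (L a) (T (L a)) ≤ c * ‖L a‖ ^ 2) : hT.eigenvalues hn i ≤ c := by
  set ψ := hT.eigenvectorBasis hn with hψ
  obtain ⟨a, ha, h0⟩ := exists_ne_zero_of_card_lt (ι := {k : Fin n // i < k}) L (fun k => ψ k)
    (by
      have := i.2
      rw [Fintype.card_subtype]
      have h2 : (Finset.univ.filter fun k : Fin n => i < k) = Finset.Ioi i := by ext; simp
      rw [h2, Fin.card_Ioi]
      omega)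
  have hy : 0 < ‖L a‖ ^ 2 := by
    have : L a ≠ 0 := fun h => ha (hL (by rw [h, map_zero]))
    positivity
  have h1 : hT.eigenvalues hn i * ‖L a‖ ^ 2 ≤ (inner ℝ (L a) (T (L a)) : ℝ) := by
    rw [hT.inner_apply_eq_sum hn, ← ψ.sum_sq_inner_right (L a), Finset.mul_sum]
    refine Finset.sum_le_sum fun k _ => ?_
    rcases lt_or_ge i k with hk | hk
    · rw [h0 ⟨k, hk⟩]
      simp
    · exact mul_le_mul_of_nonneg_right (hT.eigenvalues_antitone hn hk) (sq_nonneg _)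
  exact le_of_mul_le_mul_right (h1.trans (h a)) hy

/-- An orthonormal eigenbasis of `T₀` that diagonalizes the compressions of `T₁` to the eigenspaces
of `T₀`, ordered lexicographically by the eigenvalue and the first-order correction. -/
theorem exists_adapted_basis (h₀ : T₀.IsSymmetric) (h₁ : T₁.IsSymmetric)
    (hn : Module.finrank ℝ E = n) :
    ∃ (φ : OrthonormalBasis (Fin n) ℝ E) (μ : Fin n → ℝ), (∀ i, T₀ (φ i) = μ i • φ i) ∧
      (∀ i j, i ≠ j → μ i = μ j → (inner ℝ (φ i) (T₁ (φ j)) : ℝ) = 0) ∧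
      ∀ i j, i ≤ j → μ j < μ i ∨ μ j = μ i ∧
        (inner ℝ (φ j) (T₁ (φ j)) : ℝ) ≤ inner ℝ (φ i) (T₁ (φ i)) := by
  classical
  let V : Module.End.Eigenvalues T₀ → Submodule ℝ E := fun μ =>
    Module.End.eigenspace T₀ (μ : ℝ)
  have hV : OrthogonalFamily ℝ (fun μ => V μ) fun μ => (V μ).subtypeₗᵢ :=
    h₀.orthogonalFamily_eigenspaces'
  have hVi : DirectSum.IsInternal V := h₀.direct_sum_isInternal
  let S : ∀ μ, V μ →ₗ[ℝ] V μ := fun μ =>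
    ((V μ).orthogonalProjectionOnto : E →ₗ[ℝ] V μ).comp (T₁.comp (V μ).subtype)
  have hSin : ∀ μ (x y : V μ), (inner ℝ x (S μ y) : ℝ) = inner ℝ (x : E) (T₁ y) := fun μ x y =>
    Submodule.inner_orthogonalProjectionOnto_eq_of_mem_left x (T₁ y)
  have hS : ∀ μ, (S μ).IsSymmetric := fun μ x y => by
    rw [hSin, real_inner_comm, hSin, ← h₁, real_inner_comm]
  let v : ∀ μ, OrthonormalBasis (Fin (Module.finrank ℝ (V μ))) ℝ (V μ) := fun μ =>
    (hS μ).eigenvectorBasis rfl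
  let b := hVi.collectedOrthonormalBasis hV v
  have hb : ∀ a, b a = (v a.1 a.2 : E) := fun a => by
    simp [b, DirectSum.IsInternal.collectedOrthonormalBasis]
  have hbe : ∀ a, T₀ (b a) = (a.1 : ℝ) • b a := fun a => by
    rw [hb]
    exact Module.End.mem_eigenspace_iff.1 (v a.1 a.2).2
  have hdiag : ∀ a c, a ≠ c → (a.1 : ℝ) = c.1 → (inner ℝ (b a) (T₁ (b c)) : ℝ) = 0 := by
    rintro ⟨μ, i⟩ ⟨ν, j⟩ hac he
    obtain rfl : μ = ν := Subtype.ext he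
    have hij : i ≠ j := fun h => hac (by rw [h])
    rw [hb, hb, ← hSin]
    have h3 : S μ (v μ j) = _ := (hS μ).apply_eigenvectorBasis rfl j
    rw [h3, inner_smul_right, (v μ).orthonormal.2 hij, mul_zero]
  have hcard : Fintype.card (Σ μ, Fin (Module.finrank ℝ (V μ))) = n := by
    rw [← hn, Module.finrank_eq_card_basis b.toBasis]
  let e := Fintype.equivFinOfCardEq hcard
  let f : Fin n → ℝ ×ₗ ℝ := fun i =>
    toLex (-((e.symm i).1 : ℝ), -inner ℝ (b (e.symm i)) (T₁ (b (e.symm i))))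
  let σ := Tuple.sort f
  have hσ := Tuple.monotone_sort f
  refine ⟨b.reindex (e.trans σ.symm), fun i => ((e.symm (σ i)).1 : ℝ), fun i => ?_,
    fun i j hij h => ?_, fun i j hij => ?_⟩
  · rw [OrthonormalBasis.reindex_apply]
    exact hbe _
  · rw [OrthonormalBasis.reindex_apply, OrthonormalBasis.reindex_apply]
    refine hdiag _ _ (fun h2 => hij ?_) h
    exact σ.injective (e.symm.injective h2)
  · have h3 := hσ hij
    simp only [Function.comp_apply, f] at h3
    rw [Prod.Lex.toLex_le_toLex] at h3
    rw [OrthonormalBasis.reindex_apply, OrthonormalBasis.reindex_apply]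
    rcases h3 with h4 | ⟨h4, h5⟩
    · exact Or.inl (neg_lt_neg_iff.1 h4)
    · exact Or.inr ⟨(neg_inj.1 h4).symm, neg_le_neg_iff.1 h5⟩

theorem _root_.LinearMap.exists_norm_le (A : E →ₗ[ℝ] E) : ∃ C : ℝ, 0 ≤ C ∧ ∀ x, ‖A x‖ ≤ C * ‖x‖ :=
  ⟨‖A.toContinuousLinearMap‖, norm_nonneg _, A.toContinuousLinearMap.le_opNorm⟩

/-- Approximate diagonalization in a nearly orthonormal system locates the ordered eigenvalues. -/
theorem abs_eigenvalues_sub_le (hT : T.IsSymmetric) (hn : Module.finrank ℝ E = n)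
    (φ : OrthonormalBasis (Fin n) ℝ E) {θ : Fin n → ℝ} (hθ : Antitone θ) {B δ : ℝ}
    (hB : ∀ i, |θ i| ≤ B) (hδ : 0 ≤ δ) (Y : E →ₗ[ℝ] E)
    (hY : ∀ x, |(inner ℝ (Y x) (T (Y x)) : ℝ) - ∑ k, θ k * (inner ℝ (φ k) x : ℝ) ^ 2| ≤
      δ * ‖x‖ ^ 2)
    (hY1 : ∀ x, ‖x‖ ^ 2 ≤ ‖Y x‖ ^ 2) (hY2 : ∀ x, ‖Y x‖ ^ 2 ≤ (1 + δ) * ‖x‖ ^ 2) (i : Fin n) :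
    |hT.eigenvalues hn i - θ i| ≤ (1 + B) * δ := by
  have hYinj : Function.Injective Y := by
    rw [← LinearMap.ker_eq_bot, LinearMap.ker_eq_bot']
    intro x hx
    have := hY1 x
    rw [hx, norm_zero, zero_pow two_ne_zero] at this
    exact norm_eq_zero.1 (pow_eq_zero_iff two_ne_zero |>.1 (le_antisymm this (sq_nonneg _)))
  have hli : ∀ P : Fin n → Prop, LinearIndependent ℝ fun j : {j : Fin n // P j} => φ j := fun P =>
    φ.orthonormal.linearIndependent.comp (fun j : {j : Fin n // P j} => (j : Fin n))
      Subtype.val_injective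
  have hspan : ∀ (P : Fin n → Prop) (k : Fin n), ¬P k →
      ∀ x ∈ Submodule.span ℝ (Set.range fun j : {j : Fin n // P j} => φ j),
      (inner ℝ (φ k) x : ℝ) = 0 := by
    intro P k hk x hx
    induction hx using Submodule.span_induction with
    | mem x hx =>
      obtain ⟨j, rfl⟩ := hx
      exact φ.orthonormal.2 fun h => hk (by rw [h]; exact j.2)
    | zero => exact inner_zero_right _
    | add x y _ _ h1 h2 => rw [inner_add_right, h1, h2, add_zero]
    | smul c x _ h => rw [real_inner_smul_right, h, mul_zero]
  have hθx : ∀ x, |θ i * ‖Y x‖ ^ 2 - θ i * ‖x‖ ^ 2| ≤ B * (δ * ‖Y x‖ ^ 2) := by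
    intro x
    rw [← mul_sub, abs_mul, abs_of_nonneg (sub_nonneg.2 (hY1 x))]
    have h1 := mul_le_mul_of_nonneg_left (hY1 x) hδ
    have h2 := hY2 x
    refine mul_le_mul (hB i) (by linarith) (sub_nonneg.2 (hY1 x)) ((abs_nonneg _).trans (hB i))
  rw [abs_le]
  constructor
  · have h := hT.le_eigenvalues_of_forall_le hn i (c := θ i - (1 + B) * δ)
      (Y.comp (Submodule.span ℝ (Set.range fun j : {j : Fin n // j ≤ i} => φ j)).subtype)
      (hYinj.comp Subtype.val_injective) (by
        have h2 : (Finset.univ.filter fun k : Fin n => k ≤ i) = Finset.Iic i := by ext; simp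
        rw [finrank_span_eq_card (hli _), Fintype.card_subtype, h2, Fin.card_Iic]
        omega) (by
        rintro ⟨x, hx⟩
        simp only [LinearMap.comp_apply, Submodule.subtype_apply]
        have h1 : θ i * ‖x‖ ^ 2 ≤ ∑ k, θ k * (inner ℝ (φ k) x : ℝ) ^ 2 := by
          rw [← φ.sum_sq_inner_right x, Finset.mul_sum]
          refine Finset.sum_le_sum fun k _ => ?_
          by_cases hk : k ≤ i
          · exact mul_le_mul_of_nonneg_right (hθ hk) (sq_nonneg _)
          · rw [hspan _ k hk x hx]
            simp
        have h2 := (abs_le.1 (hY x)).1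
        have h3 := (abs_le.1 (hθx x)).2
        have h4 := mul_le_mul_of_nonneg_left (hY1 x) hδ
        linarith)
    linarith
  · have h := hT.eigenvalues_le_of_forall_le hn i (c := θ i + (1 + B) * δ)
      (Y.comp (Submodule.span ℝ (Set.range fun j : {j : Fin n // i ≤ j} => φ j)).subtype)
      (hYinj.comp Subtype.val_injective) (by
        have h2 : (Finset.univ.filter fun k : Fin n => i ≤ k) = Finset.Ici i := by ext; simp
        rw [finrank_span_eq_card (hli _), Fintype.card_subtype, h2, Fin.card_Ici]
        omega) (by
        rintro ⟨x, hx⟩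
        simp only [LinearMap.comp_apply, Submodule.subtype_apply]
        have h1 : ∑ k, θ k * (inner ℝ (φ k) x : ℝ) ^ 2 ≤ θ i * ‖x‖ ^ 2 := by
          rw [← φ.sum_sq_inner_right x, Finset.mul_sum]
          refine Finset.sum_le_sum fun k _ => ?_
          by_cases hk : i ≤ k
          · exact mul_le_mul_of_nonneg_right (hθ hk) (sq_nonneg _)
          · rw [hspan _ k hk x hx]
            simp
        have h2 := (abs_le.1 (hY x)).2
        have h3 := (abs_le.1 (hθx x)).1
        have h4 := mul_le_mul_of_nonneg_left (hY1 x) hδ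
        linarith)
    linarith

/-- First-order perturbation theory, with the ordering of the eigenvalues taken into account. -/
theorem exists_eigenvalues_expansion (h₀ : T₀.IsSymmetric) (h₁ : T₁.IsSymmetric)
    {T : ℝ → E →ₗ[ℝ] E} (hT : ∀ β, (T β).IsSymmetric) (hn : Module.finrank ℝ E = n) {C : ℝ}
    (hC : ∀ᶠ β in atTop, ∀ x, |(inner ℝ x (T β x) : ℝ) - inner ℝ x (T₀ x) -
      β⁻¹ * inner ℝ x (T₁ x)| ≤ C * β⁻¹ ^ 2 * ‖x‖ ^ 2) :
    ∃ φ : OrthonormalBasis (Fin n) ℝ E, (∀ i, T₀ (φ i) = h₀.eigenvalues hn i • φ i) ∧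
      ∃ K : ℝ, ∀ᶠ β in atTop, ∀ i, |(hT β).eigenvalues hn i - h₀.eigenvalues hn i -
        β⁻¹ * inner ℝ (φ i) (T₁ (φ i))| ≤ K * β⁻¹ ^ 2 := by
  obtain ⟨φ, μ, hμ, hd, hsort⟩ := exists_adapted_basis h₀ h₁ hn
  obtain ⟨X, hskew, hcomm⟩ := exists_rotation h₁ φ h₀ hμ hd
  set ρ : Fin n → ℝ := fun i => inner ℝ (φ i) (T₁ (φ i)) with hρ
  obtain ⟨c₀, hc₀, b₀⟩ := T₀.exists_norm_le
  obtain ⟨c₁, hc₁, b₁⟩ := T₁.exists_norm_le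
  obtain ⟨c, hc, b⟩ := X.exists_norm_le
  -- the quadratic form of an operator that is diagonal in the basis `φ`
  have hdiag : ∀ (A : E →ₗ[ℝ] E) (θ : Fin n → ℝ), (∀ i, A (φ i) = θ i • φ i) → ∀ x,
      (inner ℝ x (A x) : ℝ) = ∑ k, θ k * (inner ℝ (φ k) x : ℝ) ^ 2 := by
    intro A θ hA x
    conv_lhs => rw [← φ.sum_repr' x, map_sum, φ.sum_repr' x, inner_sum]
    refine Finset.sum_congr rfl fun k _ => ?_
    rw [map_smul, hA, real_inner_smul_right, real_inner_smul_right, real_inner_comm]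
    ring
  have hanti : Antitone μ := fun i j hij => by
    rcases hsort i j hij with h | h
    · exact h.le
    · exact h.1.le
  set B := ∑ i, (|μ i| + |ρ i|) with hB
  have hBi : ∀ i, |μ i| + |ρ i| ≤ B := fun i =>
    Finset.single_le_sum (f := fun i => |μ i| + |ρ i|) (fun i _ => by positivity)
      (Finset.mem_univ i)
  have hμeq : ∀ i, h₀.eigenvalues hn i = μ i := by
    intro i
    have h := h₀.abs_eigenvalues_sub_le hn φ hanti (B := B) (δ := 0)
      (fun i => (le_add_of_nonneg_right (abs_nonneg _)).trans (hBi i)) le_rfl LinearMap.id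
      (fun x => by rw [LinearMap.id_apply, hdiag T₀ μ hμ]; simp) (fun x => by simp)
      (fun x => by simp) i
    rw [mul_zero] at h
    exact sub_eq_zero.1 (abs_eq_zero.1 (le_antisymm h (abs_nonneg _)))
  refine ⟨φ, fun i => by rw [hμeq, hμ], ?_⟩
  set δ₀ := |C| * (1 + c ^ 2) + (c * (c₀ * c) + c * c₁ + c₁ * c + c * (c₁ * c)) + c ^ 2 with hδ₀
  have hδ₀0 : 0 ≤ δ₀ := by positivity
  refine ⟨(1 + B) * δ₀, ?_⟩
  have hord : ∀ᶠ β : ℝ in atTop, ∀ i j, i ≤ j → μ j + β⁻¹ * ρ j ≤ μ i + β⁻¹ * ρ i := by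
    rw [eventually_all]; intro i
    rw [eventually_all]; intro j
    by_cases hij : i ≤ j
    · have hlim : ∀ k, Tendsto (fun β : ℝ => μ k + β⁻¹ * ρ k) atTop (𝓝 (μ k)) := fun k => by
        simpa using (tendsto_inv_atTop_zero.mul_const (ρ k)).const_add (μ k)
      rcases hsort i j hij with h | ⟨h1, h2⟩
      · filter_upwards [(hlim j).eventually_lt (hlim i) h] with β hβ _
        exact hβ.le
      · filter_upwards [eventually_gt_atTop 0] with β hβ _
        have := mul_le_mul_of_nonneg_left h2 (inv_pos.2 hβ).le
        rw [h1]
        linarith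
    · exact Eventually.of_forall fun β h => absurd h hij
  filter_upwards [hC, hord, eventually_ge_atTop 1] with β hCβ hordβ hβ i
  have hβ0 : 0 < β := by linarith
  set ε := β⁻¹ with hε
  have hε0 : 0 < ε := inv_pos.2 hβ0
  have hε1 : ε ≤ 1 := inv_le_one_of_one_le₀ hβ
  have hY0 : ∀ x, ‖(LinearMap.id + ε • X : E →ₗ[ℝ] E) x‖ ^ 2 = ‖x‖ ^ 2 + ε ^ 2 * ‖X x‖ ^ 2 := by
    intro x
    have h1 : (inner ℝ x (X x) : ℝ) = 0 := by
      have := hskew x x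
      rw [real_inner_comm] at this
      linarith
    change ‖x + ε • X x‖ ^ 2 = _
    rw [norm_add_sq_real, real_inner_smul_right, h1, norm_smul, mul_pow,
      Real.norm_of_nonneg hε0.le]
    ring
  have hXx : ∀ x, ‖X x‖ ^ 2 ≤ c ^ 2 * ‖x‖ ^ 2 := fun x => by
    rw [← mul_pow]
    exact pow_le_pow_left₀ (norm_nonneg _) (b x) 2
  have hε2 : ε ^ 2 ≤ 1 := pow_le_one₀ hε0.le hε1
  have key := (hT β).abs_eigenvalues_sub_le hn φ (θ := fun i => μ i + ε * ρ i) (B := B)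
    (δ := δ₀ * ε ^ 2) hordβ (fun i => ?_) (by positivity) (LinearMap.id + ε • X) (fun x => ?_)
    (fun x => ?_) (fun x => ?_) i
  · rw [hμeq]
    have e1 : (hT β).eigenvalues hn i - μ i - ε * inner ℝ (φ i) (T₁ (φ i)) =
        (hT β).eigenvalues hn i - (μ i + ε * ρ i) := by rw [hρ]; ring
    rw [e1]
    refine key.trans (le_of_eq (by ring))
  · refine (abs_add_le _ _).trans (le_trans ?_ (hBi i))
    rw [abs_mul, abs_of_pos hε0]
    exact add_le_add_right (mul_le_of_le_one_left (abs_nonneg _) hε1) _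
  · set y := (LinearMap.id + ε • X : E →ₗ[ℝ] E) x with hy
    have hyx : y = x + ε • X x := rfl
    have h1 := hCβ y
    have h2 : C * ε ^ 2 * ‖y‖ ^ 2 ≤ |C| * (1 + c ^ 2) * ε ^ 2 * ‖x‖ ^ 2 := by
      have h3 : ‖y‖ ^ 2 ≤ (1 + c ^ 2) * ‖x‖ ^ 2 := by
        rw [hy, hY0]
        have h4 := hXx x
        have h5 : ε ^ 2 * ‖X x‖ ^ 2 ≤ 1 * (c ^ 2 * ‖x‖ ^ 2) := by gcongr
        linarith
      calc C * ε ^ 2 * ‖y‖ ^ 2 ≤ |C| * ε ^ 2 * ((1 + c ^ 2) * ‖x‖ ^ 2) := by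
            gcongr
            exact le_abs_self C
        _ = _ := by ring
    have hD := hdiag (T₀ + ε • (T₀.comp X - X.comp T₀ + T₁)) (fun i => μ i + ε * ρ i) (fun i => by
      simp only [LinearMap.add_apply, LinearMap.smul_apply, LinearMap.sub_apply,
        LinearMap.comp_apply]
      rw [hcomm, hμ, add_smul, mul_smul]) x
    simp only [LinearMap.add_apply, LinearMap.smul_apply, LinearMap.sub_apply,
      LinearMap.comp_apply, inner_add_right, inner_sub_right, real_inner_smul_right] at hD
    have hsk := hskew x (T₀ x)
    have e1 : (inner ℝ y (T₀ y) : ℝ) + ε * inner ℝ y (T₁ y) =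
        (∑ k, (μ k + ε * ρ k) * (inner ℝ (φ k) x : ℝ) ^ 2) +
        ε ^ 2 * (inner ℝ (X x) (T₀ (X x)) + inner ℝ (X x) (T₁ x) + inner ℝ x (T₁ (X x)) +
          ε * inner ℝ (X x) (T₁ (X x))) := by
      rw [← hD, hyx]
      simp only [map_add, map_smul, inner_add_left, inner_add_right, real_inner_smul_left,
        real_inner_smul_right]
      rw [hsk]
      ring
    have hb : ∀ (u v : E) (p q : ℝ), 0 ≤ p → 0 ≤ q → ‖u‖ ≤ p * ‖x‖ → ‖v‖ ≤ q * ‖x‖ →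
        |(inner ℝ u v : ℝ)| ≤ p * q * ‖x‖ ^ 2 := by
      intro u v p q hp hq hu hv
      calc |(inner ℝ u v : ℝ)| ≤ ‖u‖ * ‖v‖ := abs_real_inner_le_norm u v
        _ ≤ (p * ‖x‖) * (q * ‖x‖) := by gcongr
        _ = _ := by ring
    have n0 : ‖T₀ (X x)‖ ≤ c₀ * c * ‖x‖ := (b₀ _).trans (by
      rw [mul_assoc]; exact mul_le_mul_of_nonneg_left (b x) hc₀)
    have n1 : ‖T₁ (X x)‖ ≤ c₁ * c * ‖x‖ := (b₁ _).trans (by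
      rw [mul_assoc]; exact mul_le_mul_of_nonneg_left (b x) hc₁)
    have f0 := hb _ _ c (c₀ * c) hc (by positivity) (b x) n0
    have f1 := hb _ _ c c₁ hc hc₁ (b x) (b₁ x)
    have f2 := hb x _ 1 (c₁ * c) zero_le_one (by positivity) (by rw [one_mul]) n1
    have f3 := hb _ _ c (c₁ * c) hc (by positivity) (b x) n1
    have f3' : |ε * (inner ℝ (X x) (T₁ (X x)) : ℝ)| ≤ c * (c₁ * c) * ‖x‖ ^ 2 := by
      rw [abs_mul, abs_of_pos hε0]
      exact (mul_le_of_le_one_left (abs_nonneg _) hε1).trans f3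
    have hrem : |ε ^ 2 * (inner ℝ (X x) (T₀ (X x)) + inner ℝ (X x) (T₁ x) + inner ℝ x (T₁ (X x)) +
          ε * inner ℝ (X x) (T₁ (X x)) : ℝ)| ≤
        ε ^ 2 * ((c * (c₀ * c) + c * c₁ + c₁ * c + c * (c₁ * c)) * ‖x‖ ^ 2) := by
      rw [abs_mul, abs_of_pos (pow_pos hε0 2)]
      refine mul_le_mul_of_nonneg_left ?_ (sq_nonneg _)
      refine (abs_add_le _ _).trans ((add_le_add ((abs_add_le _ _).trans
        (add_le_add ((abs_add_le _ _).trans (add_le_add f0 f1)) f2)) f3').trans (le_of_eq ?_))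
      ring
    have e2 : (inner ℝ y (T β y) : ℝ) - ∑ k, (μ k + ε * ρ k) * (inner ℝ (φ k) x : ℝ) ^ 2 =
        (inner ℝ y (T β y) - inner ℝ y (T₀ y) - ε * inner ℝ y (T₁ y)) +
        ε ^ 2 * (inner ℝ (X x) (T₀ (X x)) + inner ℝ (X x) (T₁ x) + inner ℝ x (T₁ (X x)) +
          ε * inner ℝ (X x) (T₁ (X x))) := by linear_combination e1
    rw [e2]
    refine (abs_add_le _ _).trans ((add_le_add (h1.trans h2) hrem).trans ?_)
    have : 0 ≤ c ^ 2 * ε ^ 2 * ‖x‖ ^ 2 := by positivity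
    rw [hδ₀]
    linarith
  · rw [hY0]
    exact le_add_of_nonneg_right (by positivity)
  · rw [hY0, add_mul, one_mul]
    have h1 : c ^ 2 ≤ δ₀ := by
      rw [hδ₀]
      exact le_add_of_nonneg_left (by positivity)
    have h2 : ε ^ 2 * ‖X x‖ ^ 2 ≤ ε ^ 2 * (δ₀ * ‖x‖ ^ 2) :=
      mul_le_mul_of_nonneg_left ((hXx x).trans (mul_le_mul_of_nonneg_right h1 (sq_nonneg _)))
        (sq_nonneg _)
    linarith

end LinearMap.IsSymmetric

namespace DunklRootSystem

variable {N : ℕ} {R : DunklRootSystem N} {s : EuclideanSpace ℝ (Fin N)}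

/-! ### The sign of the first-order correction -/

theorem freezingWeight_pos (hs : R.IsCritical s) {α : EuclideanSpace ℝ (Fin N)}
    (hα : α ∈ R.posRoots) : 0 < freezingWeight s α := by
  have h1 := R.norm_pos_of_mem_posRoots hα
  have h2 := hs.inner_pos hα
  unfold freezingWeight
  positivity

/-- The kernel of the frozen generator consists of the constants. -/
theorem apply_eq_apply_one_of_reflSum_eq_zero (hs : R.IsCritical s)
    {φ : EuclideanSpace ℝ R.weylGroup} (h : R.reflSum (freezingWeight s) φ = 0)
    (w : R.weylGroup) : φ w = φ 1 := by
  have h1 : (inner ℝ φ (R.reflSum (freezingWeight s) φ) : ℝ) = 0 := by rw [h, inner_zero_right]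
  have hnn : ∀ α ∈ R.posRoots, 0 ≤ freezingWeight s α / 2 *
      ∑ w, (φ w - φ (w * R.reflElt α)) * (φ w - φ (w * R.reflElt α)) := fun α hα =>
    mul_nonneg (half_pos (freezingWeight_pos hs hα)).le
      (Finset.sum_nonneg fun w _ => mul_self_nonneg _)
  rw [inner_reflSum, Finset.sum_eq_zero_iff_of_nonneg hnn] at h1
  have h2 : ∀ α ∈ R.posRoots, ∀ w, φ (w * R.reflElt α) = φ w := by
    intro α hα w
    have h3 := (mul_eq_zero.1 (h1 α hα)).resolve_left (half_pos (freezingWeight_pos hs hα)).ne'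
    rw [Finset.sum_eq_zero_iff_of_nonneg fun w _ => mul_self_nonneg _] at h3
    exact (sub_eq_zero.1 (mul_self_eq_zero.1 (h3 w (Finset.mem_univ w)))).symm
  have h4 : ∀ v (hv : v ∈ R.weylGroup), ∀ w : R.weylGroup, φ (w * ⟨v, hv⟩) = φ w := by
    intro v hv
    refine Subgroup.closure_induction
      (p := fun v hv => ∀ w : R.weylGroup, φ (w * (⟨v, hv⟩ : R.weylGroup)) = φ w)
      ?_ ?_ ?_ ?_ hv
    · rintro _ ⟨α, hα, rfl⟩ w
      rcases R.mem_posRoots_or_neg hα with h5 | h5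
      · have e : (⟨dunklRefl α, Subgroup.subset_closure ⟨α, hα, rfl⟩⟩ : R.weylGroup) =
            R.reflElt α := Subtype.ext (coe_reflElt h5).symm
        exact (congrArg (fun v => φ (w * v)) e).trans (h2 α h5 w)
      · have e : (⟨dunklRefl α, Subgroup.subset_closure ⟨α, hα, rfl⟩⟩ : R.weylGroup) =
            R.reflElt (-α) := Subtype.ext (by rw [coe_reflElt h5, dunklRefl_neg])
        exact (congrArg (fun v => φ (w * v)) e).trans (h2 _ h5 w)
    · intro w
      exact congrArg _ (mul_one w)
    · intro x y hx hy ihx ihy w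
      have : w * ⟨x * y, mul_mem hx hy⟩ = (w * ⟨x, hx⟩ : R.weylGroup) * ⟨y, hy⟩ :=
        Subtype.ext (mul_assoc w.1 x y).symm
      exact (congrArg _ this).trans ((ihy _).trans (ihx w))
    · intro x hx ih w
      have e : (w * ⟨x⁻¹, inv_mem hx⟩ * ⟨x, hx⟩ : R.weylGroup) = w :=
        Subtype.ext (inv_mul_cancel_right w.1 x)
      exact (ih (w * ⟨x⁻¹, inv_mem hx⟩)).symm.trans (congrArg (fun v => φ v) e)
  have h5 := h4 w.1 w.2 1
  rwa [one_mul] at h5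

theorem tendsto_mul_sub_of_isBigO {f : ℝ → ℝ} {a c : ℝ}
    (h : (fun β : ℝ => f β - a - β⁻¹ * c) =O[atTop] fun β : ℝ => β⁻¹ ^ 2) :
    Tendsto (fun β : ℝ => β * (f β - a)) atTop (𝓝 c) := by
  have h1 := ((Asymptotics.isBigO_refl (fun β : ℝ => β) atTop).mul h).trans_tendsto
    (tendsto_inv_atTop_zero.congr' (by
      filter_upwards [eventually_gt_atTop 0] with β hβ
      field_simp))
  have h2 := h1.add_const c
  rw [zero_add] at h2
  refine h2.congr' ?_
  filter_upwards [eventually_gt_atTop 0] with β hβ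
  field_simp
  ring

theorem tendsto_of_isBigO {f : ℝ → ℝ} {a c : ℝ}
    (h : (fun β : ℝ => f β - a - β⁻¹ * c) =O[atTop] fun β : ℝ => β⁻¹ ^ 2) :
    Tendsto f atTop (𝓝 a) := by
  have h1 := (tendsto_inv_atTop_zero.mul (tendsto_mul_sub_of_isBigO h)).add_const a
  rw [zero_mul, zero_add] at h1
  refine h1.congr' ?_
  filter_upwards [eventually_gt_atTop 0] with β hβ
  field_simp
  ring

/-- On a nonconstant eigenfunction of the frozen generator the first-order correction of the jump
rates gives a strictly positive Dirichlet form. -/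
theorem inner_reflSum_correction_pos (hs : R.IsCritical s) {c : EuclideanSpace ℝ (Fin N) → ℝ}
    (hc : ∀ α ∈ R.posRoots, (fun β : ℝ => R.meanSq s β α - 1 - β⁻¹ * c α)
      =O[atTop] fun β : ℝ => β⁻¹ ^ 2) {φ : EuclideanSpace ℝ R.weylGroup} (hφ : φ ≠ 0) {m : ℕ}
    (hm : 0 < m) (hφm : R.reflSum (freezingWeight s) φ = (m : ℝ) • φ) :
    0 < (inner ℝ φ (R.reflSum (fun α => freezingWeight s α * c α) φ) : ℝ) := by
  obtain ⟨m', hm', ⟨p, hp, hpe, hpr⟩, horth⟩ := exists_polynomial_lift hs hφ hφm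
  obtain rfl : m = m' := by exact_mod_cast hm'
  obtain ⟨V, hV, hpos⟩ := exists_hess_inverse_gradient hs hφ hm hφm horth hp hpe hpr
  have h1 := tendsto_mul_inner_reflSum hs hφm horth hp hpe hpr hV
  have h2 : Tendsto (fun β : ℝ => β *
      ((inner ℝ φ (R.reflSum (fun α => freezingWeight s α * R.meanSq s β α) φ) : ℝ) -
      m * inner ℝ φ φ)) atTop
      (𝓝 (inner ℝ φ (R.reflSum (fun α => freezingWeight s α * c α) φ))) := by
    have h3 : (m : ℝ) * inner ℝ φ φ = inner ℝ φ (R.reflSum (freezingWeight s) φ) := by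
      rw [hφm, real_inner_smul_right]
    rw [h3]
    simp only [inner_reflSum]
    have h4 : Tendsto (fun β : ℝ => ∑ α ∈ R.posRoots, freezingWeight s α *
        (β * (R.meanSq s β α - 1)) / 2 *
        ∑ w, (φ w - φ (w * R.reflElt α)) * (φ w - φ (w * R.reflElt α))) atTop
        (𝓝 (∑ α ∈ R.posRoots, freezingWeight s α * c α / 2 *
        ∑ w, (φ w - φ (w * R.reflElt α)) * (φ w - φ (w * R.reflElt α)))) :=
      tendsto_finsetSum _ fun α hα =>
        (((tendsto_mul_sub_of_isBigO (hc α hα)).const_mul _).div_const 2).mul_const _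
    refine h4.congr fun β => ?_
    rw [← Finset.sum_sub_distrib, Finset.mul_sum]
    exact Finset.sum_congr rfl fun α _ => by ring
  rw [tendsto_nhds_unique h2 h1]
  exact hpos

theorem abs_inner_reflSum_le (d : EuclideanSpace ℝ (Fin N) → ℝ) (φ : EuclideanSpace ℝ R.weylGroup) :
    |(inner ℝ φ (R.reflSum d φ) : ℝ)| ≤ (∑ α ∈ R.posRoots, 2 * |d α|) * ‖φ‖ ^ 2 := by
  rw [inner_reflSum, Finset.sum_mul]
  refine (Finset.abs_sum_le_sum_abs _ _).trans (Finset.sum_le_sum fun α _ => ?_)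
  have h1 : ∑ w, (φ w - φ (w * R.reflElt α)) * (φ w - φ (w * R.reflElt α)) ≤ 4 * ‖φ‖ ^ 2 := by
    rw [← real_inner_self_eq_norm_sq, inner_eq_sum]
    have h2 := sum_mul_reflElt (R := R) α fun w => φ w * φ w
    calc _ ≤ ∑ w, (2 * (φ w * φ w) + 2 * (φ (w * R.reflElt α) * φ (w * R.reflElt α))) :=
          Finset.sum_le_sum fun w _ => by nlinarith [sq_nonneg (φ w + φ (w * R.reflElt α))]
      _ = _ := by
          rw [Finset.sum_add_distrib, ← Finset.mul_sum, ← Finset.mul_sum, h2]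
          ring
  rw [abs_mul, abs_div, abs_of_pos (zero_lt_two (α := ℝ)),
    abs_of_nonneg (show 0 ≤ ∑ w, (φ w - φ (w * R.reflElt α)) * (φ w - φ (w * R.reflElt α)) from
      Finset.sum_nonneg fun w _ => mul_self_nonneg _)]
  calc |d α| / 2 * _ ≤ |d α| / 2 * (4 * ‖φ‖ ^ 2) := by gcongr
    _ = _ := by ring

end DunklRootSystem

open DunklRootSystem

theorem mainTheorem4 {N : ℕ} (R : DunklRootSystem N) :
    ∃ (M₀ : Matrix R.weylGroup R.weylGroup ℝ) (hM₀ : M₀.IsHermitian)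
      (r₁ : Fin (Fintype.card R.weylGroup) → ℝ) (C : ℝ → ℝ) (A K : ℝ),
      Tendsto (fun β : ℝ => R.transitionMatrix β) atTop (𝓝 M₀) ∧
      (∀ i : Fin (Fintype.card R.weylGroup), 0 < (i : ℕ) → r₁ i < 0) ∧
      (∀ M : ℝ, 0 < M → 1 < C M ∧ C M ≤ A * (1 + M)) ∧
      ∀ M : ℝ, 0 < M → ∀ β : ℝ, C M < β →
        ∀ i : Fin (Fintype.card R.weylGroup), 0 < (i : ℕ) →
        |R.relaxationExponent β i - -(|hM₀.eigenvalues₀ i| + |r₁ i| / β)|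
          ≤ K * (β⁻¹ ^ 2 + Real.exp (-M)) := by
  obtain ⟨s, hs⟩ := R.exists_isCritical
  choose! c hc using fun α hα => exists_expansion_sq hs (α := α) hα
  have hc' : ∀ α ∈ R.posRoots, (fun β : ℝ => R.meanSq s β α - 1 - β⁻¹ * c α)
      =O[atTop] fun β : ℝ => β⁻¹ ^ 2 := hc
  -- the frozen generator and its first-order correction
  set ℓ : EuclideanSpace ℝ (Fin N) → ℝ := fun α => 1 / 2 * freezingWeight s α with hℓ
  set M₀ := R.rateMatrix ℓ with hM₀def
  set T₁ := -R.reflSum fun α => 1 / 2 * (freezingWeight s α * c α) with hT₁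
  have hsm : ∀ (a : ℝ) (d : EuclideanSpace ℝ (Fin N) → ℝ) (φ : EuclideanSpace ℝ R.weylGroup),
      R.reflSum (fun α => a * d α) φ = a • R.reflSum d φ := by
    intro a d φ
    ext w
    simp only [PiLp.smul_apply, smul_eq_mul, reflSum_apply, Finset.mul_sum, mul_assoc]
  have hlin₀ : Matrix.toEuclideanLin M₀ = -R.reflSum ℓ := toEuclideanLin_rateMatrix ℓ
  have hneg : ∀ d, (-R.reflSum d).IsSymmetric := fun d x y => by
    rw [LinearMap.neg_apply, LinearMap.neg_apply, inner_neg_left, inner_neg_right,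
      reflSum_isSymmetric d]
  have hsym₀ : (Matrix.toEuclideanLin M₀).IsSymmetric := by rw [hlin₀]; exact hneg _
  have hM₀ : M₀.IsHermitian := Matrix.isSymmetric_toEuclideanLin_iff.1 hsym₀
  have hsym₁ : T₁.IsSymmetric := hneg _
  have hsymβ : ∀ β, (Matrix.toEuclideanLin (R.transitionMatrix β)).IsSymmetric := fun β =>
    Matrix.isSymmetric_toEuclideanLin_iff.2 (R.transitionMatrix_isHermitian β)
  have hO := Asymptotics.IsBigO.fun_sum (s := R.posRoots) fun α hα =>
    ((hc' α hα).norm_left.const_mul_left |freezingWeight s α|)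
  obtain ⟨D, hD⟩ := hO.bound
  have hexp : ∀ᶠ β : ℝ in atTop, ∀ x : EuclideanSpace ℝ R.weylGroup,
      |(inner ℝ x (Matrix.toEuclideanLin (R.transitionMatrix β) x) : ℝ) -
        inner ℝ x (Matrix.toEuclideanLin M₀ x) - β⁻¹ * inner ℝ x (T₁ x)| ≤
        D * β⁻¹ ^ 2 * ‖x‖ ^ 2 := by
    filter_upwards [hD, eventually_gt_atTop 0] with β hDβ hβ x
    rw [transitionMatrix_eq, toEuclideanLin_rateMatrix, hlin₀, hT₁]
    have h1 : (inner ℝ x ((-R.reflSum fun α => R.jumpRate β 1 α 0) x) : ℝ) -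
        inner ℝ x ((-R.reflSum ℓ) x) -
        β⁻¹ * inner ℝ x ((-R.reflSum fun α => 1 / 2 * (freezingWeight s α * c α)) x) =
        -inner ℝ x (R.reflSum (fun α => 1 / 2 * (freezingWeight s α *
          (R.meanSq s β α - 1 - β⁻¹ * c α))) x) := by
      simp only [LinearMap.neg_apply, inner_neg_right, inner_reflSum, mul_neg]
      rw [sub_neg_eq_add, sub_neg_eq_add, ← Finset.sum_neg_distrib, ← Finset.sum_neg_distrib,
        Finset.mul_sum, ← Finset.sum_add_distrib, ← Finset.sum_add_distrib]
      refine Finset.sum_congr rfl fun α hα => ?_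
      rw [jumpRate_eq hs hβ hα]
      ring
    rw [h1, abs_neg]
    refine (abs_inner_reflSum_le _ x).trans (mul_le_mul_of_nonneg_right ?_ (sq_nonneg _))
    rw [Real.norm_of_nonneg (by positivity : (0 : ℝ) ≤ β⁻¹ ^ 2)] at hDβ
    refine le_trans (le_of_eq ?_) ((le_abs_self _).trans hDβ)
    refine Finset.sum_congr rfl fun α _ => ?_
    rw [abs_mul, abs_mul, Real.norm_eq_abs, abs_of_pos (one_half_pos (α := ℝ))]
    ring
  obtain ⟨φ, hφ, K, hK⟩ := hsym₀.exists_eigenvalues_expansion hsym₁ hsymβ finrank_euclideanSpace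
    hexp
  obtain ⟨β₁, hβ₁⟩ := eventually_atTop.1 hK
  have hne : ∀ i, φ i ≠ 0 := fun i h0 => by
    have := φ.orthonormal.1 i
    rw [h0, norm_zero] at this
    exact zero_ne_one this
  have heig : ∀ i, R.reflSum (freezingWeight s) (φ i) = (-2 * hM₀.eigenvalues₀ i) • φ i := by
    intro i
    have h1 : (-R.reflSum ℓ) (φ i) = hM₀.eigenvalues₀ i • φ i := by
      rw [← hlin₀]
      exact hφ i
    rw [LinearMap.neg_apply, hℓ, hsm] at h1
    have h2 : R.reflSum (freezingWeight s) (φ i) =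
        (-2 : ℝ) • -((1 / 2 : ℝ) • R.reflSum (freezingWeight s) (φ i)) := by
      rw [smul_neg, smul_smul, ← neg_smul]
      norm_num
    rw [h2, h1, smul_smul]
  have hm : ∀ i, ∃ m : ℕ, -2 * hM₀.eigenvalues₀ i = m := fun i => by
    obtain ⟨m, hm, -⟩ := exists_polynomial_lift hs (hne i) (heig i)
    exact ⟨m, hm⟩
  choose m hm using hm
  have hle : ∀ i, hM₀.eigenvalues₀ i ≤ 0 := fun i => by
    have h1 := hm i
    have h2 : (0 : ℝ) ≤ m i := Nat.cast_nonneg _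
    linarith
  -- zero is a simple eigenvalue, with the constants as eigenvectors
  have hmpos : ∀ i : Fin (Fintype.card R.weylGroup), 0 < (i : ℕ) → 0 < m i := by
    intro i hi
    by_contra hmi
    have hmi0 : m i = 0 := by omega
    have hi0 : hM₀.eigenvalues₀ i = 0 := by
      have := hm i
      rw [hmi0, Nat.cast_zero] at this
      linarith
    set o : Fin (Fintype.card R.weylGroup) := ⟨0, Fintype.card_pos⟩ with ho
    have ho0 : hM₀.eigenvalues₀ o = 0 := le_antisymm (hle o) (by
      rw [← hi0]
      exact hM₀.eigenvalues₀_antitone (Fin.le_def.2 (Nat.zero_le _)))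
    have hconst : ∀ j, hM₀.eigenvalues₀ j = 0 → ∀ w, φ j w = φ j 1 := fun j hj w =>
      apply_eq_apply_one_of_reflSum_eq_zero hs (by rw [heig, hj, mul_zero, zero_smul]) w
    have hoi : o ≠ i := fun h => by
      rw [← h] at hi
      exact lt_irrefl _ hi
    have h1 : (inner ℝ (φ o) (φ i) : ℝ) = 0 := φ.orthonormal.2 hoi
    rw [inner_eq_sum, Finset.sum_congr rfl fun w _ => by rw [hconst o ho0, hconst i hi0],
      Finset.sum_const, Finset.card_univ, nsmul_eq_mul] at h1
    have hcard : (Fintype.card R.weylGroup : ℝ) ≠ 0 := by exact_mod_cast Fintype.card_ne_zero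
    rcases mul_eq_zero.1 ((mul_eq_zero.1 h1).resolve_left hcard) with h2 | h2
    · refine hne o ?_
      ext w
      rw [hconst o ho0, h2]
      rfl
    · refine hne i ?_
      ext w
      rw [hconst i hi0, h2]
      rfl
  have hr₁ : ∀ i : Fin (Fintype.card R.weylGroup), 0 < (i : ℕ) →
      (inner ℝ (φ i) (T₁ (φ i)) : ℝ) < 0 := by
    intro i hi
    have h1 := inner_reflSum_correction_pos hs hc' (hne i) (hmpos i hi) (by rw [heig, hm])
    rw [hT₁, LinearMap.neg_apply, hsm, inner_neg_right, real_inner_smul_right]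
    linarith
  refine ⟨M₀, hM₀, fun i => inner ℝ (φ i) (T₁ (φ i)), fun _ => max β₁ 2, max β₁ 2, |K|, ?_, hr₁,
    fun M hM => ⟨lt_of_lt_of_le one_lt_two (le_max_right _ _), ?_⟩, ?_⟩
  · refine tendsto_pi_nhds.2 fun τ => tendsto_pi_nhds.2 fun ν => ?_
    simp only [transitionMatrix_eq, hM₀def, rateMatrix, Matrix.of_apply]
    refine tendsto_finsetSum _ fun α hα => Tendsto.mul_const _ ?_
    have h1 := ((tendsto_of_isBigO (hc' α hα)).const_mul (freezingWeight s α)).const_mul (1 / 2)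
    rw [mul_one] at h1
    refine h1.congr' ?_
    filter_upwards [eventually_gt_atTop 0] with β hβ
    exact (jumpRate_eq hs hβ hα).symm
  · have : (0 : ℝ) < max β₁ 2 := lt_of_lt_of_le zero_lt_two (le_max_right _ _)
    nlinarith
  · intro M hM β hβ i hi
    have hβ2 : 2 < β := lt_of_le_of_lt (le_max_right _ _) hβ
    have h1 := hβ₁ β ((le_max_left _ _).trans hβ.le) i
    rw [abs_of_nonpos (hle i), abs_of_neg (hr₁ i hi)]
    have h2 : R.relaxationExponent β i - -(-hM₀.eigenvalues₀ i +
        -inner ℝ (φ i) (T₁ (φ i)) / β) =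
        (hsymβ β).eigenvalues finrank_euclideanSpace i -
          hsym₀.eigenvalues finrank_euclideanSpace i - β⁻¹ * inner ℝ (φ i) (T₁ (φ i)) := by
      change (hsymβ β).eigenvalues finrank_euclideanSpace i -
        -(-hsym₀.eigenvalues finrank_euclideanSpace i + _) = _
      rw [div_eq_mul_inv]
      ring
    rw [h2]
    refine h1.trans ?_
    have h3 : (0 : ℝ) ≤ β⁻¹ ^ 2 := by positivity
    calc K * β⁻¹ ^ 2 ≤ |K| * β⁻¹ ^ 2 := mul_le_mul_of_nonneg_right (le_abs_self K) h3
      _ ≤ _ := mul_le_mul_of_nonneg_left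
          (le_add_of_nonneg_right (Real.exp_pos _).le) (abs_nonneg K)
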